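/- Let $k$ be a commutative ring. Complexes are cochain complexes of $k$-modules; all signs are given by the Koszul rule. $[n]$ denotes the ordinal $\{0<\dots<n\}$. **Transformations.** For dg functors $F,G:A\to B$ between small dg categories over $k$ let $$\mathrm{shom}^{[n]}(F,G)=\prod_{X:[n]\to \mathrm{Ob}A}\mathrm{Hom}_k\Big(\bigotimes_{i=0}^{n-1}A(X_i,X_{i+1}),\,B(FX_0,GX_n)\Big),$$ a cosimplicial complex: for $\sigma:[m]\to[n]$ and a chain $U$ over $X:[n]\to\mathrm{Ob} A$, compose (inserting identities) consecutive morphisms of $U$ into a chain $U'$ over $X\circ\sigma$ and two outer morphisms $\alpha:X_0\to X_{\sigma(0)}$, $\omega:X_{\sigma(m)}\to X_n$, and put $(\sigma_*\Phi)(U)=(-1)^{|\Phi||\omega|}G(\omega)\circ\Phi(U')\circ F(\alpha)$. Write $\mathrm{Rhom}^\bullet=\mathrm{shom}^\bullet$ (derived natural transformations). Let $\hom(F,G)$ (naive natural transformations) be the equalizer of the two cofaces $\mathrm{shom}^{[0]}(F,G)\rightrightarrows\mathrm{shom}^{[1]}(F,G)$, let $\hom^{\bullet}(F,G)$ be the constant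 cosimplicial complex with value $\hom(F,G)$, and map $\hom^{[n]}(F,G)\to\mathrm{shom}^{[n]}(F,G)$ by restricting $\sigma_*$, $\sigma:[0]\to[n]$. **2-ordinals.** A 2-ordinal $\mathcal U$ is a finite non-empty ordinal $c_0<\dots<c_N$ together with a finite non-empty ordinal $\mathcal F_c$ of arrows $c_{j}\to c_{j+1}$ for each consecutive pair $c=(c_j,c_{j+1})$; its 2-cells $f$ are the pairs of consecutive arrows in some $\mathcal F_c$, and we write $\pi(f)=c$; 2-cells are ordered lexicographically. $\mathcal U$ generates freely a strict 2-category $[\mathcal U]$ whose 1-arrows are paths and whose Hom categories are posets. A map $P:\mathcal U\to\mathcal V$ is a 2-functor $[\mathcal V]\to[\mathcal U]$ that is monotone on objects, preserves the first and last object, and preserves least and greatest paths. For a 2-cell $f$ of $\mathcal V$, $P^{-1}f\subset\mathcal U$ is the 2-ordinal of what lies between the images of the two arrows of $f$. A diagram $D$ over $\mathcal U$ assigns dg categories to objects and dg functors to arrows; $D|_f$ is the pair of functors at the 2-cell $f$, and $p_*D$ is the pair (composite of the least arrows, composite of the greatest arrows). A colouring attaches an ordinal $I_f$ of the form $[n]$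 to each 2-cell and one more such ordinal $J$. **The operads.** An element of $\mathbf{seq}(\mathcal U,(I_f),J)$ is a total order on $\mathcal I=\bigsqcup_f I_f$ with a monotone map $W:\mathcal I\to J$ such that (1) the order extends those of the $I_f$; (2) if $i_1<i<i_2$, $i_1,i_2\in I_f$, $i\in I_{f_1}$, $f_1\ne f$, then $\pi(f_1)<\pi(f)$; (3) if $\pi(f_1)=\pi(f_2)$ and $f_1<f_2$ then $I_{f_1}<I_{f_2}$. For a map $P:\mathcal U\to\mathcal V$, elements $\lambda_f\in\mathbf{seq}(P^{-1}f)$ and $\lambda\in\mathbf{seq}(\mathcal V)$ (with matching colours) are composed as follows: the maps belonging to the $\lambda_f$ give $M:\mathcal I_{\mathcal U}\to\mathcal I_{\mathcal V}$; elements of $\mathcal I_{\mathcal U}$ are compared through $M$, and through $\lambda_f$ when they have the same image; the new monotone map is $W_\lambda\circ M$. The trivial coloured 2-operad $\mathcal T$ has $\mathcal T(\mathcal U,(I_f),J)=\{1\}$ for all coloured 2-ordinals. **The action.** Each $e\in\mathbf{seq}(\mathcal U,(I_f),J)$ and each diagram $D$ over $\mathcal U$ give a map $$e_*:\bigotimes_f\mathrm{shom}^{I_f}(D|_f)\to\mathrm{shom}^{J}(p_*D),$$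 whose value on $(h_f)$ at a chain $U$ over $X:J\to\mathrm{Ob}\,D(c_0)$ is computed column by column. The chain in $D(c_j)$ already obtained carries the elements of the $I_f$ with $\pi(f)\ge(c_j,c_{j+1})$ as marks, placed monotonically on its vertices; initially the chain is $U$ and the marks are placed by $W$. In the column $c=(c_j,c_{j+1})$, the 2-cells $f_1<\dots<f_m$ of $c$ occupy successive intervals of the chain. Before the first mark of $f_1$, between the last mark of $f_i$ and the first mark of $f_{i+1}$, and after the last mark of $f_m$, apply to every morphism the first, the $(i+1)$-st, and the last functor of $\mathcal F_c$, respectively; replace the interval occupied by $f_i$ by the single morphism obtained by composing the morphisms between consecutive marks of $f_i$ (identities where there are none) and applying $h_{f_i}$. This gives the chain in $D(c_{j+1})$; the remaining marks keep their places in the order. Finally all morphisms of the chain in $D(c_N)$ are composed. **Proposition.** Let $F,G$, $\mathcal U$, $D$, $e$ be arbitrary as above. 1. The maps $\hom^\bullet(F,G)\to\mathrm{Rhom}^\bullet(F,G)$ are injective maps of cosimplicial complexes, and $\hom^\bullet$ is a $\mathbf{seq}$-subalgebra of $\mathrm{Rhom}^\bullet$: $e_*$ maps $\bigotimes_f\hom^{I_f}(D|_f)$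 into $\hom^J(p_*D)$, and these restricted maps are maps of complexes that are compatible with the compositions of $\mathbf{seq}$, so that they make $\hom^\bullet$ an algebra over $\mathbf{seq}$. 2. The $\mathbf{seq}$-action on $\hom^\bullet$ factors through the projection $\mathbf{seq}\to\mathcal T$: there is a $\mathcal T$-algebra structure on $\hom^\bullet$ (maps of complexes $\bigotimes_f\hom^{I_f}(D|_f)\to\hom^J(p_*D)$ compatible with all maps of coloured 2-ordinals) whose pull-back along $\mathbf{seq}\to\mathcal T$ is the restricted action. In particular the restriction of $e_*$ to $\hom^\bullet$ does not depend on $e\in\mathbf{seq}(\mathcal U,(I_f),J)$. -/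

import Mathlib

universe u v w

/-- A small dg category over `k`. The complex of morphisms `x ⟶ y` is presented by its total
module `Hom x y`, its internal grading `deg x y`, and its differential `d` of degree `1`.
`comp g f` is the composite `g ∘ f`. -/
structure DGCat (k : Type u) [CommRing k] where
  Obj : Type v
  Hom : Obj → Obj → Type w
  [grp : ∀ x y, AddCommGroup (Hom x y)]
  [mod : ∀ x y, Module k (Hom x y)]
  deg : ∀ x y, ℤ → Submodule k (Hom x y)
  internal : ∀ x y, DirectSum.IsInternal (deg x y)
  d : ∀ x y, Hom x y →ₗ[k] Hom x y
  d_mem : ∀ {x y} {n : ℤ} {f : Hom x y}, f ∈ deg x y n → d x y f ∈ deg x y (n + 1)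
  d_d : ∀ {x y} (f : Hom x y), d x y (d x y f) = 0
  one : ∀ x, Hom x x
  one_mem : ∀ x, one x ∈ deg x x 0
  comp : ∀ {x y z}, Hom y z →ₗ[k] Hom x y →ₗ[k] Hom x z
  comp_mem : ∀ {x y z} {m n : ℤ} {g : Hom y z} {f : Hom x y},
    g ∈ deg y z m → f ∈ deg x y n → comp g f ∈ deg x z (m + n)
  one_comp : ∀ {x y} (f : Hom x y), comp (one y) f = f
  comp_one : ∀ {x y} (f : Hom x y), comp f (one x) = f
  assoc : ∀ {x y z t} (h : Hom z t) (g : Hom y z) (f : Hom x y),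
    comp (comp h g) f = comp h (comp g f)
  leibniz : ∀ {x y z} {m : ℤ} {g : Hom y z} (f : Hom x y), g ∈ deg y z m →
    d x z (comp g f) = comp (d y z g) f + Int.negOnePow m • comp g (d x y f)

attribute [instance] DGCat.grp DGCat.mod

section

variable {k : Type u} [CommRing k]

/-- A dg functor: a functor given on morphisms by morphisms of complexes. -/
structure DGFunctor (A B : DGCat.{u, v, w} k) where
  obj : A.Obj → B.Obj
  map : ∀ {x y}, A.Hom x y →ₗ[k] B.Hom (obj x) (obj y)
  map_mem : ∀ {x y} {n : ℤ} {f : A.Hom x y}, f ∈ A.deg x y n → map f ∈ B.deg (obj x) (obj y) n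
  map_d : ∀ {x y} (f : A.Hom x y), map (A.d x y f) = B.d _ _ (map f)
  map_one : ∀ x, map (A.one x) = B.one (obj x)
  map_comp : ∀ {x y z} (g : A.Hom y z) (f : A.Hom x y),
    map (A.comp g f) = B.comp (map g) (map f)

namespace DGFunctor

/-- The identity dg functor. -/
def id (A : DGCat.{u, v, w} k) : DGFunctor A A where
  obj x := x
  map := LinearMap.id
  map_mem h := h
  map_d _ := rfl
  map_one _ := rfl
  map_comp _ _ := rfl

/-- The composite dg functor `G ∘ F`. -/
def comp {A B C : DGCat.{u, v, w} k} (F : DGFunctor A B) (G : DGFunctor B C) :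
    DGFunctor A C where
  obj x := G.obj (F.obj x)
  map := G.map ∘ₗ F.map
  map_mem h := G.map_mem (F.map_mem h)
  map_d f := by simp [F.map_d, G.map_d]
  map_one x := by simp [F.map_one, G.map_one]
  map_comp g f := by simp [F.map_comp, G.map_comp]

end DGFunctor

namespace DGCat

/-- The operator acting on morphisms of degree `n` as the Koszul sign `(-1) ^ (e * n)`. -/
noncomputable def kos (A : DGCat.{u, v, w} k) (e : ℤ) {x y : A.Obj} :
    A.Hom x y →ₗ[k] A.Hom x y :=
  (DirectSum.toModule k ℤ (A.Hom x y)
      (fun n => ((Int.negOnePow (e * n) : ℤˣ) : ℤ) • (A.deg x y n).subtype)) ∘ₗ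
    (LinearEquiv.ofBijective (DirectSum.coeLinearMap (A.deg x y)) (A.internal x y)).symm.toLinearMap

theorem kos_of_mem (A : DGCat.{u, v, w} k) (e : ℤ) {x y : A.Obj} {n : ℤ} {f : A.Hom x y}
    (hf : f ∈ A.deg x y n) : A.kos e f = Int.negOnePow (e * n) • f := by
  have h : (LinearEquiv.ofBijective (DirectSum.coeLinearMap (A.deg x y)) (A.internal x y)).symm f
      = DirectSum.lof k ℤ (fun n => A.deg x y n) n ⟨f, hf⟩ := by
    refine (LinearEquiv.symm_apply_eq _).2 ?_
    exact (DirectSum.coeLinearMap_lof (A.deg x y) n ⟨f, hf⟩).symm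
  simp only [kos, LinearMap.comp_apply, LinearEquiv.coe_coe, h, DirectSum.toModule_lof]
  simp [Units.smul_def]

theorem kos_mem (A : DGCat.{u, v, w} k) (e : ℤ) {x y : A.Obj} {n : ℤ} {f : A.Hom x y}
    (hf : f ∈ A.deg x y n) : A.kos e f ∈ A.deg x y n := by
  rw [A.kos_of_mem e hf, Units.smul_def]
  exact zsmul_mem hf _

theorem d_kos (A : DGCat.{u, v, w} k) {x y : A.Obj} (f : A.Hom x y) :
    A.d x y (A.kos 1 f) = -A.kos 1 (A.d x y f) := by
  have hf : f ∈ ⨆ n, A.deg x y n := by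
    rw [(A.internal x y).submodule_iSup_eq_top]; trivial
  induction hf using Submodule.iSup_induction' with
  | mem n f hf =>
    rw [A.kos_of_mem 1 hf, A.kos_of_mem 1 (A.d_mem hf), one_mul, one_mul, Int.negOnePow_succ,
      Units.smul_def, Units.smul_def, map_zsmul, Units.val_neg, neg_smul, neg_neg]
  | zero => simp
  | add f g _ _ hf hg => simp only [map_add, hf, hg, neg_add]

/-- The identity morphism, regarded as a morphism between two equal objects. -/
def eqHom (A : DGCat.{u, v, w} k) {x y : A.Obj} (h : x = y) : A.Hom x y :=
  match y, h with
  | _, rfl => A.one x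

/-- For a chain `u` over `X : [n] → A`, the composite `X a ⟶ X b` of the consecutive morphisms
between `a` and `b` when `a ≤ b` (and `0` when `b < a`). -/
def chainComp (A : DGCat.{u, v, w} k) {n : ℕ} (X : Fin (n + 1) → A.Obj)
    (u : ∀ i : Fin n, A.Hom (X i.castSucc) (X i.succ)) (a b : Fin (n + 1)) : A.Hom (X a) (X b) :=
  Fin.induction (motive := fun b => A.Hom (X a) (X b))
    (if h : a = 0 then A.eqHom (congrArg X h) else 0)
    (fun i v => if h : a = i.succ then A.eqHom (congrArg X h) else A.comp (u i) v) b

end DGCat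

/-! Functions of a family of vectors that are linear in the coordinates in `S` and do not depend
on the others. -/

/-- `f` is additive and homogeneous in the coordinates satisfying `S`, and does not depend on the
remaining coordinates. -/
def LinOn (k : Type u) [CommRing k] {n : ℕ} {V : Fin n → Type w} [∀ i, AddCommGroup (V i)]
    [∀ i, Module k (V i)] {M : Type w} [AddCommGroup M] [Module k M] (S : Fin n → Prop)
    (f : (∀ i, V i) → M) : Prop :=
  ∀ i, (S i → (∀ u x y, f (Function.update u i (x + y)) =
          f (Function.update u i x) + f (Function.update u i y)) ∧
        ∀ u (c : k) x, f (Function.update u i (c • x)) = c • f (Function.update u i x)) ∧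
    (¬ S i → ∀ u x, f (Function.update u i x) = f u)

section LinOn

variable {n : ℕ} {V : Fin n → Type w} [∀ i, AddCommGroup (V i)] [∀ i, Module k (V i)]
  {M N P : Type w} [AddCommGroup M] [Module k M] [AddCommGroup N] [Module k N]
  [AddCommGroup P] [Module k P]

theorem LinOn.zero (S : Fin n → Prop) : LinOn k S (fun _ : (∀ i, V i) => (0 : M)) := by
  intro i; simp

theorem LinOn.const {S : Fin n → Prop} (hS : ∀ i, ¬ S i) (m : M) :
    LinOn k S (fun _ : (∀ i, V i) => m) := by
  intro i; simp [hS i]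

theorem LinOn.congr {S T : Fin n → Prop} {f : (∀ i, V i) → M} (h : LinOn k S f)
    (hST : ∀ i, S i ↔ T i) : LinOn k T f := by
  have : S = T := funext fun i => propext (hST i)
  exact this ▸ h

theorem LinOn.linear {S : Fin n → Prop} {f : (∀ i, V i) → M} (h : LinOn k S f)
    (φ : M →ₗ[k] N) : LinOn k S (fun u => φ (f u)) := by
  intro i
  refine ⟨fun hi => ⟨fun u x y => ?_, fun u c x => ?_⟩, fun hi u x => ?_⟩
  · simp [((h i).1 hi).1]
  · simp [((h i).1 hi).2]
  · simp [(h i).2 hi]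

theorem LinOn.bilinear {S T R : Fin n → Prop} {f : (∀ i, V i) → M} {g : (∀ i, V i) → N}
    (hf : LinOn k S f) (hg : LinOn k T g) (φ : M →ₗ[k] N →ₗ[k] P)
    (hd : ∀ i, S i → ¬ T i) (hR : ∀ i, R i ↔ S i ∨ T i) :
    LinOn k R (fun u => φ (f u) (g u)) := by
  intro i
  by_cases hS : S i
  · have hT := hd i hS
    refine ⟨fun _ => ⟨fun u x y => ?_, fun u c x => ?_⟩, fun hi => absurd ((hR i).2 (.inl hS)) hi⟩
    · simp [((hf i).1 hS).1, (hg i).2 hT]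
    · simp [((hf i).1 hS).2, (hg i).2 hT]
  · by_cases hT : T i
    · refine ⟨fun _ => ⟨fun u x y => ?_, fun u c x => ?_⟩,
        fun hi => absurd ((hR i).2 (.inr hT)) hi⟩
      · simp [((hg i).1 hT).1, (hf i).2 hS]
      · simp [((hg i).1 hT).2, (hf i).2 hS]
    · refine ⟨fun hi => absurd ((hR i).1 hi) (by tauto), fun _ u x => ?_⟩
      simp [(hf i).2 hS, (hg i).2 hT]

theorem LinOn.multilinear {m : ℕ} {E : Fin m → Type w} [∀ i, AddCommGroup (E i)]
    [∀ i, Module k (E i)] (φ : MultilinearMap k E M) {S : Fin m → Fin n → Prop}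
    {T : Fin n → Prop} {g : (∀ i, V i) → ∀ j, E j} (hg : ∀ j, LinOn k (S j) (fun u => g u j))
    (hd : ∀ i j j', S j i → S j' i → j = j') (hT : ∀ i, T i ↔ ∃ j, S j i) :
    LinOn k T (fun u => φ (g u)) := by
  classical
  intro i
  by_cases hi : T i
  · obtain ⟨j, hj⟩ := (hT i).1 hi
    have key : ∀ u x, g (Function.update u i x) =
        Function.update (g u) j (g (Function.update u i x) j) := by
      intro u x
      funext j'
      by_cases h : j' = j
      · subst h; simp
      · rw [Function.update_of_ne h]
        exact (hg j' i).2 (fun h' => h (hd i j' j h' hj)) u x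
    refine ⟨fun _ => ⟨fun u x y => ?_, fun u c x => ?_⟩, fun h => absurd hi h⟩
    · beta_reduce
      have e := ((hg j i).1 hj).1 u x y
      beta_reduce at e
      rw [key u (x + y), key u x, key u y, e, φ.map_update_add]
    · beta_reduce
      have e := ((hg j i).1 hj).2 u c x
      beta_reduce at e
      rw [key u (c • x), key u x, e, φ.map_update_smul]
  · refine ⟨fun h => absurd h hi, fun _ u x => ?_⟩
    have : g (Function.update u i x) = g u := by
      funext j
      exact (hg j i).2 (fun h => hi ((hT i).2 ⟨j, h⟩)) u x
    beta_reduce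
    rw [this]

/-- A function linear in every coordinate, as a multilinear map. -/
def LinOn.toMultilinear {S : Fin n → Prop} {f : (∀ i, V i) → M} (h : LinOn k S f)
    (hS : ∀ i, S i) : MultilinearMap k V M where
  toFun := f
  map_update_add' {dec} u i x y := by
    have : dec = instDecidableEqFin n := Subsingleton.elim _ _
    subst this
    exact ((h i).1 (hS i)).1 u x y
  map_update_smul' {dec} u i c x := by
    have : dec = instDecidableEqFin n := Subsingleton.elim _ _
    subst this
    exact ((h i).1 (hS i)).2 u c x

end LinOn

/-- Any position between two terms of a sequence in `Fin` lies between two consecutive terms. -/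
theorem exists_between_consecutive {m n : ℕ} (W : Fin (m + 1) → Fin (n + 1)) (i : Fin n)
    (h0 : W 0 ≤ i.castSucc) (h1 : i.castSucc < W (Fin.last m)) :
    ∃ j : Fin m, W j.castSucc ≤ i.castSucc ∧ i.castSucc < W j.succ := by
  by_contra hc
  push Not at hc
  have : ∀ j, W j ≤ i.castSucc := Fin.induction h0 (fun j hj => hc j hj)
  exact absurd h1 (not_lt.2 (this _))

theorem consecutive_unique {m n : ℕ} {W : Fin (m + 1) → Fin (n + 1)} (hW : Monotone W) (i : Fin n)
    {j j' : Fin m} (h1 : W j.castSucc ≤ i.castSucc ∧ i.castSucc < W j.succ)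
    (h2 : W j'.castSucc ≤ i.castSucc ∧ i.castSucc < W j'.succ) : j = j' := by
  rcases lt_trichotomy j j' with h | h | h
  · have := hW (show j.succ ≤ j'.castSucc from Fin.succ_le_castSucc_iff.2 h)
    exact absurd (h1.2.trans_le (this.trans h2.1)) (lt_irrefl _)
  · exact h
  · have := hW (show j'.succ ≤ j.castSucc from Fin.succ_le_castSucc_iff.2 h)
    exact absurd (h2.2.trans_le (this.trans h1.1)) (lt_irrefl _)

namespace DGCat

theorem chainComp_of_lt (A : DGCat.{u, v, w} k) {n : ℕ} (X : Fin (n + 1) → A.Obj)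
    (u : ∀ i : Fin n, A.Hom (X i.castSucc) (X i.succ)) (a b : Fin (n + 1)) (h : b < a) :
    A.chainComp X u a b = 0 := by
  induction b using Fin.induction with
  | zero => simp [chainComp, h.ne']
  | succ i ih =>
    have h1 : a ≠ i.succ := h.ne'
    have h2 := ih ((Fin.castSucc_lt_succ).trans h)
    simp only [chainComp, Fin.induction_succ, h1, dite_false] at h2 ⊢
    rw [h2, map_zero]

theorem chainComp_linOn (A : DGCat.{u, v, w} k) {n : ℕ} (X : Fin (n + 1) → A.Obj)
    (a b : Fin (n + 1)) :
    LinOn k (fun i : Fin n => a ≤ i.castSucc ∧ i.castSucc < b)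
      (fun u : (∀ i : Fin n, A.Hom (X i.castSucc) (X i.succ)) => A.chainComp X u a b) := by
  induction b using Fin.induction with
  | zero =>
    simp only [chainComp, Fin.induction_zero]
    exact LinOn.const (fun i => by simp) _
  | succ b ih =>
    rcases lt_trichotomy a b.succ with h | h | h
    · have h1 : a ≠ b.succ := h.ne
      have h2 : a ≤ b.castSucc := by simpa [Fin.le_def, Fin.lt_def, Nat.lt_succ_iff] using h
      simp only [chainComp, Fin.induction_succ, h1, dite_false] at ih ⊢
      have hb : LinOn k (fun i => i = b)
          (fun u : (∀ i : Fin n, A.Hom (X i.castSucc) (X i.succ)) => u b) := by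
        intro i
        refine ⟨fun hi => ?_, fun hi u x => ?_⟩
        · subst hi; simp
        · exact Function.update_of_ne (fun h => hi h.symm) _ _
      refine hb.bilinear ih A.comp (fun i hi => by simp [hi]) (fun i => ?_)
      simp only [Fin.le_def, Fin.lt_def, Fin.ext_iff, Fin.val_castSucc, Fin.val_succ] at *
      omega
    · subst h
      simp only [chainComp, Fin.induction_succ, dite_true]
      exact LinOn.const (fun i => by simp) _
    · simp only [A.chainComp_of_lt X _ a _ h]
      exact LinOn.zero _

end DGCat

/-! ### The cosimplicial complex of derived natural transformations -/

/-- All families, over `X : [n] → A`, of multilinear maps sending a chain over `X` to a morphism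
`F (X 0) ⟶ G (X n)`. -/
abbrev ShomAmb (n : ℕ) {A B : DGCat.{u, v, w} k} (F G : DGFunctor A B) :=
  ∀ X : Fin (n + 1) → A.Obj,
    MultilinearMap k (fun i : Fin n => A.Hom (X i.castSucc) (X i.succ))
      (B.Hom (F.obj (X 0)) (G.obj (X (Fin.last n))))

section Shom

variable {A B : DGCat.{u, v, w} k}

/-- The degree `p` part of the complex `shom^[n](F, G)`: the families of multilinear maps that
raise degrees by `p`. -/
def shomDeg (n : ℕ) (F G : DGFunctor A B) (p : ℤ) : Submodule k (ShomAmb n F G) where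
  carrier := {Φ | ∀ (X : Fin (n + 1) → A.Obj) (e : Fin n → ℤ) (u : ∀ i : Fin n, A.Hom (X i.castSucc) (X i.succ)),
    (∀ i, u i ∈ A.deg (X i.castSucc) (X i.succ) (e i)) →
      Φ X u ∈ B.deg (F.obj (X 0)) (G.obj (X (Fin.last n))) (p + ∑ i, e i)}
  add_mem' h h' X e u hu := Submodule.add_mem _ (h X e u hu) (h' X e u hu)
  zero_mem' _ _ _ _ := Submodule.zero_mem _
  smul_mem' c _ h X e u hu := Submodule.smul_mem _ c (h X e u hu)

/-- The differential `Φ ↦ d ∘ Φ - (-1) ^ p Φ ∘ d` of `shom^[n](F, G)` in degree `p`. Chains are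
written in the order of composition, `u (n - 1) ⊗ ⋯ ⊗ u 0`, so that applying `d` to the factor
`u i` produces the Koszul sign of the factors `u j` with `i < j`. -/
noncomputable def shomD (n : ℕ) (F G : DGFunctor A B) (p : ℤ) (Φ : ShomAmb n F G) :
    ShomAmb n F G := fun X =>
  (B.d _ _).compMultilinearMap (Φ X) -
    Int.negOnePow p • ∑ i : Fin n, (Φ X).compLinearMap
      (fun j => if i < j then A.kos 1 else if i = j then A.d _ _ else LinearMap.id)

theorem cosimp_linOn {m n : ℕ} (F G : DGFunctor A B) (p : ℤ) (σ : Fin (m + 1) →o Fin (n + 1))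
    (Φ : ShomAmb m F G) (X : Fin (n + 1) → A.Obj) :
    LinOn k (fun _ => True) (fun u : (∀ i : Fin n, A.Hom (X i.castSucc) (X i.succ)) =>
      B.comp (G.map (A.kos p (A.chainComp X u (σ (Fin.last m)) (Fin.last n))))
        (B.comp (Φ (X ∘ σ) (fun i => A.chainComp X u (σ i.castSucc) (σ i.succ)))
          (F.map (A.chainComp X u 0 (σ 0))))) := by
  have h1 := (A.chainComp_linOn X (σ (Fin.last m)) (Fin.last n)).linear (G.map ∘ₗ A.kos p)
  have h3 := (A.chainComp_linOn X 0 (σ 0)).linear F.map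
  have h2 := LinOn.multilinear (Φ (X ∘ σ))
    (T := fun i : Fin n => σ 0 ≤ i.castSucc ∧ i.castSucc < σ (Fin.last m))
    (g := fun u i => A.chainComp X u (σ i.castSucc) (σ i.succ))
    (fun i => A.chainComp_linOn X (σ i.castSucc) (σ i.succ))
    (fun i j j' h h' => consecutive_unique σ.monotone i h h')
    (fun i => ⟨fun h => exists_between_consecutive σ i h.1 h.2,
      fun ⟨j, h⟩ => ⟨(σ.monotone (Fin.zero_le _)).trans h.1,
        h.2.trans_le (σ.monotone (Fin.le_last _))⟩⟩)
  have h0 := σ.monotone (Fin.zero_le (Fin.last m))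
  refine h1.bilinear (h2.bilinear h3 B.comp
    (R := fun i : Fin n => i.castSucc < σ (Fin.last m)) ?_ ?_) B.comp ?_ ?_
  · intro i h h'
    exact absurd h.1 (not_le.2 h'.2)
  · intro i
    refine ⟨fun h => ?_, ?_⟩
    · by_cases h' : σ 0 ≤ i.castSucc
      · exact .inl ⟨h', h⟩
      · exact .inr ⟨Fin.zero_le _, not_le.1 h'⟩
    · rintro (h | h)
      · exact h.2
      · exact h.2.trans_le h0
  · intro i h h'
    exact absurd h.1 (not_le.2 h')
  · intro i
    refine ⟨fun _ => ?_, fun _ => trivial⟩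
    by_cases h' : σ (Fin.last m) ≤ i.castSucc
    · exact .inl ⟨h', Fin.castSucc_lt_last i⟩
    · exact .inr (not_le.1 h')

/-- The map `σ_* : shom^[m](F, G) → shom^[n](F, G)` in degree `p` induced by `σ : [m] → [n]`: a
chain over `X` is composed into a chain over `X ∘ σ` together with the two outer morphisms
`α : X 0 ⟶ X (σ 0)` and `ω : X (σ m) ⟶ X n`, and is sent to
`(-1) ^ (p * deg ω) G ω ∘ Φ(…) ∘ F α`. -/
noncomputable def cosimp {m n : ℕ} (F G : DGFunctor A B) (p : ℤ)
    (σ : Fin (m + 1) →o Fin (n + 1)) : ShomAmb m F G →ₗ[k] ShomAmb n F G where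
  toFun Φ := fun X => (cosimp_linOn F G p σ Φ X).toMultilinear (fun _ => trivial)
  map_add' Φ Ψ := by
    funext X
    ext u
    simp [LinOn.toMultilinear]
  map_smul' c Φ := by
    funext X
    ext u
    simp [LinOn.toMultilinear]

theorem shomD_apply {n : ℕ} {F G : DGFunctor A B} (p : ℤ) (Φ : ShomAmb n F G)
    (X : Fin (n + 1) → A.Obj) (u : ∀ i : Fin n, A.Hom (X i.castSucc) (X i.succ)) :
    shomD n F G p Φ X u = B.d _ _ (Φ X u) - Int.negOnePow p • ∑ i : Fin n, Φ X (fun j =>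
      (if i < j then A.kos 1 else if i = j then A.d _ _ else LinearMap.id) (u j)) := by
  simp only [shomD, sub_apply, smul_apply, sum_apply, LinearMap.compMultilinearMap_apply,
    MultilinearMap.compLinearMap_apply]

theorem shomD_mem {n : ℕ} {F G : DGFunctor A B} {p : ℤ} {Φ : ShomAmb n F G}
    (h : Φ ∈ shomDeg n F G p) : shomD n F G p Φ ∈ shomDeg n F G (p + 1) := by
  intro X e u hu
  have e1 : p + ∑ i, e i + 1 = p + 1 + ∑ i, e i := by ring
  simp only [shomD, sub_apply, smul_apply, sum_apply,
    LinearMap.compMultilinearMap_apply, MultilinearMap.compLinearMap_apply]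
  refine Submodule.sub_mem _ (e1 ▸ B.d_mem (h X e u hu)) ?_
  rw [Units.smul_def]
  refine zsmul_mem (Submodule.sum_mem _ fun i _ => ?_) _
  have e2 : p + ∑ j, (e j + if i = j then 1 else 0) = p + 1 + ∑ j, e j := by
    rw [Finset.sum_add_distrib, Finset.sum_ite_eq]
    simp only [Finset.mem_univ, if_true]
    ring
  refine e2 ▸ h X _ _ fun j => ?_
  by_cases h1 : i < j
  · simpa [h1, h1.ne] using A.kos_mem 1 (hu j)
  · by_cases h2 : i = j
    · subst h2
      simpa using A.d_mem (hu i)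
    · simpa [h1, h2] using hu j

theorem shomD_shomD {n : ℕ} {F G : DGFunctor A B} (p : ℤ) (Φ : ShomAmb n F G) :
    shomD n F G (p + 1) (shomD n F G p Φ) = 0 := by
  funext X
  ext u
  have key : ∑ i : Fin n, ∑ j : Fin n, (Φ X) (fun l =>
      (if j < l then A.kos 1 else if j = l then A.d _ _ else LinearMap.id)
        ((if i < l then A.kos 1 else if i = l then A.d _ _ else LinearMap.id) (u l))) = 0 := by
    rw [← Finset.sum_product']
    refine Finset.sum_involution (fun a _ => (a.2, a.1)) ?_ ?_ ?_ ?_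
    · rintro ⟨i, j⟩ -
      wlog hij : i ≤ j generalizing i j with H
      · exact (add_comm _ _).trans (H j i (le_of_not_ge hij))
      rcases hij.lt_or_eq with hlt | rfl
      · have : (fun l => (if j < l then A.kos 1 else if j = l then A.d _ _ else LinearMap.id)
          ((if i < l then A.kos 1 else if i = l then A.d _ _ else LinearMap.id) (u l))) =
          Function.update (fun l => (if i < l then A.kos 1 else if i = l then A.d _ _ else
            LinearMap.id) ((if j < l then A.kos 1 else if j = l then A.d _ _ else LinearMap.id)
              (u l))) j (-(A.kos 1 (A.d _ _ (u j)))) := by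
          funext l
          rcases lt_trichotomy j l with q | q | q
          · rw [Function.update_of_ne q.ne']
            simp [q, hlt.trans q]
          · subst q
            simp [hlt, A.d_kos]
          · rw [Function.update_of_ne q.ne]
            simp [q.not_gt, q.ne']
        dsimp only
        rw [this, ← neg_one_smul k, MultilinearMap.map_update_smul]
        have e : Function.update (fun l => (if i < l then A.kos 1 else if i = l then A.d _ _ else
            LinearMap.id) ((if j < l then A.kos 1 else if j = l then A.d _ _ else LinearMap.id)
              (u l))) j (A.kos 1 (A.d _ _ (u j))) = (fun l => (if i < l then A.kos 1 else
              if i = l then A.d _ _ else LinearMap.id) ((if j < l then A.kos 1 else if j = l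
              then A.d _ _ else LinearMap.id) (u l))) := by
          rw [Function.update_eq_self_iff]
          simp [hlt]
        rw [e]
        simp
      · have z : (Φ X) (fun l => (if i < l then A.kos 1 else if i = l then A.d _ _ else
          LinearMap.id) ((if i < l then A.kos 1 else if i = l then A.d _ _ else LinearMap.id)
            (u l))) = 0 := (Φ X).map_coord_zero i (by simp [A.d_d])
        simp [z]
    · rintro ⟨i, j⟩ - hne heq
      simp only [Prod.mk.injEq] at heq
      obtain ⟨rfl, -⟩ := heq
      exact hne ((Φ X).map_coord_zero j (by simp [A.d_d]))
    · intro a _; simp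
    · intro a _; rfl
  rw [shomD_apply, shomD_apply]
  simp only [shomD_apply]
  rw [Finset.sum_sub_distrib, ← Finset.smul_sum, key, map_sub, B.d_d, Units.smul_def,
    Units.smul_def, map_zsmul, map_sum, Int.negOnePow_succ, Units.val_neg]
  simp

/-- The `i`-th vertex `[0] → [n]`. -/
def vertex (n : ℕ) (i : Fin (n + 1)) : Fin (0 + 1) →o Fin (n + 1) := OrderHom.const _ i

/-- The degree `p` part of the complex `hom(F, G)` of naive natural transformations: the equalizer
of the two coface maps `shom^[0](F, G) ⇉ shom^[1](F, G)`. -/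
noncomputable def naive (F G : DGFunctor A B) (p : ℤ) : Submodule k (ShomAmb 0 F G) :=
  shomDeg 0 F G p ⊓
    LinearMap.eqLocus (cosimp F G p (vertex 1 0)) (cosimp F G p (vertex 1 1))

/-- The canonical map `hom^[n](F, G) = hom(F, G) → shom^[n](F, G)` in degree `p`. -/
noncomputable def naiveIncl (n : ℕ) (F G : DGFunctor A B) (p : ℤ) :
    ShomAmb 0 F G →ₗ[k] ShomAmb n F G :=
  cosimp F G p (vertex n 0)

/-- The degree `p` part of `hom^[n](F, G)`, as a submodule of `shom^[n](F, G)`. -/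
noncomputable def constNaive (n : ℕ) (F G : DGFunctor A B) (p : ℤ) :
    Submodule k (ShomAmb n F G) :=
  (naive F G p).map (naiveIncl n F G p)

end Shom

/-! ### 2-ordinals -/

/-- A 2-ordinal, realised inside `ℕ × ℕ`: the ordinal of objects is `{a < a + 1 < ⋯ < a + n}` and
the ordinal attached to the arrow from `c` to `c + 1` is `{lo c < ⋯ < hi c}` for
`a ≤ c < a + n` (the other values of `lo` and `hi` are irrelevant). Every 2-ordinal is uniquely
isomorphic to one of this form, up to the choice of `a` and `lo`. -/
structure TwoOrd where
  a : ℕ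
  n : ℕ
  lo : ℕ → ℕ
  hi : ℕ → ℕ
  lo_le_hi : ∀ c, a ≤ c → c < a + n → lo c ≤ hi c

namespace TwoOrd

/-- The 2-cells: `(c, r)` is the cell from the arrow `r` to the arrow `r + 1`, both from `c` to
`c + 1`. -/
def Cell (U : TwoOrd) (c r : ℕ) : Prop :=
  U.a ≤ c ∧ c < U.a + U.n ∧ U.lo c ≤ r ∧ r < U.hi c

/-- The finite set of 2-cells. -/
def cells (U : TwoOrd) : Finset (ℕ × ℕ) :=
  (Finset.Ico U.a (U.a + U.n)).biUnion fun c => (Finset.Ico (U.lo c) (U.hi c)).image (Prod.mk c)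

theorem mem_cells (U : TwoOrd) (f : ℕ × ℕ) : f ∈ U.cells ↔ U.Cell f.1 f.2 := by
  obtain ⟨c, r⟩ := f
  simp [cells, Cell, and_assoc]

/-- The sum of a family of degrees over all 2-cells. -/
def total (U : TwoOrd) (p : ℕ → ℕ → ℤ) : ℤ := ∑ f ∈ U.cells, p f.1 f.2

end TwoOrd

/-- The total order on 2-cells: lexicographic. -/
def CellLT (f g : ℕ × ℕ) : Prop := f.1 < g.1 ∨ (f.1 = g.1 ∧ f.2 < g.2)

/-- The map `ℕ → ℕ` with initial value `base` and increments `len`. -/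
def stepFun (base : ℕ) (len : ℕ → ℕ) : ℕ → ℕ
  | 0 => base
  | d + 1 => stepFun base len d + len d

/-- A map of 2-ordinals `P : U → V`, that is, a 2-functor `[P] : [V] → [U]` which is dominant on
objects and preserves least and greatest arrows. On objects it is `d ↦ stepFun base len d` (a
monotone map); the arrow `g` from `d` to `d + 1` of `V` is sent to the path in `U` from
`stepFun base len d` to `stepFun base len (d + 1)` whose component from `c` to `c + 1` is
`arr d g c`. Only the values at objects and arrows of `V` are relevant. -/
structure TwoOrdMap (U V : TwoOrd) where
  base : ℕ
  len : ℕ → ℕ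
  arr : ℕ → ℕ → ℕ → ℕ
  first : stepFun base len V.a = U.a
  last : stepFun base len (V.a + V.n) = U.a + U.n
  arr_mono : ∀ d, V.a ≤ d → d < V.a + V.n → ∀ g g', V.lo d ≤ g → g ≤ g' → g' ≤ V.hi d →
    ∀ c, stepFun base len d ≤ c → c < stepFun base len (d + 1) → arr d g c ≤ arr d g' c
  arr_lo : ∀ d, V.a ≤ d → d < V.a + V.n →
    ∀ c, stepFun base len d ≤ c → c < stepFun base len (d + 1) → arr d (V.lo d) c = U.lo c
  arr_hi : ∀ d, V.a ≤ d → d < V.a + V.n →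
    ∀ c, stepFun base len d ≤ c → c < stepFun base len (d + 1) → arr d (V.hi d) c = U.hi c

namespace TwoOrdMap

variable {U V : TwoOrd} (P : TwoOrdMap U V)

/-- The map on objects. -/
def obj (d : ℕ) : ℕ := stepFun P.base P.len d

/-- The inverse image of the 2-cell `(d, s)` of `V`, a ball in `U`. -/
def pre (d s : ℕ) (h : V.Cell d s) : TwoOrd where
  a := P.obj d
  n := P.len d
  lo := P.arr d s
  hi := P.arr d (s + 1)
  lo_le_hi c h1 h2 := P.arr_mono d h.1 h.2.1 s (s + 1) h.2.2.1 (Nat.le_succ s) h.2.2.2 c h1 h2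

theorem obj_mono : Monotone P.obj :=
  monotone_nat_of_le_succ fun _ => Nat.le_add_right _ _

theorem cell_of_pre {d s c r : ℕ} (h : V.Cell d s) (hc : (P.pre d s h).Cell c r) :
    U.Cell c r := by
  obtain ⟨h1, h2, h3, h4⟩ := h
  obtain ⟨c1, c2, c3, c4⟩ := hc
  have m1 : P.obj V.a ≤ P.obj d := P.obj_mono h1
  have m2 : P.obj (d + 1) ≤ P.obj (V.a + V.n) := P.obj_mono h2
  have e1 : P.obj V.a = U.a := P.first
  have e2 : P.obj (V.a + V.n) = U.a + U.n := P.last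
  have c1' : P.obj d ≤ c := c1
  have c2' : c < P.obj (d + 1) := c2
  have c3' : P.arr d s c ≤ r := c3
  have c4' : r < P.arr d (s + 1) c := c4
  have l1 := P.arr_mono d h1 h2 (V.lo d) s le_rfl h3 h4.le c c1' c2'
  have l2 := P.arr_mono d h1 h2 (s + 1) (V.hi d) (h3.trans (Nat.le_succ s)) h4 le_rfl c c1' c2'
  rw [P.arr_lo d h1 h2 c c1' c2'] at l1
  rw [P.arr_hi d h1 h2 c c1' c2'] at l2
  refine ⟨?_, ?_, ?_, ?_⟩ <;> omega

/-- Every 2-cell of `U` lies in the inverse image of a 2-cell of `V`. -/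
theorem exists_pre {c r : ℕ} (h : U.Cell c r) :
    ∃ f : ℕ × ℕ, ∃ hf : V.Cell f.1 f.2, (P.pre f.1 f.2 hf).Cell c r := by
  obtain ⟨h1, h2, h3, h4⟩ := h
  have e1 : P.obj V.a = U.a := P.first
  have e2 : P.obj (V.a + V.n) = U.a + U.n := P.last
  obtain ⟨d, d1, d2, d3, d4⟩ : ∃ d, V.a ≤ d ∧ d < V.a + V.n ∧ P.obj d ≤ c ∧ c < P.obj (d + 1) := by
    by_contra hc
    push Not at hc
    have : ∀ i, i ≤ V.n → P.obj (V.a + i) ≤ c := by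
      intro i
      induction i with
      | zero => intro _; simpa [e1] using h1
      | succ i ih => intro hi; exact hc (V.a + i) (by omega) (by omega) (ih (by omega))
    have := this V.n le_rfl
    omega
  have a1 := P.arr_lo d d1 d2 c d3 d4
  have a2 := P.arr_hi d d1 d2 c d3 d4
  obtain ⟨s, s1, s2, s3, s4⟩ : ∃ s, V.lo d ≤ s ∧ s < V.hi d ∧ P.arr d s c ≤ r ∧
      r < P.arr d (s + 1) c := by
    by_contra hc
    push Not at hc
    have hl := V.lo_le_hi d d1 d2
    have : ∀ i, V.lo d + i ≤ V.hi d → P.arr d (V.lo d + i) c ≤ r := by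
      intro i
      induction i with
      | zero => intro _; simpa [a1] using h3
      | succ i ih => intro hi; exact hc (V.lo d + i) (by omega) (by omega) (ih (by omega))
    have := this (V.hi d - V.lo d) (by omega)
    rw [Nat.add_sub_of_le hl, a2] at this
    omega
  exact ⟨(d, s), ⟨d1, d2, s1, s2⟩, d3, d4, s3, s4⟩

theorem pre_unique {c r d s d' s' : ℕ} {h : V.Cell d s} {h' : V.Cell d' s'}
    (hc : (P.pre d s h).Cell c r) (hc' : (P.pre d' s' h').Cell c r) : d = d' ∧ s = s' := by
  obtain ⟨c1, c2, c3, c4⟩ := hc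
  obtain ⟨c1', c2', c3', c4'⟩ := hc'
  have q1 : P.obj d ≤ c := c1
  have q2 : c < P.obj (d + 1) := c2
  have q3 : P.arr d s c ≤ r := c3
  have q4 : r < P.arr d (s + 1) c := c4
  have q1' : P.obj d' ≤ c := c1'
  have q2' : c < P.obj (d' + 1) := c2'
  have q3' : P.arr d' s' c ≤ r := c3'
  have q4' : r < P.arr d' (s' + 1) c := c4'
  have hd : d = d' := by
    rcases lt_trichotomy d d' with hl | hl | hl
    · have := P.obj_mono (show d + 1 ≤ d' from hl); omega
    · exact hl
    · have := P.obj_mono (show d' + 1 ≤ d from hl); omega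
  subst hd
  refine ⟨rfl, ?_⟩
  obtain ⟨h1, h2, h3, h4⟩ := h
  obtain ⟨-, -, h3', h4'⟩ := h'
  rcases lt_trichotomy s s' with hl | hl | hl
  · have := P.arr_mono d h1 h2 (s + 1) s' (by omega) hl (by omega) c q1 q2; omega
  · exact hl
  · have := P.arr_mono d h1 h2 (s' + 1) s (by omega) hl (by omega) c q1 q2; omega

theorem pre_congr {f g : ℕ × ℕ} (e : f = g) {hf : V.Cell f.1 f.2} (hg : V.Cell g.1 g.2) {c r : ℕ}
    (hc : (P.pre f.1 f.2 hf).Cell c r) : (P.pre g.1 g.2 hg).Cell c r := by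
  subst e
  exact hc

end TwoOrdMap

/-! ### The operad `seq` -/

/-- The elements of the disjoint union of the ordinals `[I f]` over the 2-cells `f = (c, r)`. -/
@[ext] structure Mark (U : TwoOrd) (I : ℕ → ℕ → ℕ) where
  c : ℕ
  r : ℕ
  i : ℕ
  cell : U.Cell c r
  le : i ≤ I c r

/-- An element of `seq (U, I, J)`, where the 2-cell `(c, r)` has colour `[I c r]` and the
remaining colour is `[J]`: a total order on the set of marks and a monotone map `W` to `[J]`. -/
structure SeqOp (U : TwoOrd) (I : ℕ → ℕ → ℕ) (J : ℕ) where
  le : Mark U I → Mark U I → Prop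
  refl : ∀ x, le x x
  antisymm : ∀ x y, le x y → le y x → x = y
  trans : ∀ x y z, le x y → le y z → le x z
  total : ∀ x y, le x y ∨ le y x
  W : Mark U I → Fin (J + 1)
  mono : ∀ x y, le x y → W x ≤ W y
  le_of_le : ∀ x y, x.c = y.c → x.r = y.r → x.i ≤ y.i → le x y
  nested : ∀ x x' y, x.c = x'.c → x.r = x'.r → ¬ (y.c = x.c ∧ y.r = x.r) →
    le x y → le y x' → y.c < x.c
  le_of_lt : ∀ x y, x.c = y.c → x.r < y.r → le x y

/-- The data of a set-valued `ℕ`-coloured 2-operad: the set attached to each coloured 2-ordinal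
`(U, I, J)` and the composition attached to each map of coloured 2-ordinals
`(U, I, J) → (V, K, J)`. -/
structure TwoOperadData where
  obj : TwoOrd → (ℕ → ℕ → ℕ) → ℕ → Type
  comp : ∀ {U V : TwoOrd} (P : TwoOrdMap U V) (I K : ℕ → ℕ → ℕ) (J : ℕ),
    (∀ (d s : ℕ) (h : V.Cell d s), obj (P.pre d s h) I (K d s)) → obj V K J → obj U I J

/-- The trivial coloured 2-operad. -/
def trivOperad : TwoOperadData where
  obj _ _ _ := Unit
  comp _ _ _ _ _ _ := ()

namespace SeqOp

section Comp

variable {U V : TwoOrd} (P : TwoOrdMap U V) {I K : ℕ → ℕ → ℕ} {J : ℕ}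
  (lam : ∀ (d s : ℕ) (h : V.Cell d s), SeqOp (P.pre d s h) I (K d s)) (mu : SeqOp V K J)

/-- The 2-cell of `V` whose inverse image contains the 2-cell of the mark `x`. -/
noncomputable def fib (x : Mark U I) : ℕ × ℕ := (P.exists_pre x.cell).choose

theorem fib_cell (x : Mark U I) : V.Cell (fib P x).1 (fib P x).2 :=
  (P.exists_pre x.cell).choose_spec.choose

/-- The mark `x`, as a mark of the inverse image that contains it. -/
noncomputable def res (x : Mark U I) : Mark (P.pre _ _ (fib_cell P x)) I where
  c := x.c
  r := x.r
  i := x.i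
  cell := (P.exists_pre x.cell).choose_spec.choose_spec
  le := x.le

/-- The map from the marks of `U` to the marks of `V` induced by the monotone maps of the
elements `lam d s`. -/
noncomputable def push (x : Mark U I) : Mark V K where
  c := (fib P x).1
  r := (fib P x).2
  i := ((lam _ _ (fib_cell P x)).W (res P x)).val
  cell := fib_cell P x
  le := Nat.lt_succ_iff.1 ((lam _ _ (fib_cell P x)).W (res P x)).isLt

/-- Two marks of `U` in the same inverse image `P⁻¹ (d, s)`, compared for the order of
`lam d s`. -/
def FibLE (x y : Mark U I) : Prop :=
  ∃ (d s : ℕ) (h : V.Cell d s) (hx : (P.pre d s h).Cell x.c x.r)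
    (hy : (P.pre d s h).Cell y.c y.r),
    (lam d s h).le ⟨x.c, x.r, x.i, hx, x.le⟩ ⟨y.c, y.r, y.i, hy, y.le⟩

/-- The order of the composite: by the images in the marks of `V`, then by the orders of the
elements `lam d s`. -/
def CompLE (x y : Mark U I) : Prop :=
  (push P lam x ≠ push P lam y ∧ mu.le (push P lam x) (push P lam y)) ∨
    (push P lam x = push P lam y ∧ FibLE P lam x y)

variable {P lam mu}

theorem FibLE.at {x y : Mark U I} (h : FibLE P lam x y) {d s : ℕ} {hc : V.Cell d s}
    (hx : (P.pre d s hc).Cell x.c x.r) :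
    ∃ hy : (P.pre d s hc).Cell y.c y.r,
      (lam d s hc).le ⟨x.c, x.r, x.i, hx, x.le⟩ ⟨y.c, y.r, y.i, hy, y.le⟩ := by
  obtain ⟨d', s', hc', hx', hy', hle⟩ := h
  obtain ⟨rfl, rfl⟩ := P.pre_unique hx' hx
  exact ⟨hy', hle⟩

theorem fib_eq {x : Mark U I} {d s : ℕ} {hc : V.Cell d s}
    (hx : (P.pre d s hc).Cell x.c x.r) : fib P x = (d, s) := by
  obtain ⟨h1, h2⟩ := P.pre_unique (res P x).cell hx
  exact Prod.ext h1 h2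

theorem push_eq {x : Mark U I} {d s : ℕ} {hc : V.Cell d s}
    (hx : (P.pre d s hc).Cell x.c x.r) :
    push P lam x = ⟨d, s, ((lam d s hc).W ⟨x.c, x.r, x.i, hx, x.le⟩).val, hc,
      Nat.lt_succ_iff.1 ((lam d s hc).W ⟨x.c, x.r, x.i, hx, x.le⟩).isLt⟩ := by
  obtain ⟨h1, h2⟩ := P.pre_unique (res P x).cell hx
  subst h1 h2
  rfl

theorem exists_cell_of_fib {x y : Mark U I} (h : fib P x = fib P y) :
    ∃ (d s : ℕ) (hc : V.Cell d s), (P.pre d s hc).Cell x.c x.r ∧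
      (P.pre d s hc).Cell y.c y.r := by
  exact ⟨_, _, fib_cell P x, (res P x).cell, P.pre_congr h.symm (fib_cell P x) (res P y).cell⟩

theorem fib_of_push {x y : Mark U I} (h : push P lam x = push P lam y) : fib P x = fib P y :=
  Prod.ext (congrArg Mark.c h) (congrArg Mark.r h)

theorem CompLE.le {x y : Mark U I} (h : CompLE P lam mu x y) :
    mu.le (push P lam x) (push P lam y) := by
  rcases h with h | h
  · exact h.2
  · rw [h.1]; exact mu.refl _

theorem compLE_trans {x y z : Mark U I} (h : CompLE P lam mu x y) (h' : CompLE P lam mu y z) :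
    CompLE P lam mu x z := by
  have t := mu.trans _ _ _ h.le h'.le
  by_cases e : push P lam x = push P lam z
  · have e1 : push P lam x = push P lam y := mu.antisymm _ _ h.le (e ▸ h'.le)
    have e2 : push P lam y = push P lam z := e1 ▸ e
    refine .inr ⟨e, ?_⟩
    have f1 : FibLE P lam x y := (h.resolve_left fun q => q.1 e1).2
    have f2 : FibLE P lam y z := (h'.resolve_left fun q => q.1 e2).2
    obtain ⟨hy, l1⟩ := f1.at (res P x).cell
    obtain ⟨hz, l2⟩ := f2.at hy
    exact ⟨_, _, fib_cell P x, (res P x).cell, hz, (lam _ _ _).trans _ _ _ l1 l2⟩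
  · exact .inl ⟨e, t⟩

/-- Marks in the same inverse image are compared as for the order of the corresponding element
`lam d s`. -/
theorem compLE_of_le {x y : Mark U I} {d s : ℕ} {hc : V.Cell d s}
    (hx : (P.pre d s hc).Cell x.c x.r) (hy : (P.pre d s hc).Cell y.c y.r)
    (h : (lam d s hc).le ⟨x.c, x.r, x.i, hx, x.le⟩ ⟨y.c, y.r, y.i, hy, y.le⟩) :
    CompLE P lam mu x y := by
  by_cases e : push P lam x = push P lam y
  · exact .inr ⟨e, d, s, hc, hx, hy, h⟩
  · refine .inl ⟨e, mu.le_of_le _ _ ?_ ?_ ?_⟩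
    · rw [push_eq hx, push_eq hy]
    · rw [push_eq hx, push_eq hy]
    · rw [push_eq hx, push_eq hy]
      exact (lam d s hc).mono _ _ h

theorem le_of_compLE {x y : Mark U I} {d s : ℕ} {hc : V.Cell d s}
    (hx : (P.pre d s hc).Cell x.c x.r) (hy : (P.pre d s hc).Cell y.c y.r)
    (h : CompLE P lam mu x y) :
    (lam d s hc).le ⟨x.c, x.r, x.i, hx, x.le⟩ ⟨y.c, y.r, y.i, hy, y.le⟩ := by
  rcases (lam d s hc).total ⟨x.c, x.r, x.i, hx, x.le⟩ ⟨y.c, y.r, y.i, hy, y.le⟩ with q | q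
  · exact q
  · have q' : CompLE P lam mu y x := compLE_of_le hy hx q
    have e : push P lam x = push P lam y := mu.antisymm _ _ h.le q'.le
    obtain ⟨hy', l⟩ := ((h.resolve_left fun q => q.1 e).2).at hx
    exact l

variable (P lam mu)

/-- The composition of `seq`. -/
noncomputable def comp : SeqOp U I J where
  le := CompLE P lam mu
  refl x := compLE_of_le (res P x).cell (res P x).cell ((lam _ _ _).refl _)
  antisymm x y h h' := by
    have e : push P lam x = push P lam y := mu.antisymm _ _ h.le h'.le
    obtain ⟨d, s, hc, hx, hy⟩ := exists_cell_of_fib (fib_of_push e)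
    have := (lam d s hc).antisymm _ _ (le_of_compLE hx hy h) (le_of_compLE hy hx h')
    simp only [Mark.mk.injEq] at this
    exact Mark.ext this.1 this.2.1 this.2.2
  trans _ _ _ h h' := compLE_trans h h'
  total x y := by
    by_cases e : push P lam x = push P lam y
    · obtain ⟨d, s, hc, hx, hy⟩ := exists_cell_of_fib (fib_of_push e)
      exact ((lam d s hc).total _ _).imp (compLE_of_le hx hy) (compLE_of_le hy hx)
    · exact (mu.total _ _).imp (fun h => .inl ⟨e, h⟩) (fun h => .inl ⟨fun q => e q.symm, h⟩)
  W x := mu.W (push P lam x)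
  mono x y h := mu.mono _ _ h.le
  le_of_le x y h1 h2 h3 := by
    have hy : (P.pre _ _ (fib_cell P x)).Cell y.c y.r := by
      rw [← h1, ← h2]; exact (res P x).cell
    exact compLE_of_le (res P x).cell hy ((lam _ _ _).le_of_le _ _ h1 h2 h3)
  nested x x' y h1 h2 hne h h' := by
    have hx := (res P x).cell
    have hx' : (P.pre _ _ (fib_cell P x)).Cell x'.c x'.r := by
      rw [← h1, ← h2]; exact (res P x).cell
    by_cases e : fib P y = fib P x
    · have hy : (P.pre _ _ (fib_cell P x)).Cell y.c y.r := by
        obtain ⟨d, s, hc, hy, hx2⟩ := exists_cell_of_fib e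
        obtain ⟨r1, r2⟩ := P.pre_unique hx2 hx
        subst r1 r2
        exact hy
      exact (lam _ _ _).nested ⟨x.c, x.r, x.i, hx, x.le⟩ ⟨x'.c, x'.r, x'.i, hx', x'.le⟩
        ⟨y.c, y.r, y.i, hy, y.le⟩ h1 h2 hne (le_of_compLE hx hy h) (le_of_compLE hy hx' h')
    · have e' := fib_eq hx'
      have key := mu.nested (push P lam x) (push P lam x') (push P lam y)
        (by rw [push_eq hx, push_eq hx']) (by rw [push_eq hx, push_eq hx'])
        (fun q => e (Prod.ext q.1 q.2)) h.le h'.le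
      have key' : (fib P y).1 < (fib P x).1 := key
      have b1 : y.c < P.obj ((fib P y).1 + 1) := (res P y).cell.2.1
      have b2 : P.obj (fib P x).1 ≤ x.c := hx.1
      exact b1.trans_le ((P.obj_mono key').trans b2)
  le_of_lt x y h1 h2 := by
    have hx := (res P x).cell
    have hy := (res P y).cell
    have x1 : P.obj (fib P x).1 ≤ x.c := hx.1
    have x2 : x.c < P.obj ((fib P x).1 + 1) := hx.2.1
    have y1 : P.obj (fib P y).1 ≤ y.c := hy.1
    have y2 : y.c < P.obj ((fib P y).1 + 1) := hy.2.1
    have hd : (fib P x).1 = (fib P y).1 := by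
      rcases lt_trichotomy (fib P x).1 (fib P y).1 with hl | hl | hl
      · have := P.obj_mono (show (fib P x).1 + 1 ≤ (fib P y).1 from hl); omega
      · exact hl
      · have := P.obj_mono (show (fib P y).1 + 1 ≤ (fib P x).1 from hl); omega
    rcases lt_trichotomy (fib P x).2 (fib P y).2 with hl | hl | hl
    · refine .inl ⟨fun q => ?_, mu.le_of_lt _ _ hd hl⟩
      have := congrArg Mark.r q
      exact absurd this hl.ne
    · obtain ⟨d, s, hc, hx, hy⟩ := exists_cell_of_fib (Prod.ext hd hl : fib P x = fib P y)
      exact compLE_of_le hx hy ((lam d s hc).le_of_lt _ _ h1 h2)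
    · exfalso
      have x4 : x.r < P.arr (fib P x).1 ((fib P x).2 + 1) x.c := hx.2.2.2
      have x3 : P.arr (fib P x).1 (fib P x).2 x.c ≤ x.r := hx.2.2.1
      have y4 : y.r < P.arr (fib P y).1 ((fib P y).2 + 1) y.c := hy.2.2.2
      obtain ⟨c1, c2, c3, c4⟩ := fib_cell P x
      obtain ⟨_, _, c3', c4'⟩ := fib_cell P y
      rw [← hd, ← h1] at y4
      rw [← hd] at c3' c4'
      have := P.arr_mono _ c1 c2 ((fib P y).2 + 1) (fib P x).2 (by omega) hl (by omega) x.c x1 x2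
      omega

end Comp

end SeqOp

/-- The coloured 2-operad `seq`. -/
noncomputable def seqOperad : TwoOperadData where
  obj := SeqOp
  comp P _ _ _ lam mu := SeqOp.comp P lam mu

/-! ### Diagrams -/

/-- A diagram of dg categories of the shape of a 2-ordinal: a dg category `cat c` for every object
`c` and a dg functor `F c r : cat c → cat (c + 1)` for every arrow `r` from `c` to `c + 1`. As the
arrows freely generate the underlying category of a 2-ordinal, this is a functor from it. A diagram
is extended to all indices; for a given 2-ordinal only the values inside it are used. -/
structure Diagram (k : Type u) [CommRing k] where
  cat : ℕ → DGCat.{u, v, w} k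
  F : ∀ c, ℕ → DGFunctor (cat c) (cat (c + 1))

namespace Diagram

variable (D : Diagram.{u, v, w} k)

/-- The composite of the functors along the path `q`, from the object `a` to `a + l`. -/
def path (q : ℕ → ℕ) (a : ℕ) : ∀ l : ℕ, DGFunctor (D.cat a) (D.cat (a + l))
  | 0 => DGFunctor.id _
  | l + 1 => (path q a l).comp (D.F (a + l) (q (a + l)))

/-- The composite of the least arrows of a 2-ordinal. -/
abbrev src (U : TwoOrd) : DGFunctor (D.cat U.a) (D.cat (U.a + U.n)) := D.path U.lo U.a U.n

/-- The composite of the greatest arrows of a 2-ordinal. -/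
abbrev tgt (U : TwoOrd) : DGFunctor (D.cat U.a) (D.cat (U.a + U.n)) := D.path U.hi U.a U.n

/-- The diagram over `V` obtained from a diagram over `U` along `P : U → V`. -/
def push {U V : TwoOrd} (P : TwoOrdMap U V) : Diagram.{u, v, w} k where
  cat d := D.cat (P.obj d)
  F d g := D.path (P.arr d g) (P.obj d) (P.len d)

end Diagram

/-! ### The action of `seq` -/

namespace SeqOp

open Classical in
/-- The arrow from `c` to `c + 1` reached just before the mark `x`: the least arrow raised by the
number of 2-cells from `c` to `c + 1` all of whose marks precede `x`. -/
noncomputable def passed {U : TwoOrd} {I : ℕ → ℕ → ℕ} {J : ℕ} (e : SeqOp U I J) (x : Mark U I)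
    (c : ℕ) : ℕ :=
  U.lo c + ((Finset.Ico (U.lo c) (U.hi c)).filter
    (fun r => ∀ y : Mark U I, y.c = c → y.r = r → e.le y x ∧ y ≠ x)).card

/-- The position of a mark: the arrows reached just before it and its image in `[J]`. -/
noncomputable def pos {U : TwoOrd} {I : ℕ → ℕ → ℕ} {J : ℕ} (e : SeqOp U I J) (x : Mark U I) :
    (ℕ → ℕ) × Fin (J + 1) :=
  (e.passed x, e.W x)

/-- The `i`-th mark of a 2-cell. -/
def mark {U : TwoOrd} (I : ℕ → ℕ → ℕ) {c r : ℕ} (h : U.Cell c r) (i : Fin (I c r + 1)) :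
    Mark U I :=
  ⟨c, r, i.val, h, Nat.lt_succ_iff.1 i.isLt⟩

theorem W_mark_mono {U : TwoOrd} {I : ℕ → ℕ → ℕ} {J : ℕ} (e : SeqOp U I J) {c r : ℕ}
    (h : U.Cell c r) : Monotone fun i : Fin (I c r + 1) => e.W (mark I h i) :=
  fun _ _ hij => e.mono _ _ (e.le_of_le _ _ rfl rfl hij)

section Eval

variable {U : TwoOrd} {I : ℕ → ℕ → ℕ} {J : ℕ} (e : SeqOp U I J) (D : Diagram.{u, v, w} k)
  (h : ∀ c r, ShomAmb (I c r) (D.F c r) (D.F c (r + 1)))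
  (X : Fin (J + 1) → (D.cat U.a).Obj)

/-- The object of `cat (a + l)` at the position `(q, j)`. -/
abbrev ob (U : TwoOrd) {J : ℕ} (D : Diagram.{u, v, w} k) (X : Fin (J + 1) → (D.cat U.a).Obj)
    (l : ℕ) (t : (ℕ → ℕ) × Fin (J + 1)) : (D.cat (U.a + l)).Obj :=
  (D.path t.1 U.a l).obj (X t.2)

open Classical in
/-- One step of the evaluation. Let `c = a + l`, and let `prev` give the morphisms of `cat c`
between positions. Then `evalStep r t s t'` is the morphism of `cat (c + 1)` from the value of
`F c r` at the position `t` to the value of `F c s` at the position `t'`, which passes through the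
2-cells `(c, r), …, (c, s - 1)` in this order: outside of the interval between the first and the
last mark of such a 2-cell, the current functor is applied to the morphisms of `prev`; to the chain
of morphisms of `prev` between the marks of `(c, i)`, the transformation `h c i` is applied. -/
noncomputable def evalStep (l : ℕ)
    (prev : ∀ t t', (D.cat (U.a + l)).Hom (ob U D X l t) (ob U D X l t'))
    (r : ℕ) (t : (ℕ → ℕ) × Fin (J + 1)) :
    ∀ (s : ℕ) (t' : (ℕ → ℕ) × Fin (J + 1)),
      (D.cat (U.a + l + 1)).Hom ((D.F (U.a + l) r).obj (ob U D X l t))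
        ((D.F (U.a + l) s).obj (ob U D X l t'))
  | 0, t' =>
    if hr : r = 0 then
      (D.cat (U.a + l + 1)).comp ((D.cat (U.a + l + 1)).eqHom (by rw [hr]))
        ((D.F (U.a + l) r).map (prev t t'))
    else 0
  | s + 1, t' =>
    if hr : r = s + 1 then
      (D.cat (U.a + l + 1)).comp ((D.cat (U.a + l + 1)).eqHom (by rw [hr]))
        ((D.F (U.a + l) r).map (prev t t'))
    else if hc : U.Cell (U.a + l) s then
      (D.cat (U.a + l + 1)).comp
        ((D.F (U.a + l) (s + 1)).map (prev (e.pos (mark I hc (Fin.last _))) t'))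
        ((D.cat (U.a + l + 1)).comp
          (h (U.a + l) s (fun i => ob U D X l (e.pos (mark I hc i)))
            (fun i => prev (e.pos (mark I hc i.castSucc)) (e.pos (mark I hc i.succ))))
          (evalStep l prev r t s (e.pos (mark I hc 0))))
    else 0

/-- The morphism of `cat (a + l)` between two positions obtained from the chain `u` in `cat a`
by applying the functors and the transformations of the first `l` columns. -/
noncomputable def eval (u : ∀ i : Fin J, (D.cat U.a).Hom (X i.castSucc) (X i.succ)) :
    ∀ (l : ℕ) (t t' : (ℕ → ℕ) × Fin (J + 1)),
      (D.cat (U.a + l)).Hom (ob U D X l t) (ob U D X l t')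
  | 0, t, t' => (D.cat U.a).chainComp X u t.2 t'.2
  | l + 1, t, t' => evalStep e D h X l (eval u l) (t.1 (U.a + l)) t (t'.1 (U.a + l)) t'

theorem evalStep_linOn (l : ℕ)
    (prev : (∀ i : Fin J, (D.cat U.a).Hom (X i.castSucc) (X i.succ)) →
      ∀ t t', (D.cat (U.a + l)).Hom (ob U D X l t) (ob U D X l t'))
    (hz : ∀ u t t', t'.2 < t.2 → prev u t t' = 0)
    (hl : ∀ t t', LinOn k (fun i : Fin J => t.2 ≤ i.castSucc ∧ i.castSucc < t'.2)
      (fun u => prev u t t'))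
    (r : ℕ) (t : (ℕ → ℕ) × Fin (J + 1)) (s : ℕ) (t' : (ℕ → ℕ) × Fin (J + 1)) :
    (∀ u, t'.2 < t.2 → evalStep e D h X l (prev u) r t s t' = 0) ∧
      LinOn k (fun i : Fin J => t.2 ≤ i.castSucc ∧ i.castSucc < t'.2)
        (fun u => evalStep e D h X l (prev u) r t s t') := by
  induction s generalizing t' with
  | zero =>
    by_cases hr : r = 0
    · refine ⟨fun u hlt => ?_, ?_⟩
      · simp [evalStep, hr, hz u t t' hlt]
      · simp only [evalStep, hr, dite_true]
        exact (hl t t').linear (((D.cat (U.a + l + 1)).comp _) ∘ₗ (D.F (U.a + l) _).map)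
    · simp only [evalStep, hr, dite_false]
      exact ⟨fun _ _ => trivial, LinOn.zero _⟩
  | succ s ih =>
    by_cases hr : r = s + 1
    · refine ⟨fun u hlt => ?_, ?_⟩
      · simp [evalStep, hr, hz u t t' hlt]
      · simp only [evalStep, hr, dite_true]
        exact (hl t t').linear (((D.cat (U.a + l + 1)).comp _) ∘ₗ (D.F (U.a + l) _).map)
    · by_cases hc : U.Cell (U.a + l) s
      · simp only [evalStep, hr, hc, dite_true, dite_false]
        have hm := e.W_mark_mono hc
        have h01 : (e.pos (mark I hc 0)).2 ≤ (e.pos (mark I hc (Fin.last _))).2 :=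
          hm (Fin.zero_le _)
        obtain ⟨iz, il⟩ := ih (e.pos (mark I hc 0))
        have hh := LinOn.multilinear
          (h (U.a + l) s (fun i => ob U D X l (e.pos (mark I hc i))))
          (T := fun i : Fin J => (e.pos (mark I hc 0)).2 ≤ i.castSucc ∧
            i.castSucc < (e.pos (mark I hc (Fin.last _))).2)
          (g := fun u i => prev u (e.pos (mark I hc i.castSucc)) (e.pos (mark I hc i.succ)))
          (fun i => hl _ _)
          (fun i j j' q q' => consecutive_unique hm i q q')
          (fun i => ⟨fun q => exists_between_consecutive
              (fun i => e.W (mark I hc i)) i q.1 q.2,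
            fun ⟨j, q⟩ => ⟨(hm (Fin.zero_le _)).trans q.1,
              q.2.trans_le (hm (Fin.le_last _))⟩⟩)
        have h3 := (hl (e.pos (mark I hc (Fin.last _))) t').linear (D.F (U.a + l) (s + 1)).map
        have key : ∀ u, (t'.2 < t.2 ∨ (e.pos (mark I hc 0)).2 < t.2 ∨
            t'.2 < (e.pos (mark I hc (Fin.last _))).2) →
            (D.cat (U.a + l + 1)).comp
              ((D.F (U.a + l) (s + 1)).map (prev u (e.pos (mark I hc (Fin.last _))) t'))
              ((D.cat (U.a + l + 1)).comp
                (h (U.a + l) s (fun i => ob U D X l (e.pos (mark I hc i)))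
                  (fun i => prev u (e.pos (mark I hc i.castSucc)) (e.pos (mark I hc i.succ))))
                (evalStep e D h X l (prev u) r t s (e.pos (mark I hc 0)))) = 0 := by
          intro u q
          by_cases q1 : (e.pos (mark I hc 0)).2 < t.2
          · rw [iz u q1]; simp
          · have q2 : t'.2 < (e.pos (mark I hc (Fin.last _))).2 := by
              rcases q with q | q | q
              · exact q.trans_le ((not_lt.1 q1).trans h01)
              · exact absurd q q1
              · exact q
            rw [hz u _ _ q2]; simp
        refine ⟨fun u q => key u (.inl q), ?_⟩
        by_cases q : (e.pos (mark I hc 0)).2 < t.2 ∨ t'.2 < (e.pos (mark I hc (Fin.last _))).2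
        · simp only [key _ (.inr q)]
          exact LinOn.zero _
        · push Not at q
          refine h3.bilinear (hh.bilinear il (D.cat (U.a + l + 1)).comp
            (R := fun i : Fin J => t.2 ≤ i.castSucc ∧
              i.castSucc < (e.pos (mark I hc (Fin.last _))).2) ?_ ?_) (D.cat (U.a + l + 1)).comp
              ?_ ?_
          · intro i p p'
            exact absurd p.1 (not_le.2 p'.2)
          · intro i
            refine ⟨fun p => ?_, ?_⟩
            · by_cases p' : (e.pos (mark I hc 0)).2 ≤ i.castSucc
              · exact .inl ⟨p', p.2⟩
              · exact .inr ⟨p.1, not_le.1 p'⟩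
            · rintro (p | p)
              · exact ⟨q.1.trans p.1, p.2⟩
              · exact ⟨p.1, p.2.trans_le h01⟩
          · intro i p p'
            exact absurd p.1 (not_le.2 p'.2)
          · intro i
            refine ⟨fun p => ?_, ?_⟩
            · by_cases p' : (e.pos (mark I hc (Fin.last _))).2 ≤ i.castSucc
              · exact .inl ⟨p', p.2⟩
              · exact .inr ⟨p.1, not_le.1 p'⟩
            · rintro (p | p)
              · exact ⟨(q.1.trans h01).trans p.1, p.2⟩
              · exact ⟨p.1, p.2.trans_le q.2⟩
      · simp only [evalStep, hr, hc, dite_false]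
        exact ⟨fun _ _ => trivial, LinOn.zero _⟩

theorem eval_linOn (l : ℕ) (t t' : (ℕ → ℕ) × Fin (J + 1)) :
    (∀ u, t'.2 < t.2 → eval e D h X u l t t' = 0) ∧
      LinOn k (fun i : Fin J => t.2 ≤ i.castSucc ∧ i.castSucc < t'.2)
        (fun u => eval e D h X u l t t') := by
  induction l generalizing t t' with
  | zero => exact ⟨fun u q => (D.cat U.a).chainComp_of_lt X u _ _ q, (D.cat U.a).chainComp_linOn X _ _⟩
  | succ l ih =>
    exact evalStep_linOn e D h X l (fun u => eval e D h X u l) (fun u t t' => (ih t t').1 u)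
      (fun t t' => (ih t t').2) _ t _ t'

open Classical in
/-- The sum of the degrees of the 2-cells all of whose marks are sent to elements `≤ j` of `[J]`:
these are the transformations that the `j`-th morphism of a chain has to be moved across. -/
noncomputable def cross (p : ℕ → ℕ → ℤ) (j : Fin J) : ℤ :=
  ∑ f ∈ U.cells, if ∀ y : Mark U I, y.c = f.1 → y.r = f.2 → e.W y ≤ j.castSucc then p f.1 f.2 else 0

open Classical in
/-- The exponent of the Koszul sign of the permutation that takes the 2-cells from the
lexicographic order to the decreasing order of their last marks. In the result of the evaluation
the transformations occur, from left to right, in the latter order. -/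
noncomputable def signExp (p : ℕ → ℕ → ℤ) : ℤ :=
  ∑ f ∈ U.cells, ∑ g ∈ U.cells,
    if CellLT f g ∧ (∃ y : Mark U I, (y.c = g.1 ∧ y.r = g.2) ∧
        ∀ x : Mark U I, x.c = f.1 → x.r = f.2 → e.le x y)
    then p f.1 f.2 * p g.1 g.2 else 0

theorem act_linOn (p : ℕ → ℕ → ℤ) :
    LinOn k (fun _ => True) (fun u : (∀ i : Fin J, (D.cat U.a).Hom (X i.castSucc) (X i.succ)) =>
      ((Int.negOnePow (e.signExp p) : ℤˣ) : ℤ) •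
        eval e D h X (fun j => (D.cat U.a).kos (e.cross p j) (u j)) U.n
          (U.lo, 0) (U.hi, Fin.last J)) := by
  have hE := (eval_linOn e D h X U.n (U.lo, 0) (U.hi, Fin.last J)).2
  have hS : ∀ i : Fin J, (0 : Fin (J + 1)) ≤ i.castSucc ∧ i.castSucc < Fin.last J :=
    fun i => ⟨Fin.zero_le _, Fin.castSucc_lt_last i⟩
  have upd : ∀ (u : ∀ i : Fin J, (D.cat U.a).Hom (X i.castSucc) (X i.succ)) (i : Fin J) x,
      (fun j => (D.cat U.a).kos (e.cross p j) (Function.update u i x j)) =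
        Function.update (fun j => (D.cat U.a).kos (e.cross p j) (u j)) i
          ((D.cat U.a).kos (e.cross p i) x) := by
    intro u i x
    funext j
    by_cases q : j = i
    · subst q; simp
    · simp [Function.update_of_ne q]
  intro i
  refine ⟨fun _ => ⟨fun u x y => ?_, fun u c x => ?_⟩, fun q => absurd trivial q⟩
  · have := ((hE i).1 (hS i)).1 (fun j => (D.cat U.a).kos (e.cross p j) (u j))
      ((D.cat U.a).kos (e.cross p i) x) ((D.cat U.a).kos (e.cross p i) y)
    beta_reduce at this ⊢
    rw [upd, upd, upd, map_add, this, smul_add]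
  · have := ((hE i).1 (hS i)).2 (fun j => (D.cat U.a).kos (e.cross p j) (u j)) c
      ((D.cat U.a).kos (e.cross p i) x)
    beta_reduce at this ⊢
    rw [upd, upd, map_smul, this, smul_comm]

end Eval

/-- The structure map of the `seq`-action attached to `e ∈ seq (U, I, J)` and a diagram `D`,
`⨂ shom^[I f] (D|f) → shom^[J] (p_* D)`, on transformations `h f` of degrees `p f`. -/
noncomputable def act {U : TwoOrd} {I : ℕ → ℕ → ℕ} {J : ℕ} (e : SeqOp U I J)
    (D : Diagram.{u, v, w} k) (p : ℕ → ℕ → ℤ)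
    (h : ∀ c r, ShomAmb (I c r) (D.F c r) (D.F c (r + 1))) :
    ShomAmb J (D.src U) (D.tgt U) :=
  fun X => (act_linOn e D h X p).toMultilinear (fun _ => trivial)

end SeqOp

/-! The structure maps of the action preserve degrees. -/

theorem sum_fin_sub {n : ℕ} (f : Fin (n + 1) → ℤ) :
    ∑ i : Fin n, (f i.succ - f i.castSucc) = f (Fin.last n) - f 0 := by
  have h := (Fin.sum_univ_succ f).symm.trans (Fin.sum_univ_castSucc f)
  rw [Finset.sum_sub_distrib]
  linarith

theorem DGCat.eqHom_mem (A : DGCat.{u, v, w} k) {x y : A.Obj} (h : x = y) :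
    A.eqHom h ∈ A.deg x y 0 := by
  subst h
  exact A.one_mem _

theorem DGCat.chainComp_mem (A : DGCat.{u, v, w} k) {n : ℕ} (X : Fin (n + 1) → A.Obj)
    (u : ∀ i : Fin n, A.Hom (X i.castSucc) (X i.succ)) (ψ : Fin (n + 1) → ℤ)
    (hu : ∀ i, u i ∈ A.deg (X i.castSucc) (X i.succ) (ψ i.succ - ψ i.castSucc))
    (a b : Fin (n + 1)) : A.chainComp X u a b ∈ A.deg (X a) (X b) (ψ b - ψ a) := by
  induction b using Fin.induction with
  | zero =>
    by_cases h : a = 0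
    · subst h
      simpa [chainComp] using A.eqHom_mem rfl
    · simp [chainComp, h]
  | succ i ih =>
    by_cases h : a = i.succ
    · subst h
      simpa [chainComp] using A.eqHom_mem rfl
    · have e : (ψ i.succ - ψ i.castSucc) + (ψ i.castSucc - ψ a) = ψ i.succ - ψ a := by ring
      simp only [chainComp, Fin.induction_succ, h, dite_false] at ih ⊢
      exact e ▸ A.comp_mem (hu i) ih

namespace SeqOp

section Degrees

variable {U : TwoOrd} {I : ℕ → ℕ → ℕ} {J : ℕ} (e : SeqOp U I J) (D : Diagram.{u, v, w} k)
  (h : ∀ c r, ShomAmb (I c r) (D.F c r) (D.F c (r + 1)))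
  (X : Fin (J + 1) → (D.cat U.a).Obj) (p : ℕ → ℕ → ℤ)

theorem evalStep_mem (hh : ∀ c r, U.Cell c r → h c r ∈ shomDeg (I c r) (D.F c r) (D.F c (r + 1)) (p c r))
    (l : ℕ) (prev : ∀ t t', (D.cat (U.a + l)).Hom (ob U D X l t) (ob U D X l t'))
    (φ : (ℕ → ℕ) × Fin (J + 1) → ℤ)
    (hp : ∀ t t', prev t t' ∈ (D.cat (U.a + l)).deg _ _ (φ t' - φ t))
    (r : ℕ) (t : (ℕ → ℕ) × Fin (J + 1)) (s : ℕ) (t' : (ℕ → ℕ) × Fin (J + 1)) :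
    evalStep e D h X l prev r t s t' ∈ (D.cat (U.a + l + 1)).deg _ _
      ((φ t' + ∑ i ∈ Finset.range s, p (U.a + l) i) -
        (φ t + ∑ i ∈ Finset.range r, p (U.a + l) i)) := by
  have base : ∀ (s : ℕ) (t' : (ℕ → ℕ) × Fin (J + 1)) (hr : r = s),
      (D.cat (U.a + l + 1)).comp ((D.cat (U.a + l + 1)).eqHom (by rw [hr]))
        ((D.F (U.a + l) r).map (prev t t')) ∈ (D.cat (U.a + l + 1)).deg
          ((D.F (U.a + l) r).obj (ob U D X l t)) ((D.F (U.a + l) s).obj (ob U D X l t'))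
      ((φ t' + ∑ i ∈ Finset.range s, p (U.a + l) i) -
        (φ t + ∑ i ∈ Finset.range r, p (U.a + l) i)) := by
    rintro s t' rfl
    have e1 : 0 + (φ t' - φ t) = (φ t' + ∑ i ∈ Finset.range r, p (U.a + l) i) -
        (φ t + ∑ i ∈ Finset.range r, p (U.a + l) i) := by ring
    exact e1 ▸ (D.cat (U.a + l + 1)).comp_mem ((D.cat (U.a + l + 1)).eqHom_mem _)
      ((D.F (U.a + l) r).map_mem (hp t t'))
  induction s generalizing t' with
  | zero =>
    by_cases hr : r = 0
    · simp only [evalStep, hr, dite_true]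
      have := base 0 t' hr
      subst hr
      exact this
    · simp [evalStep, hr]
  | succ s ih =>
    by_cases hr : r = s + 1
    · have := base (s + 1) t' hr
      subst hr
      simp only [evalStep, dite_true]
      exact this
    · by_cases hc : U.Cell (U.a + l) s
      · simp only [evalStep, hr, hc, dite_true, dite_false]
        have m1 := (D.F (U.a + l) (s + 1)).map_mem (hp (e.pos (mark I hc (Fin.last _))) t')
        have m2 := hh _ _ hc (fun i => ob U D X l (e.pos (mark I hc i)))
          (fun i => φ (e.pos (mark I hc i.succ)) - φ (e.pos (mark I hc i.castSucc)))
          (fun i => prev (e.pos (mark I hc i.castSucc)) (e.pos (mark I hc i.succ)))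
          (fun i => hp _ _)
        have m3 := ih (e.pos (mark I hc 0))
        have tel : ∑ i : Fin (I (U.a + l) s), (φ (e.pos (mark I hc i.succ)) -
            φ (e.pos (mark I hc i.castSucc))) =
            φ (e.pos (mark I hc (Fin.last _))) - φ (e.pos (mark I hc 0)) :=
          sum_fin_sub (fun i => φ (e.pos (mark I hc i)))
        rw [tel] at m2
        have m := (D.cat (U.a + l + 1)).comp_mem m1 ((D.cat (U.a + l + 1)).comp_mem m2 m3)
        have e1 : (φ t' + ∑ i ∈ Finset.range (s + 1), p (U.a + l) i) -
            (φ t + ∑ i ∈ Finset.range r, p (U.a + l) i) =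
            φ t' - φ (e.pos (mark I hc (Fin.last _))) + (p (U.a + l) s +
              (φ (e.pos (mark I hc (Fin.last _))) - φ (e.pos (mark I hc 0))) +
              ((φ (e.pos (mark I hc 0)) + ∑ i ∈ Finset.range s, p (U.a + l) i) -
                (φ t + ∑ i ∈ Finset.range r, p (U.a + l) i))) := by
          rw [Finset.sum_range_succ]
          ring
        rw [e1]
        exact m
      · simp [evalStep, hr, hc]

theorem eval_mem (hh : ∀ c r, U.Cell c r → h c r ∈ shomDeg (I c r) (D.F c r) (D.F c (r + 1)) (p c r))
    (u : ∀ i : Fin J, (D.cat U.a).Hom (X i.castSucc) (X i.succ)) (ψ : Fin (J + 1) → ℤ)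
    (hu : ∀ i, u i ∈ (D.cat U.a).deg (X i.castSucc) (X i.succ) (ψ i.succ - ψ i.castSucc))
    (l : ℕ) (t t' : (ℕ → ℕ) × Fin (J + 1)) :
    eval e D h X u l t t' ∈ (D.cat (U.a + l)).deg _ _
      ((ψ t'.2 + ∑ c ∈ Finset.range l, ∑ i ∈ Finset.range (t'.1 (U.a + c)), p (U.a + c) i) -
        (ψ t.2 + ∑ c ∈ Finset.range l, ∑ i ∈ Finset.range (t.1 (U.a + c)), p (U.a + c) i)) := by
  induction l generalizing t t' with
  | zero =>
    simp only [Finset.range_zero, Finset.sum_empty, add_zero]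
    exact (D.cat U.a).chainComp_mem X u ψ hu t.2 t'.2
  | succ l ih =>
    have := evalStep_mem e D h X p hh l (eval e D h X u l) (fun t => ψ t.2 + ∑ c ∈ Finset.range l,
      ∑ i ∈ Finset.range (t.1 (U.a + c)), p (U.a + c) i) ih (t.1 (U.a + l)) t (t'.1 (U.a + l)) t'
    have e1 : ∀ t : (ℕ → ℕ) × Fin (J + 1),
        ψ t.2 + ∑ c ∈ Finset.range (l + 1), ∑ i ∈ Finset.range (t.1 (U.a + c)), p (U.a + c) i =
        (ψ t.2 + ∑ c ∈ Finset.range l, ∑ i ∈ Finset.range (t.1 (U.a + c)), p (U.a + c) i) +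
          ∑ i ∈ Finset.range (t.1 (U.a + l)), p (U.a + l) i := by
      intro t
      rw [Finset.sum_range_succ, add_assoc]
    rw [e1 t, e1 t']
    exact this

end Degrees

/-- The structure maps of the action are maps
`⨂ shom^[I f] (D|f) → shom^[J] (p_* D)` of degree `0`. -/
theorem act_mem {U : TwoOrd} {I : ℕ → ℕ → ℕ} {J : ℕ} (e : SeqOp U I J)
    (D : Diagram.{u, v, w} k) (p : ℕ → ℕ → ℤ)
    (h : ∀ c r, ShomAmb (I c r) (D.F c r) (D.F c (r + 1)))
    (hh : ∀ c r, U.Cell c r → h c r ∈ shomDeg (I c r) (D.F c r) (D.F c (r + 1)) (p c r)) :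
    e.act D p h ∈ shomDeg J (D.src U) (D.tgt U) (U.total p) := by
  intro X n u hu
  let ψ : Fin (J + 1) → ℤ := fun j => ∑ i : Fin J, if i.castSucc < j then n i else 0
  have hψ : ∀ i : Fin J, ψ i.succ - ψ i.castSucc = n i := by
    intro i
    simp only [ψ, ← Finset.sum_sub_distrib]
    rw [Finset.sum_eq_single i]
    · simp
    · intro j _ hj
      have : j.castSucc < i.succ ↔ j.castSucc < i.castSucc := by
        have := Fin.val_ne_of_ne hj
        simp only [Fin.lt_def, Fin.val_castSucc, Fin.val_succ]
        omega
      simp [this]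
    · simp
  have hE := eval_mem e D h X p hh (fun j => (D.cat U.a).kos (e.cross p j) (u j)) ψ
    (fun i => by rw [hψ i]; exact (D.cat U.a).kos_mem _ (hu i)) U.n (U.lo, 0) (U.hi, Fin.last J)
  have hd : (ψ (Fin.last J) + ∑ c ∈ Finset.range U.n, ∑ i ∈ Finset.range (U.hi (U.a + c)),
      p (U.a + c) i) - (ψ 0 + ∑ c ∈ Finset.range U.n, ∑ i ∈ Finset.range (U.lo (U.a + c)),
      p (U.a + c) i) = U.total p + ∑ i, n i := by
    have h1 : ψ (Fin.last J) = ∑ i, n i := by simp [ψ, Fin.castSucc_lt_last]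
    have h2 : ψ 0 = 0 := by simp [ψ]
    have h3 : U.total p = ∑ c ∈ Finset.range U.n, ((∑ i ∈ Finset.range (U.hi (U.a + c)),
        p (U.a + c) i) - ∑ i ∈ Finset.range (U.lo (U.a + c)), p (U.a + c) i) := by
      rw [TwoOrd.total, TwoOrd.cells, Finset.sum_biUnion]
      · rw [Finset.sum_Ico_eq_sum_range, Nat.add_sub_cancel_left]
        refine Finset.sum_congr rfl fun c hc => ?_
        rw [Finset.sum_image (by simp [Set.InjOn]), Finset.sum_Ico_eq_sub]
        exact U.lo_le_hi _ (Nat.le_add_right _ _) (by simpa using hc)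
      · intro c _ c' _ hne
        simp only [Function.onFun, Finset.disjoint_left, Finset.mem_image]
        rintro _ ⟨x, _, rfl⟩ ⟨y, _, hy⟩
        exact hne (congrArg Prod.fst hy).symm
    rw [h1, h2, h3, Finset.sum_sub_distrib]
    ring
  rw [← hd]
  exact zsmul_mem hE _

end SeqOp

/-! ### Algebra structures on `hom^•` -/

/-- A map of set-valued coloured 2-operads. -/
structure TwoOperadMap (O O' : TwoOperadData) where
  app : ∀ {U : TwoOrd} {I : ℕ → ℕ → ℕ} {J : ℕ}, O.obj U I J → O'.obj U I J
  app_comp : ∀ {U V : TwoOrd} (P : TwoOrdMap U V) (I K : ℕ → ℕ → ℕ) (J : ℕ)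
    (lam : ∀ (d s : ℕ) (h : V.Cell d s), O.obj (P.pre d s h) I (K d s)) (mu : O.obj V K J),
    app (O.comp P I K J lam mu) = O'.comp P I K J (fun d s h => app (lam d s h)) (app mu)

/-- The projection of `seq` onto the trivial coloured 2-operad. -/
def seqProj : TwoOperadMap seqOperad trivOperad where
  app _ := ()
  app_comp _ _ _ _ _ _ := rfl

/-- The family `x` with the member at `(c, r)` replaced by `y`. -/
def upd {T : ℕ → ℕ → Type w} (x : ∀ c r, T c r) (c r : ℕ) (y : T c r) : ∀ c r, T c r :=
  Function.update x c (Function.update (x c) r y)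

/-- `h` consists of naive natural transformations `h c r ∈ hom (F c r, F c (r + 1))` of degree
`p c r`, one for every 2-cell of `U`. -/
def NaiveInput (U : TwoOrd) (D : Diagram.{u, v, w} k) (p : ℕ → ℕ → ℤ)
    (h : ∀ c r, ShomAmb 0 (D.F c r) (D.F c (r + 1))) : Prop :=
  ∀ c r, U.Cell c r → h c r ∈ naive (D.F c r) (D.F c (r + 1)) (p c r)

open Classical in
/-- The exponent of the sign produced by moving the differential, from the left, to the factor of
the 2-cell `f`. -/
noncomputable def TwoOrd.leftDeg (U : TwoOrd) (p : ℕ → ℕ → ℤ) (f : ℕ × ℕ) : ℤ :=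
  ∑ g ∈ U.cells, if CellLT g f then p g.1 g.2 else 0

open Classical in
/-- The degrees of the composites over the inverse images of the 2-cells of `V`. -/
noncomputable def TwoOrdMap.pushDeg {U V : TwoOrd} (P : TwoOrdMap U V) (p : ℕ → ℕ → ℤ)
    (d s : ℕ) : ℤ :=
  if h : V.Cell d s then (P.pre d s h).total p else 0

open Classical in
/-- The exponent of the Koszul sign of the permutation that takes the 2-cells of `U` from their
lexicographic order to the order in which they are grouped by the 2-cells of `V` (in the
lexicographic order of the latter). -/
noncomputable def TwoOrdMap.shuffleExp {U V : TwoOrd} (P : TwoOrdMap U V) (p : ℕ → ℕ → ℤ) : ℤ :=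
  ∑ f ∈ U.cells, ∑ g ∈ U.cells,
    if CellLT f g ∧ (∃ (f' g' : ℕ × ℕ) (hf : V.Cell f'.1 f'.2) (hg : V.Cell g'.1 g'.2),
        (P.pre f'.1 f'.2 hf).Cell f.1 f.2 ∧ (P.pre g'.1 g'.2 hg).Cell g.1 g.2 ∧ CellLT g' f')
    then p f.1 f.2 * p g.1 g.2 else 0

open Classical in
/-- An algebra structure over the coloured 2-operad `O` on the family of complexes
`hom^[n](F, G) = hom(F, G)`, that is, a map from `O` to the full coloured 2-operad of this family:
every `o ∈ O (U, I, J)` and every diagram `D` give a map of complexes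
`⨂ hom^[I f] (D|f) → hom^[J] (p_* D)` from the tensor product over the 2-cells `f` of `U` (in their
lexicographic order), compatibly with the compositions.

The map is given by its values `op o D p h` on tensors of elements `h f` of degrees `p f`; it only
depends on the values at the 2-cells of `U` (`op_congr`), preserves degrees, is multilinear and
commutes with the differentials. In `op_comp`, the two sides are transformations between the
composite functors over `V` of `D.push P` and the composite functors over `U` of `D`; these
functors are equal. -/
structure HomAlgebra (k : Type u) [CommRing k] (O : TwoOperadData) where
  op : ∀ {U : TwoOrd} {I : ℕ → ℕ → ℕ} {J : ℕ}, O.obj U I J → ∀ (D : Diagram.{u, v, w} k)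
    (_ : ℕ → ℕ → ℤ) (_ : ∀ c r, ShomAmb 0 (D.F c r) (D.F c (r + 1))),
    ShomAmb 0 (D.src U) (D.tgt U)
  op_congr : ∀ {U : TwoOrd} {I : ℕ → ℕ → ℕ} {J : ℕ} (o : O.obj U I J) (D : Diagram.{u, v, w} k)
    (p p' : ℕ → ℕ → ℤ) (h h' : ∀ c r, ShomAmb 0 (D.F c r) (D.F c (r + 1))),
    (∀ c r, U.Cell c r → p c r = p' c r ∧ h c r = h' c r) → op o D p h = op o D p' h'
  op_mem : ∀ {U : TwoOrd} {I : ℕ → ℕ → ℕ} {J : ℕ} (o : O.obj U I J) (D : Diagram.{u, v, w} k)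
    (p : ℕ → ℕ → ℤ) (h : ∀ c r, ShomAmb 0 (D.F c r) (D.F c (r + 1))), NaiveInput U D p h →
    op o D p h ∈ naive (D.src U) (D.tgt U) (U.total p)
  op_add : ∀ {U : TwoOrd} {I : ℕ → ℕ → ℕ} {J : ℕ} (o : O.obj U I J) (D : Diagram.{u, v, w} k)
    (p : ℕ → ℕ → ℤ) (h : ∀ c r, ShomAmb 0 (D.F c r) (D.F c (r + 1))), NaiveInput U D p h →
    ∀ c r, U.Cell c r → ∀ x ∈ naive (D.F c r) (D.F c (r + 1)) (p c r),
      ∀ y ∈ naive (D.F c r) (D.F c (r + 1)) (p c r),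
      op o D p (upd h c r (x + y)) = op o D p (upd h c r x) + op o D p (upd h c r y)
  op_smul : ∀ {U : TwoOrd} {I : ℕ → ℕ → ℕ} {J : ℕ} (o : O.obj U I J) (D : Diagram.{u, v, w} k)
    (p : ℕ → ℕ → ℤ) (h : ∀ c r, ShomAmb 0 (D.F c r) (D.F c (r + 1))), NaiveInput U D p h →
    ∀ c r, U.Cell c r → ∀ (a : k), ∀ x ∈ naive (D.F c r) (D.F c (r + 1)) (p c r),
      op o D p (upd h c r (a • x)) = a • op o D p (upd h c r x)
  op_d : ∀ {U : TwoOrd} {I : ℕ → ℕ → ℕ} {J : ℕ} (o : O.obj U I J) (D : Diagram.{u, v, w} k)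
    (p : ℕ → ℕ → ℤ) (h : ∀ c r, ShomAmb 0 (D.F c r) (D.F c (r + 1))), NaiveInput U D p h →
    shomD 0 (D.src U) (D.tgt U) (U.total p) (op o D p h) =
      ∑ f ∈ U.cells, Int.negOnePow (U.leftDeg p f) •
        op o D (upd p f.1 f.2 (p f.1 f.2 + 1))
          (upd h f.1 f.2 (shomD 0 (D.F f.1 f.2) (D.F f.1 (f.2 + 1)) (p f.1 f.2) (h f.1 f.2)))
  op_comp : ∀ {U V : TwoOrd} (P : TwoOrdMap U V) (I K : ℕ → ℕ → ℕ) (J : ℕ)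
    (lam : ∀ (d s : ℕ) (hc : V.Cell d s), O.obj (P.pre d s hc) I (K d s)) (mu : O.obj V K J)
    (D : Diagram.{u, v, w} k) (p : ℕ → ℕ → ℤ)
    (h : ∀ c r, ShomAmb 0 (D.F c r) (D.F c (r + 1))), NaiveInput U D p h →
    HEq (op mu (D.push P) (P.pushDeg p)
        (fun d s => if hc : V.Cell d s then op (lam d s hc) D p h else 0))
      (Int.negOnePow (P.shuffleExp p) • op (O.comp P I K J lam mu) D p h)

/-- The pull-back of an algebra structure along a map of coloured 2-operads. -/
noncomputable def HomAlgebra.pullback {O O' : TwoOperadData} (τ : HomAlgebra.{u, v, w} k O')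
    (φ : TwoOperadMap O O') : HomAlgebra.{u, v, w} k O where
  op o := τ.op (φ.app o)
  op_congr o := τ.op_congr (φ.app o)
  op_mem o := τ.op_mem (φ.app o)
  op_add o := τ.op_add (φ.app o)
  op_smul o := τ.op_smul (φ.app o)
  op_d o := τ.op_d (φ.app o)
  op_comp P I K J lam mu D p h hh := by
    rw [φ.app_comp]
    exact τ.op_comp P I K J (fun d s hc => φ.app (lam d s hc)) (φ.app mu) D p h hh

end

/-! An element of `hom(F, G)` of degree `p` is a family of morphisms `φ x` of degree `p` with `φ y ∘
F u = (-1) ^ (p * |u|) G u ∘ φ x` (`mem_naive`). Its image in `shom^[n]` sends a chain to `± G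
(composite of the chain) ∘ φ` at the first vertex (`naiveIncl_apply`). It thus depends on the chain
only through its composite, which gives compatibility with every `σ_*` (`cosimp_naiveIncl`) and,
with the Leibniz rule, with the differentials (`shomD_naiveIncl`). Evaluation on chains of
identities gives injectivity.

For the action, such transformations are fed into the evaluation of `e`. The interval of a 2-cell
becomes one composed morphism and one component at the first mark. Naturality slides the component
to the last mark and on to the end of the chain, and the functors applied on both sides of it merge
into one composite (`Mult.evalStep_naive`). Merging requires that evaluation between positions is
multiplicative (`eval_mult`). Here the axioms of `seq` enter: the marks before a mark `x` form a
lower set that splits no 2-cell of a column earlier than that of `x` (`before_iff_lt_passed`,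
`cut_mark`). After the last column the marks have disappeared, and what remains is, up to sign, the
pasting composite `hor` at the last vertex, precomposed with the composite of the chain
(`eval_naive`).

Only the sign could still depend on `e`. Sliding the components produces one term for each pair of
2-cells `f < g` such that `f` is not finished before the last mark of `g`, and one for each 2-cell
and each morphism of the chain after its last mark. The Koszul signs in the definition of the action
contribute the complementary pairs and the second kind of terms once more. Altogether every pair `f
< g` counts once (`evalExp_eq`), and `e_*` is the operation `naiveOp`, which does not involve `e`
(`act_naiveIncl`).

It remains to see that `naiveOp` is an algebra over the trivial operad. The differential is the
Leibniz rule (`hor_d`, `shomD_naiveOp`). For a map of 2-ordinals, the composites over the cells of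
one column of `V` are combined by the interchange law (`hor_comp`), and the columns are then joined
end to end (`pushTransf_eq`). A count of pairs of cells of `U` (`pairExp_push`) identifies the
resulting sign with the Koszul sign of the regrouping. -/

section

variable {k : Type u} [CommRing k]

/-! ### Koszul sign operators and composites of chains -/

namespace DGCat

/-- Linear maps out of a morphism complex agree if they agree on homogeneous morphisms. -/
theorem hom_ext (A : DGCat.{u, v, w} k) {x y : A.Obj} {M : Type*} [AddCommGroup M] [Module k M]
    {φ ψ : A.Hom x y →ₗ[k] M} (h : ∀ n, ∀ f ∈ A.deg x y n, φ f = ψ f) : φ = ψ := by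
  refine LinearMap.ext fun f => ?_
  have hf : f ∈ ⨆ n, A.deg x y n := by
    rw [(A.internal x y).submodule_iSup_eq_top]; trivial
  induction hf using Submodule.iSup_induction' with
  | mem n f hf => exact h n f hf
  | zero => simp
  | add f g _ _ hf hg => simp only [map_add, hf, hg]

theorem map_units_smul {M N : Type*} [AddCommGroup M] [AddCommGroup N] {F : Type*}
    [FunLike F M N] [AddMonoidHomClass F M N] (φ : F) (c : ℤˣ) (x : M) : φ (c • x) = c • φ x := by
  simp only [Units.smul_def, map_zsmul]

theorem comp_units_smul (A : DGCat.{u, v, w} k) {x y z : A.Obj} (c : ℤˣ) (g : A.Hom y z)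
    (f : A.Hom x y) : A.comp (c • g) f = c • A.comp g f := by
  simp only [Units.smul_def, map_zsmul, LinearMap.smul_apply]

theorem comp_smul' (A : DGCat.{u, v, w} k) {x y z : A.Obj} (c : ℤˣ) (g : A.Hom y z)
    (f : A.Hom x y) : A.comp g (c • f) = c • A.comp g f := map_units_smul _ _ _

theorem kos_one (A : DGCat.{u, v, w} k) (e : ℤ) (x : A.Obj) : A.kos e (A.one x) = A.one x := by
  rw [A.kos_of_mem e (A.one_mem x)]; simp

/-- The exponent `e * n` is additive in the degree `n`; both sides are bilinear, so homogeneous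
arguments suffice. -/
theorem kos_comp (A : DGCat.{u, v, w} k) (e : ℤ) {x y z : A.Obj} (g : A.Hom y z)
    (f : A.Hom x y) : A.kos e (A.comp g f) = A.comp (A.kos e g) (A.kos e f) := by
  have h : (A.comp (x := x) (y := y) (z := z)).compr₂ (A.kos e) =
      A.comp.compl₁₂ (A.kos e) (A.kos e) := by
    refine A.hom_ext fun m g hg => A.hom_ext fun n f hf => ?_
    simp only [LinearMap.compr₂_apply, LinearMap.compl₁₂_apply]
    rw [A.kos_of_mem e hg, A.kos_of_mem e hf, A.kos_of_mem e (A.comp_mem hg hf),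
      comp_units_smul, comp_smul', smul_smul, ← Int.negOnePow_add, mul_add]
  exact LinearMap.congr_fun₂ h g f

theorem kos_add (A : DGCat.{u, v, w} k) (e e' : ℤ) {x y : A.Obj} (f : A.Hom x y) :
    A.kos (e + e') f = A.kos e (A.kos e' f) := by
  have h : A.kos (x := x) (y := y) (e + e') = A.kos e ∘ₗ A.kos e' := by
    refine A.hom_ext fun n f hf => ?_
    rw [LinearMap.comp_apply, A.kos_of_mem e (A.kos_mem e' hf), A.kos_of_mem e' hf,
      A.kos_of_mem _ hf, smul_smul, ← Int.negOnePow_add, add_mul]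
  exact LinearMap.congr_fun h f

theorem kos_zero (A : DGCat.{u, v, w} k) {x y : A.Obj} (f : A.Hom x y) : A.kos 0 f = f := by
  have h : A.kos (x := x) (y := y) 0 = LinearMap.id := by
    refine A.hom_ext fun n f hf => ?_
    rw [A.kos_of_mem _ hf]; simp
  exact LinearMap.congr_fun h f

theorem kos_map {A B : DGCat.{u, v, w} k} (F : DGFunctor A B) (e : ℤ) {x y : A.Obj}
    (f : A.Hom x y) : B.kos e (F.map f) = F.map (A.kos e f) := by
  have h : B.kos e ∘ₗ F.map (x := x) (y := y) = F.map ∘ₗ A.kos e := by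
    refine A.hom_ext fun n f hf => ?_
    rw [LinearMap.comp_apply, LinearMap.comp_apply, A.kos_of_mem _ hf,
      B.kos_of_mem _ (F.map_mem hf), map_units_smul]
  exact LinearMap.congr_fun h f

/-- The differential raises the degree by one, so exchanging it with the sign operator costs `(-1) ^
e`. -/
theorem d_kos' (A : DGCat.{u, v, w} k) (e : ℤ) {x y : A.Obj} (f : A.Hom x y) :
    A.d x y (A.kos e f) = Int.negOnePow e • A.kos e (A.d x y f) := by
  have h : A.d x y ∘ₗ A.kos e = ((Int.negOnePow e : ℤˣ) : ℤ) • (A.kos e ∘ₗ A.d x y) := by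
    refine A.hom_ext fun n f hf => ?_
    rw [LinearMap.comp_apply, LinearMap.smul_apply, LinearMap.comp_apply, A.kos_of_mem _ hf,
      A.kos_of_mem _ (A.d_mem hf), map_units_smul, ← Units.smul_def, smul_smul,
      ← Int.negOnePow_add, mul_add, mul_one]
    congr 1
    rw [Int.negOnePow_eq_iff]
    exact ⟨-e, by ring⟩
  rw [Units.smul_def]
  exact LinearMap.congr_fun h f

/-- Expressing the Koszul sign by the operator `kos 1` on the left factor frees the Leibniz rule
from homogeneity. -/
theorem leibniz_kos (A : DGCat.{u, v, w} k) {x y z : A.Obj} (g : A.Hom y z) (f : A.Hom x y) :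
    A.d x z (A.comp g f) = A.comp (A.d y z g) f + A.comp (A.kos 1 g) (A.d x y f) := by
  have h : (A.comp (x := x) (y := y) (z := z)).compr₂ (A.d x z) =
      A.comp ∘ₗ A.d y z + A.comp.compl₁₂ (A.kos 1) (A.d x y) := by
    refine A.hom_ext fun m g hg => LinearMap.ext fun f => ?_
    simp only [LinearMap.compr₂_apply, LinearMap.compl₁₂_apply, LinearMap.add_apply,
      LinearMap.comp_apply]
    rw [A.leibniz f hg, A.kos_of_mem 1 hg, one_mul, comp_units_smul]
  exact LinearMap.congr_fun₂ h g f

theorem d_one (A : DGCat.{u, v, w} k) (x : A.Obj) : A.d x x (A.one x) = 0 := by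
  have h := A.leibniz_kos (A.one x) (A.one x)
  rw [A.kos_one, A.one_comp, A.one_comp, A.comp_one] at h
  simpa using h

theorem chainComp_self (A : DGCat.{u, v, w} k) {n : ℕ} (X : Fin (n + 1) → A.Obj)
    (u : ∀ i : Fin n, A.Hom (X i.castSucc) (X i.succ)) (a : Fin (n + 1)) :
    A.chainComp X u a a = A.one (X a) := by
  induction a using Fin.cases <;> simp [chainComp] <;> rfl

theorem chainComp_succ (A : DGCat.{u, v, w} k) {n : ℕ} (X : Fin (n + 1) → A.Obj)
    (u : ∀ i : Fin n, A.Hom (X i.castSucc) (X i.succ)) {a : Fin (n + 1)} {b : Fin n}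
    (h : a ≤ b.castSucc) :
    A.chainComp X u a b.succ = A.comp (u b) (A.chainComp X u a b.castSucc) := by
  have h1 : a ≠ b.succ := (h.trans_lt Fin.castSucc_lt_succ).ne
  simp only [chainComp, Fin.induction_succ, h1, dite_false]

/-- The composites of a chain of morphisms `m i (i + 1)`, when `m` is multiplicative. -/
theorem chainComp_eq (A : DGCat.{u, v, w} k) {n : ℕ} (X : Fin (n + 1) → A.Obj)
    (m : ∀ i j, A.Hom (X i) (X j)) (h1 : ∀ i, m i i = A.one (X i))
    (h2 : ∀ i j l, i ≤ j → j ≤ l → A.comp (m j l) (m i j) = m i l) {a b : Fin (n + 1)}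
    (h : a ≤ b) : A.chainComp X (fun i => m i.castSucc i.succ) a b = m a b := by
  induction b using Fin.induction with
  | zero =>
    obtain rfl : a = 0 := le_antisymm h (Fin.zero_le _)
    rw [chainComp_self, h1]
  | succ i ih =>
    rcases h.eq_or_lt with rfl | hlt
    · rw [chainComp_self, h1]
    · have h3 : a ≤ i.castSucc := by
        simpa [Fin.le_def, Fin.lt_def, Nat.lt_succ_iff] using hlt
      rw [chainComp_succ _ _ _ h3, ih h3, h2 _ _ _ h3 Fin.castSucc_lt_succ.le]

theorem chainComp_comp (A : DGCat.{u, v, w} k) {n : ℕ} (X : Fin (n + 1) → A.Obj)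
    (u : ∀ i : Fin n, A.Hom (X i.castSucc) (X i.succ)) {a b c : Fin (n + 1)} (h : a ≤ b)
    (h' : b ≤ c) :
    A.comp (A.chainComp X u b c) (A.chainComp X u a b) = A.chainComp X u a c := by
  induction c using Fin.induction with
  | zero =>
    obtain rfl : b = 0 := le_antisymm h' (Fin.zero_le _)
    rw [chainComp_self, A.one_comp]
  | succ i ih =>
    rcases h'.eq_or_lt with rfl | hlt
    · rw [chainComp_self, A.one_comp]
    · have h3 : b ≤ i.castSucc := by
        simpa [Fin.le_def, Fin.lt_def, Nat.lt_succ_iff] using hlt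
      rw [chainComp_succ _ _ _ h3, chainComp_succ _ _ _ (h.trans h3), A.assoc, ih h3]

theorem chainComp_congr (A : DGCat.{u, v, w} k) {n : ℕ} (X : Fin (n + 1) → A.Obj)
    (u u' : ∀ i : Fin n, A.Hom (X i.castSucc) (X i.succ)) (a b : Fin (n + 1))
    (h : ∀ i : Fin n, i.castSucc < b → u i = u' i) :
    A.chainComp X u a b = A.chainComp X u' a b := by
  induction b using Fin.induction with
  | zero => rfl
  | succ i ih =>
    have e1 := ih (fun j hj => h j (hj.trans Fin.castSucc_lt_succ))
    have e2 := h i Fin.castSucc_lt_succ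
    simp only [chainComp, Fin.induction_succ] at e1 ⊢
    rw [e1, e2]

/-- The chain `u` with the differential moved, from the left, to its `i`-th member. -/
noncomputable def dChain (A : DGCat.{u, v, w} k) {n : ℕ} (X : Fin (n + 1) → A.Obj)
    (u : ∀ i : Fin n, A.Hom (X i.castSucc) (X i.succ)) (i : Fin n) (j : Fin n) :
    A.Hom (X j.castSucc) (X j.succ) :=
  (if i < j then A.kos 1 else if i = j then A.d _ _ else LinearMap.id) (u j)

/-- Iterated Leibniz rule: on its way to the `i`-th factor the differential passes the factors of
larger index, which stand to the left. This is the sign pattern of `shomD`. Members of the chain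
beyond `b` do not enter the composite, hence the restriction on `i`. -/
theorem d_chainComp (A : DGCat.{u, v, w} k) {n : ℕ} (X : Fin (n + 1) → A.Obj)
    (u : ∀ i : Fin n, A.Hom (X i.castSucc) (X i.succ)) (b : Fin (n + 1)) :
    A.d _ _ (A.chainComp X u 0 b) =
      ∑ i : Fin n, if i.castSucc < b then A.chainComp X (A.dChain X u i) 0 b else 0 := by
  induction b using Fin.induction with
  | zero => rw [chainComp_self, d_one]; simp
  | succ j ih =>
    rw [chainComp_succ _ _ _ (Fin.zero_le _), leibniz_kos, ih, map_sum]
    -- The term in which the differential meets the new factor is spread out as a sum over `i`, to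
    -- be added termwise to the sum from the induction hypothesis.
    have e1 : A.comp (A.d _ _ (u j)) (A.chainComp X u 0 j.castSucc) =
        ∑ i : Fin n, if i = j then A.chainComp X (A.dChain X u i) 0 j.succ else 0 := by
      rw [Finset.sum_ite_eq' Finset.univ j, if_pos (Finset.mem_univ _),
        chainComp_succ _ _ _ (Fin.zero_le _),
        A.chainComp_congr X (A.dChain X u j) u]
      · simp [dChain]
      · intro i hi
        have : i < j := hi
        simp [dChain, this.not_gt, this.ne']
    rw [e1, ← Finset.sum_add_distrib]
    refine Finset.sum_congr rfl fun i _ => ?_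
    rcases lt_trichotomy i j with h | h | h
    · have h1 : i.castSucc < j.castSucc := h
      rw [if_neg h.ne, if_pos h1, if_pos (h1.trans Fin.castSucc_lt_succ), zero_add,
        chainComp_succ _ _ _ (Fin.zero_le _)]
      simp [dChain, h]
    · subst h
      simp
    · have h1 : ¬ i.castSucc < j.succ := by
        simp only [Fin.lt_def, Fin.val_castSucc, Fin.val_succ] at h ⊢; omega
      have h2 : ¬ i.castSucc < j.castSucc := by
        simp only [Fin.lt_def, Fin.val_castSucc] at h ⊢; omega
      rw [if_neg h.ne', if_neg h1, if_neg h2]; simp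

end DGCat

/-- Multilinear maps agree if they agree on homogeneous vectors. -/
theorem MultilinearMap.ext_homogeneous (A : DGCat.{u, v, w} k) {n : ℕ}
    {X Y : Fin n → A.Obj} {M : Type w} [AddCommGroup M] [Module k M]
    {f g : MultilinearMap k (fun i => A.Hom (X i) (Y i)) M}
    (h : ∀ (u : ∀ i, A.Hom (X i) (Y i)) (e : Fin n → ℤ), (∀ i, u i ∈ A.deg (X i) (Y i) (e i)) →
      f u = g u) : f = g := by
  -- `S` collects the coordinates that may be inhomogeneous; it grows by one coordinate at a time,
  -- by linearity in that coordinate.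
  have key : ∀ S : Finset (Fin n), ∀ u : (∀ i, A.Hom (X i) (Y i)),
      (∀ i, i ∉ S → ∃ e, u i ∈ A.deg (X i) (Y i) e) → f u = g u := by
    intro S
    induction S using Finset.induction_on with
    | empty =>
      intro u hu
      choose e he using fun i => hu i (Finset.notMem_empty i)
      exact h u e he
    | insert i S hi ih =>
      intro u hu
      have : f.toLinearMap u i = g.toLinearMap u i := by
        refine A.hom_ext fun m x hx => ?_
        simp only [MultilinearMap.toLinearMap_apply]
        refine ih _ fun j hj => ?_
        by_cases hji : j = i
        · subst hji
          exact ⟨m, by simpa using hx⟩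
        · rw [Function.update_of_ne hji]
          exact hu j (by simp [hji, hj])
      simpa using LinearMap.congr_fun this (u i)
  ext u
  exact key Finset.univ u (fun i hi => absurd (Finset.mem_univ i) hi)

/-- The sum of the members of a family before a given position. -/
def partialSum {n : ℕ} (e : Fin n → ℤ) (j : Fin (n + 1)) : ℤ :=
  ∑ i : Fin n, if i.castSucc < j then e i else 0

theorem partialSum_zero {n : ℕ} (e : Fin n → ℤ) : partialSum e 0 = 0 := by simp [partialSum]

theorem partialSum_last {n : ℕ} (e : Fin n → ℤ) : partialSum e (Fin.last n) = ∑ i, e i := by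
  simp [partialSum, Fin.castSucc_lt_last]

theorem partialSum_succ {n : ℕ} (e : Fin n → ℤ) (i : Fin n) :
    partialSum e i.succ - partialSum e i.castSucc = e i := by
  simp only [partialSum, ← Finset.sum_sub_distrib]
  rw [Finset.sum_eq_single i]
  · simp
  · intro j _ hj
    have : j.castSucc < i.succ ↔ j.castSucc < i.castSucc := by
      have := Fin.val_ne_of_ne hj
      simp only [Fin.lt_def, Fin.val_castSucc, Fin.val_succ]
      omega
    simp [this]
  · simp

/-! ### Naive transformations as sign-natural families, and their inclusion into `shom^[n]` -/

section Naive

variable {A B : DGCat.{u, v, w} k} {F G : DGFunctor A B}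

/-- The component at `x` of an element of `shom^[0](F, G)`. -/
def cmpt (Φ : ShomAmb 0 F G) (x : A.Obj) : B.Hom (F.obj x) (G.obj x) :=
  Φ (fun _ => x) (fun i => i.elim0)

/-- The element of `shom^[0](F, G)` with given components. -/
def ofCmpt (φ : ∀ x, B.Hom (F.obj x) (G.obj x)) : ShomAmb 0 F G :=
  fun X => MultilinearMap.constOfIsEmpty k _ (φ (X 0))

@[simp] theorem cmpt_ofCmpt (φ : ∀ x, B.Hom (F.obj x) (G.obj x)) (x : A.Obj) :
    cmpt (ofCmpt φ) x = φ x := rfl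

theorem apply_eq_cmpt (Φ : ShomAmb 0 F G) (X : Fin 1 → A.Obj)
    (u : ∀ i : Fin 0, A.Hom (X i.castSucc) (X i.succ)) : Φ X u = cmpt Φ (X 0) := by
  obtain ⟨x, rfl⟩ : ∃ x, X = fun _ => x :=
    ⟨X 0, funext fun i => congrArg X (Subsingleton.elim _ _)⟩
  exact congrArg _ (Subsingleton.elim _ _)

theorem shom_zero_ext {Φ Ψ : ShomAmb 0 F G} (h : ∀ x, cmpt Φ x = cmpt Ψ x) : Φ = Ψ := by
  funext X
  refine MultilinearMap.ext fun u => ?_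
  rw [apply_eq_cmpt, apply_eq_cmpt, h]

theorem cmpt_shomD (p : ℤ) (Φ : ShomAmb 0 F G) (x : A.Obj) :
    cmpt (shomD 0 F G p Φ) x = B.d _ _ (cmpt Φ x) := by
  simp [cmpt, shomD_apply]

theorem cosimp_vertex (n : ℕ) (i : Fin (n + 1)) (p : ℤ) (Φ : ShomAmb 0 F G)
    (X : Fin (n + 1) → A.Obj) (u : ∀ i : Fin n, A.Hom (X i.castSucc) (X i.succ)) :
    cosimp F G p (vertex n i) Φ X u = B.comp (G.map (A.kos p (A.chainComp X u i (Fin.last n))))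
      (B.comp (cmpt Φ (X i)) (F.map (A.chainComp X u 0 i))) := by
  have h : ∀ v, Φ (X ∘ vertex n i) v = cmpt Φ (X i) := apply_eq_cmpt Φ (X ∘ vertex n i)
  exact congrArg (fun m => B.comp (G.map (A.kos p (A.chainComp X u i (Fin.last n))))
    (B.comp m (F.map (A.chainComp X u 0 i)))) (h _)

theorem naiveIncl_apply (n : ℕ) (p : ℤ) (Φ : ShomAmb 0 F G)
    (X : Fin (n + 1) → A.Obj) (u : ∀ i : Fin n, A.Hom (X i.castSucc) (X i.succ)) :
    naiveIncl n F G p Φ X u =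
      B.comp (G.map (A.kos p (A.chainComp X u 0 (Fin.last n)))) (cmpt Φ (X 0)) := by
  rw [naiveIncl, cosimp_vertex, A.chainComp_self, F.map_one, B.comp_one]

/-- Naturality up to the Koszul sign of transformations of degree `p`. -/
def KosNat (p : ℤ) (φ : ∀ x, B.Hom (F.obj x) (G.obj x)) : Prop :=
  ∀ x y (u : A.Hom x y), B.comp (φ y) (F.map u) = B.comp (G.map (A.kos p u)) (φ x)

/-- On a chain consisting of one morphism `u`, the coface of the vertex `0` gives `G (± u)` after
the component at the source, and that of the vertex `1` gives the component at the target after `F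
u`. Equalizing the cofaces is therefore naturality up to the Koszul sign. -/
theorem mem_naive {p : ℤ} {Φ : ShomAmb 0 F G} : Φ ∈ naive F G p ↔
    (∀ x, cmpt Φ x ∈ B.deg _ _ p) ∧ KosNat p (cmpt Φ) := by
  have h1 : Φ ∈ shomDeg 0 F G p ↔ ∀ x, cmpt Φ x ∈ B.deg _ _ p := by
    refine ⟨fun h x => ?_, fun h X e u _ => ?_⟩
    · simpa [cmpt] using h (fun _ => x) (fun i => i.elim0) (fun i => i.elim0) (fun i => i.elim0)
    · rw [apply_eq_cmpt]
      simpa using h (X 0)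
  have h2 : cosimp F G p (vertex 1 0) Φ = cosimp F G p (vertex 1 1) Φ ↔ KosNat p (cmpt Φ) := by
    have e : ∀ (X : Fin 2 → A.Obj) (u : ∀ i : Fin 1, A.Hom (X i.castSucc) (X i.succ)),
        A.chainComp X u 0 1 = u 0 := by
      intro X u
      exact (A.chainComp_succ X u (b := 0) (Fin.zero_le _)).trans
        ((congrArg _ (A.chainComp_self X u 0)).trans (A.comp_one _))
    have c0 : ∀ (X : Fin 2 → A.Obj) (u : ∀ i : Fin 1, A.Hom (X i.castSucc) (X i.succ)),
        cosimp F G p (vertex 1 0) Φ X u =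
          B.comp (G.map (A.kos p (A.chainComp X u 0 1))) (cmpt Φ (X 0)) := by
      intro X u
      rw [cosimp_vertex, A.chainComp_self, F.map_one, B.comp_one]
      rfl
    have c1 : ∀ (X : Fin 2 → A.Obj) (u : ∀ i : Fin 1, A.Hom (X i.castSucc) (X i.succ)),
        cosimp F G p (vertex 1 1) Φ X u =
          B.comp (cmpt Φ (X 1)) (F.map (A.chainComp X u 0 1)) := by
      intro X u
      rw [cosimp_vertex]
      have : A.chainComp X u 1 (Fin.last 1) = A.one (X 1) := A.chainComp_self X u 1
      rw [this, A.kos_one]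
      exact (congrArg (fun m => B.comp m _) (G.map_one (X 1))).trans (B.one_comp _)
    refine ⟨fun h x y u => ?_, fun h => ?_⟩
    · let X : Fin 2 → A.Obj := Fin.cons x (fun _ => y)
      let U : ∀ i : Fin 1, A.Hom (X i.castSucc) (X i.succ) :=
        fun i => match i with | 0 => u
      have := congrFun h X
      have := congrArg (fun f => f U) this
      simp only [c0, c1, e] at this
      exact this.symm
    · funext X
      refine MultilinearMap.ext fun u => ?_
      rw [c0, c1]
      exact (h _ _ _).symm
  rw [naive, Submodule.mem_inf, LinearMap.mem_eqLocus, h1, h2]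

/-- Differentiate the naturality equation for `u`: the terms containing `d u` cancel by naturality
for `d u`, and what remains is the equation for `d φ`, with one more sign operator from the Leibniz
rule. -/
theorem KosNat.d {p : ℤ} {φ : ∀ x, B.Hom (F.obj x) (G.obj x)} (hφ : KosNat p φ)
    (hp : ∀ x, φ x ∈ B.deg _ _ p) : KosNat (p + 1) (fun x => B.d _ _ (φ x)) := by
  intro x y u
  have h := congrArg (B.d _ _) (hφ x y u)
  rw [B.leibniz _ (hp y), B.leibniz_kos, ← F.map_d, ← G.map_d, A.d_kos', DGCat.kos_map,
    DGCat.map_units_smul, B.comp_units_smul, ← hφ, ← A.kos_add, add_comm] at h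
  rw [add_comm p 1]
  exact add_left_cancel h

theorem shomD_naive {p : ℤ} {Φ : ShomAmb 0 F G} (h : Φ ∈ naive F G p) :
    shomD 0 F G p Φ ∈ naive F G (p + 1) := by
  rw [mem_naive] at h ⊢
  have e : cmpt (shomD 0 F G p Φ) = fun x => B.d _ _ (cmpt Φ x) := funext (cmpt_shomD p Φ)
  rw [e]
  exact ⟨fun x => B.d_mem (h.1 x), h.2.d h.1⟩

theorem naiveIncl_mem (n : ℕ) {p : ℤ} {Φ : ShomAmb 0 F G} (h : Φ ∈ naive F G p) :
    naiveIncl n F G p Φ ∈ shomDeg n F G p := by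
  intro X e u hu
  rw [naiveIncl_apply, add_comm p]
  refine B.comp_mem (G.map_mem (A.kos_mem _ ?_)) ((mem_naive.1 h).1 _)
  have := A.chainComp_mem X u (partialSum e) (fun i => by rw [partialSum_succ]; exact hu i) 0
    (Fin.last n)
  rwa [partialSum_last, partialSum_zero, sub_zero] at this

/-- The Leibniz terms in which the differential meets the chain are exactly the sum subtracted in
`shomD`; only the differential of the component survives. -/
theorem shomD_naiveIncl (n : ℕ) (p : ℤ) (Φ : ShomAmb 0 F G) :
    shomD n F G p (naiveIncl n F G p Φ) = naiveIncl n F G (p + 1) (shomD 0 F G p Φ) := by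
  funext X
  refine MultilinearMap.ext fun u => ?_
  rw [shomD_apply, naiveIncl_apply, naiveIncl_apply, B.leibniz_kos, ← G.map_d, A.d_kos',
    A.d_chainComp, cmpt_shomD, DGCat.kos_map, ← A.kos_add, add_comm 1 p]
  have : ∀ i : Fin n, naiveIncl n F G p Φ X (fun j =>
      (if i < j then A.kos 1 else if i = j then A.d _ _ else LinearMap.id) (u j)) =
      B.comp (G.map (A.kos p (A.chainComp X (A.dChain X u i) 0 (Fin.last n)))) (cmpt Φ (X 0)) :=
    fun i => naiveIncl_apply n p Φ X (A.dChain X u i)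
  simp only [this, Fin.castSucc_lt_last, if_true]
  rw [add_sub_right_comm, DGCat.map_units_smul, B.comp_units_smul, map_sum, map_sum, map_sum,
    LinearMap.sum_apply, sub_self, zero_add]

/-- The component at `x` is recovered by evaluating on the chain of identities of `x`. -/
theorem naiveIncl_injective (n : ℕ) (p : ℤ) {Φ Ψ : ShomAmb 0 F G}
    (h : naiveIncl n F G p Φ = naiveIncl n F G p Ψ) : Φ = Ψ := by
  refine shom_zero_ext fun x => ?_
  have hc : A.chainComp (fun _ : Fin (n + 1) => x) (fun _ => A.one x) 0 (Fin.last n) = A.one x :=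
    A.chainComp_eq (fun _ : Fin (n + 1) => x) (fun _ _ => A.one x) (fun _ => rfl)
      (fun _ _ _ _ _ => A.one_comp _) (Fin.zero_le _)
  have := congrArg (fun f => f (fun _ => A.one x)) (congrFun h (fun _ => x))
  simp only [naiveIncl_apply] at this
  have e : G.map (A.kos p (A.one x)) = B.one (G.obj x) := by rw [A.kos_one, G.map_one]
  have e' : ∀ f : B.Hom (F.obj x) (G.obj x), B.comp (G.map (A.kos p (A.chainComp
      (fun _ : Fin (n + 1) => x) (fun _ => A.one x) 0 (Fin.last n)))) f = f := by
    intro f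
    rw [hc]
    exact (congrArg (fun m => B.comp m f) e).trans (B.one_comp f)
  exact (e' _).symm.trans (this.trans (e' _))

/-- Naturality carries the first outer morphism from the `F` side to the `G` side, where it joins
the inner composite and the other outer morphism to form the composite of the whole chain. -/
theorem cosimp_naiveIncl {m n : ℕ} (σ : Fin (m + 1) →o Fin (n + 1)) {p : ℤ} {Φ : ShomAmb 0 F G}
    (h : Φ ∈ naive F G p) : cosimp F G p σ (naiveIncl m F G p Φ) = naiveIncl n F G p Φ := by
  funext X
  refine MultilinearMap.ext fun u => ?_
  rw [naiveIncl_apply]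
  have e1 : cosimp F G p σ (naiveIncl m F G p Φ) X u =
      B.comp (G.map (A.kos p (A.chainComp X u (σ (Fin.last m)) (Fin.last n))))
        (B.comp (naiveIncl m F G p Φ (X ∘ σ) (fun i => A.chainComp X u (σ i.castSucc) (σ i.succ)))
          (F.map (A.chainComp X u 0 (σ 0)))) := rfl
  have e2 : A.chainComp (X ∘ σ) (fun i => A.chainComp X u (σ i.castSucc) (σ i.succ)) 0
      (Fin.last m) = A.chainComp X u (σ 0) (σ (Fin.last m)) :=
    A.chainComp_eq (X ∘ σ) (fun i j => A.chainComp X u (σ i) (σ j))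
      (fun i => A.chainComp_self X u _)
      (fun i j l h h' => A.chainComp_comp X u (σ.monotone h) (σ.monotone h')) (Fin.zero_le _)
  rw [e1, naiveIncl_apply, e2]
  have e3 := (mem_naive.1 h).2 _ _ (A.chainComp X u 0 (σ 0))
  have hm : σ 0 ≤ σ (Fin.last m) := σ.monotone (Fin.zero_le _)
  simp only [Function.comp_apply] at e3 ⊢
  rw [B.assoc, e3, ← B.assoc, ← B.assoc, ← G.map_comp, ← A.kos_comp,
    A.chainComp_comp X u hm (Fin.le_last _), ← G.map_comp, ← A.kos_comp,
    A.chainComp_comp X u (Fin.zero_le _) (Fin.le_last _)]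

end Naive

end

section

variable {k : Type u} [CommRing k]

theorem upd_same {T : ℕ → ℕ → Type w} (x : ∀ c r, T c r) (c r : ℕ) (y : T c r) :
    upd x c r y c r = y := by simp [upd]

theorem upd_ne {T : ℕ → ℕ → Type w} (x : ∀ c r, T c r) {c r c' r' : ℕ} (y : T c r)
    (h : ¬ (c' = c ∧ r' = r)) : upd x c r y c' r' = x c' r' := by
  by_cases hc : c' = c
  · subst hc
    have : r' ≠ r := fun e => h ⟨rfl, e⟩
    simp [upd, this]
  · simp [upd, hc]

/-! ### Vertical and horizontal composition of sign-natural families -/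

section KosNat

variable {A B C : DGCat.{u, v, w} k}

theorem KosNat.one (F : DGFunctor A B) : KosNat (F := F) (G := F) 0 (fun x => B.one (F.obj x)) := by
  intro x y u
  rw [B.one_comp, B.comp_one, A.kos_zero]

theorem KosNat.vcomp {F G H : DGFunctor A B} {p p' : ℤ} {φ : ∀ x, B.Hom (F.obj x) (G.obj x)}
    {ψ : ∀ x, B.Hom (G.obj x) (H.obj x)} (hψ : KosNat p' ψ) (hφ : KosNat p φ) :
    KosNat (F := F) (G := H) (p' + p) (fun x => B.comp (ψ x) (φ x)) := by
  intro x y u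
  rw [B.assoc, hφ, ← B.assoc, hψ, B.assoc, A.kos_add]

theorem KosNat.hcomp {F G : DGFunctor A B} {F' G' : DGFunctor B C} {p p' : ℤ}
    {φ : ∀ x, B.Hom (F.obj x) (G.obj x)} {ψ : ∀ y, C.Hom (F'.obj y) (G'.obj y)}
    (hψ : KosNat p' ψ) (hφ : KosNat p φ) :
    KosNat (F := F.comp F') (G := G.comp G') (p' + p)
      (fun x => C.comp (ψ (G.obj x)) (F'.map (φ x))) := by
  intro x y u
  have e1 : C.comp (C.comp (ψ (G.obj y)) (F'.map (φ y))) (F'.map (F.map u)) =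
      C.comp (G'.map (G.map (A.kos (p' + p) u))) (C.comp (ψ (G.obj x)) (F'.map (φ x))) := by
    rw [C.assoc, ← F'.map_comp, hφ, F'.map_comp, ← C.assoc, hψ, C.assoc, A.kos_add, DGCat.kos_map]
  exact e1

/-- The inductive step of `hor_d`, for arbitrary morphisms: `ψ` stands for the last column and `f`
for the earlier ones. The differential passes `ψ` before it reaches `f`; the terms of `f` are listed
first, as earlier columns come first in `cellSum`. -/
theorem DGFunctor.d_comp_map (F : DGFunctor B C) {x y : B.Obj} {z : C.Obj}
    {ψ : C.Hom (F.obj y) z} {f : B.Hom x y} {p : ℤ} (hp : ψ ∈ C.deg _ _ p)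
    {R S : Finset ℕ} {T : ℕ → Finset ℕ} {s : ℕ → ℤ} {t : ℕ → ℕ → ℤ} {Ψ : ℕ → C.Hom (F.obj y) z}
    {Φ : ℕ → ℕ → B.Hom x y} (hψ : C.d _ _ ψ = ∑ i ∈ R, Int.negOnePow (s i) • Ψ i)
    (hf : B.d _ _ f = ∑ c ∈ S, ∑ i ∈ T c, Int.negOnePow (t c i) • Φ c i) :
    C.d _ _ (C.comp ψ (F.map f)) =
      (∑ c ∈ S, ∑ i ∈ T c, Int.negOnePow (t c i + p) • C.comp ψ (F.map (Φ c i))) +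
        ∑ i ∈ R, Int.negOnePow (s i) • C.comp (Ψ i) (F.map f) := by
  rw [C.leibniz _ hp, ← F.map_d, hψ, hf, add_comm]
  congr 1
  · simp only [map_sum, Finset.smul_sum]
    refine Finset.sum_congr rfl fun c _ => Finset.sum_congr rfl fun i _ => ?_
    rw [DGCat.map_units_smul, C.comp_smul', smul_smul, ← Int.negOnePow_add, add_comm]
  · simp only [map_sum, LinearMap.sum_apply, C.comp_units_smul]

/-- The inductive step of the interchange law `hor_comp`: the two middle factors are exchanged by
naturality of `v`, then the outer pairs are composed. -/
theorem DGCat.comp_comp_map (F G : DGFunctor B C) {x y z : B.Obj} {w : C.Obj}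
    {m : B.Hom y z} {m' : B.Hom x y} {n : B.Hom x z} {v : ∀ y, C.Hom (F.obj y) (G.obj y)}
    {v' : C.Hom (G.obj z) w} {v'' : C.Hom (F.obj z) w} {s t : ℤˣ}
    (h1 : C.comp (G.map m) (v y) = s • C.comp (v z) (F.map m)) (h2 : B.comp m m' = t • n)
    (h3 : C.comp v' (v z) = v'') :
    C.comp (C.comp v' (G.map m)) (C.comp (v y) (F.map m')) =
      (s * t) • C.comp v'' (F.map n) := by
  rw [C.assoc, ← C.assoc (G.map m), h1, C.comp_units_smul, C.comp_smul', C.assoc, ← F.map_comp,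
    h2, DGCat.map_units_smul, C.comp_smul', C.comp_smul', smul_smul, ← C.assoc, h3]

end KosNat

/-! ### Pasting composites in a diagram: naturality, linearity, differential, interchange -/

namespace Diagram

variable (D : Diagram.{u, v, w} k) (p : ℕ → ℕ → ℤ)
  (h : ∀ c r, ShomAmb 0 (D.F c r) (D.F c (r + 1)))

/-- The vertical composite `F c r → F c s` of the transformations `h c r, …, h c (s - 1)`. -/
def vert (c r : ℕ) : ∀ (s : ℕ) (x : (D.cat c).Obj),
    (D.cat (c + 1)).Hom ((D.F c r).obj x) ((D.F c s).obj x)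
  | 0, x => if hr : r = 0 then (D.cat (c + 1)).eqHom (by rw [hr]) else 0
  | s + 1, x => if hr : r = s + 1 then (D.cat (c + 1)).eqHom (by rw [hr]) else
      (D.cat (c + 1)).comp (cmpt (h c s) x) (vert c r s x)

theorem vert_self (c r : ℕ) (x : (D.cat c).Obj) :
    D.vert h c r r x = (D.cat (c + 1)).one _ := by
  cases r <;> simp [vert] <;> rfl

theorem vert_succ {c r s : ℕ} (hrs : r ≤ s) (x : (D.cat c).Obj) :
    D.vert h c r (s + 1) x = (D.cat (c + 1)).comp (cmpt (h c s) x) (D.vert h c r s x) := by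
  have : r ≠ s + 1 := by omega
  simp [vert, this]

/-- The horizontal composite of the columns `a, …, a + l - 1`, between the composites of the
functors along the paths `q` and `q'`. -/
def hor (a : ℕ) (q q' : ℕ → ℕ) : ∀ (l : ℕ) (x : (D.cat a).Obj),
    (D.cat (a + l)).Hom ((D.path q a l).obj x) ((D.path q' a l).obj x)
  | 0, x => (D.cat a).one x
  | l + 1, x => (D.cat (a + l + 1)).comp
      (D.vert h (a + l) (q (a + l)) (q' (a + l)) ((D.path q' a l).obj x))
      ((D.F (a + l) (q (a + l))).map (hor a q q' l x))

/-- The sum of `φ` over the cells between the paths `q` and `q'`. -/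
def cellSum {M : Type*} [AddCommMonoid M] (a : ℕ) (q q' : ℕ → ℕ) (l : ℕ) (φ : ℕ → ℕ → M) : M :=
  ∑ c ∈ Finset.range l, ∑ i ∈ Finset.Ico (q (a + c)) (q' (a + c)), φ (a + c) i

theorem cellSum_zero {M : Type*} [AddCommMonoid M] (a : ℕ) (q q' : ℕ → ℕ) (φ : ℕ → ℕ → M) :
    cellSum a q q' 0 φ = 0 := by simp [cellSum]

theorem cellSum_succ {M : Type*} [AddCommMonoid M] (a : ℕ) (q q' : ℕ → ℕ) (l : ℕ)
    (φ : ℕ → ℕ → M) : cellSum a q q' (l + 1) φ =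
      cellSum a q q' l φ + ∑ i ∈ Finset.Ico (q (a + l)) (q' (a + l)), φ (a + l) i :=
  Finset.sum_range_succ _ _

theorem cellSum_congr {M : Type*} [AddCommMonoid M] {a : ℕ} {q q' : ℕ → ℕ} {l : ℕ}
    {φ ψ : ℕ → ℕ → M}
    (h : ∀ c r, a ≤ c → c < a + l → q c ≤ r → r < q' c → φ c r = ψ c r) :
    cellSum a q q' l φ = cellSum a q q' l ψ := by
  refine Finset.sum_congr rfl fun c hc => Finset.sum_congr rfl fun i hi => ?_
  rw [Finset.mem_range] at hc
  rw [Finset.mem_Ico] at hi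
  exact h _ _ (by omega) (by omega) hi.1 hi.2

theorem sum_cells {M : Type*} [AddCommMonoid M] (U : TwoOrd) (φ : ℕ × ℕ → M) :
    ∑ f ∈ U.cells, φ f = cellSum U.a U.lo U.hi U.n (fun c r => φ (c, r)) := by
  rw [TwoOrd.cells, Finset.sum_biUnion]
  · rw [Finset.sum_Ico_eq_sum_range, Nat.add_sub_cancel_left]
    exact Finset.sum_congr rfl fun c _ => Finset.sum_image (by simp [Set.InjOn])
  · intro c _ c' _ hne
    simp only [Function.onFun, Finset.disjoint_left, Finset.mem_image]
    rintro _ ⟨x, _, rfl⟩ ⟨y, _, hy⟩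
    exact hne (congrArg Prod.fst hy).symm

/-- `q ≤ q'` on the columns `a, …, a + l - 1`. -/
def PathLE (a l : ℕ) (q q' : ℕ → ℕ) : Prop := ∀ c, a ≤ c → c < a + l → q c ≤ q' c

/-- The transformations at the cells between the paths `q` and `q'` are naive. -/
def NaiveOn (a l : ℕ) (q q' : ℕ → ℕ) : Prop :=
  ∀ c r, a ≤ c → c < a + l → q c ≤ r → r < q' c → h c r ∈ naive (D.F c r) (D.F c (r + 1)) (p c r)

variable {D p h}

theorem PathLE.init {a l : ℕ} {q q' : ℕ → ℕ} (hq : PathLE a (l + 1) q q') : PathLE a l q q' :=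
  fun c h1 h2 => hq c h1 (by omega)

theorem PathLE.top {a l : ℕ} {q q' : ℕ → ℕ} (hq : PathLE a (l + 1) q q') :
    q (a + l) ≤ q' (a + l) := hq _ (by omega) (by omega)

theorem NaiveOn.init {a l : ℕ} {q q' : ℕ → ℕ} (hn : D.NaiveOn p h a (l + 1) q q') :
    D.NaiveOn p h a l q q' := fun c r h1 h2 => hn c r h1 (by omega)

theorem NaiveOn.top {a l : ℕ} {q q' : ℕ → ℕ} (hn : D.NaiveOn p h a (l + 1) q q') :
    ∀ i, q (a + l) ≤ i → i < q' (a + l) →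
      h (a + l) i ∈ naive (D.F (a + l) i) (D.F (a + l) (i + 1)) (p (a + l) i) :=
  fun i h1 h2 => hn _ i (by omega) (by omega) h1 h2

theorem NaiveOn.mono {a l : ℕ} {q q' r r' : ℕ → ℕ} (hn : D.NaiveOn p h a l q q')
    (h1 : PathLE a l q r) (h2 : PathLE a l r' q') : D.NaiveOn p h a l r r' :=
  fun c i ha hl hr hr' => hn c i ha hl ((h1 c ha hl).trans hr) (hr'.trans_le (h2 c ha hl))

theorem vert_naive {c r s : ℕ} (hrs : r ≤ s)
    (hn : ∀ i, r ≤ i → i < s → h c i ∈ naive (D.F c i) (D.F c (i + 1)) (p c i)) :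
    (∀ x, D.vert h c r s x ∈ (D.cat (c + 1)).deg _ _ (∑ i ∈ Finset.Ico r s, p c i)) ∧
      KosNat (∑ i ∈ Finset.Ico r s, p c i) (D.vert h c r s) := by
  induction s, hrs using Nat.le_induction with
  | base =>
    have e : D.vert h c r r = fun x => (D.cat (c + 1)).one _ := funext (D.vert_self h c r)
    rw [e]
    simp only [Finset.Ico_self, Finset.sum_empty]
    exact ⟨fun x => (D.cat (c + 1)).one_mem _, KosNat.one _⟩
  | succ s hs ih =>
    obtain ⟨i1, i2⟩ := ih (fun i h1 h2 => hn i h1 (by omega))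
    have e : D.vert h c r (s + 1) = fun x => (D.cat (c + 1)).comp (cmpt (h c s) x)
      (D.vert h c r s x) := funext (D.vert_succ h hs)
    obtain ⟨n1, n2⟩ := mem_naive.1 (hn s hs (by omega))
    rw [e, Finset.sum_Ico_succ_top hs, add_comm (∑ i ∈ _, _)]
    exact ⟨fun x => (D.cat (c + 1)).comp_mem (n1 x) (i1 x), n2.vcomp i2⟩

theorem hor_naive {a l : ℕ} {q q' : ℕ → ℕ} (hq : PathLE a l q q') (hn : D.NaiveOn p h a l q q') :
    (∀ x, D.hor h a q q' l x ∈ (D.cat (a + l)).deg _ _ (cellSum a q q' l p)) ∧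
      KosNat (cellSum a q q' l p) (D.hor h a q q' l) := by
  induction l with
  | zero =>
    rw [cellSum_zero]
    exact ⟨fun x => (D.cat a).one_mem x, KosNat.one (DGFunctor.id (D.cat a))⟩
  | succ l ih =>
    obtain ⟨i1, i2⟩ := ih hq.init hn.init
    obtain ⟨n1, n2⟩ := vert_naive hq.top hn.top
    rw [cellSum_succ, add_comm (cellSum _ _ _ _ _)]
    exact ⟨fun x => (D.cat (a + l + 1)).comp_mem (n1 _) ((D.F _ _).map_mem (i1 x)), n2.hcomp i2⟩

theorem vert_congr {h' : ∀ c r, ShomAmb 0 (D.F c r) (D.F c (r + 1))} {c r s : ℕ} (hrs : r ≤ s)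
    (hh : ∀ i, r ≤ i → i < s → h c i = h' c i) : D.vert h c r s = D.vert h' c r s := by
  induction s, hrs using Nat.le_induction with
  | base => funext x; rw [vert_self, vert_self]
  | succ s hs ih =>
    funext x
    rw [vert_succ _ _ hs, vert_succ _ _ hs, hh s hs (by omega),
      ih (fun i h1 h2 => hh i h1 (by omega))]

theorem hor_congr {h' : ∀ c r, ShomAmb 0 (D.F c r) (D.F c (r + 1))} {a l : ℕ} {q q' : ℕ → ℕ}
    (hq : PathLE a l q q')
    (hh : ∀ c i, a ≤ c → c < a + l → q c ≤ i → i < q' c → h c i = h' c i) :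
    D.hor h a q q' l = D.hor h' a q q' l := by
  induction l with
  | zero => rfl
  | succ l ih =>
    have e1 := ih hq.init (fun c i h1 h2 => hh c i h1 (by omega))
    have e2 := vert_congr hq.top (fun i => hh (a + l) i (by omega) (by omega))
    funext x
    simp only [hor, e1, e2]
    rfl

/-- The component at `x`, as a linear map. -/
def cmptLin {A B : DGCat.{u, v, w} k} {F G : DGFunctor A B} (x : A.Obj) :
    ShomAmb 0 F G →ₗ[k] B.Hom (F.obj x) (G.obj x) where
  toFun Φ := cmpt Φ x
  map_add' _ _ := rfl
  map_smul' _ _ := rfl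

/-- Exactly one factor of the composite is the replaced one. Providing a single linear map for all
replacements yields additivity and homogeneity together and passes easily through inductions. -/
theorem vert_upd_linear {c i r s : ℕ} (h1 : r ≤ i) (h2 : i < s) (x : (D.cat c).Obj) :
    ∃ L : ShomAmb 0 (D.F c i) (D.F c (i + 1)) →ₗ[k]
        (D.cat (c + 1)).Hom ((D.F c r).obj x) ((D.F c s).obj x),
      ∀ y, D.vert (upd h c i y) c r s x = L y := by
  induction s, (show i + 1 ≤ s from h2) using Nat.le_induction with
  | base =>
    refine ⟨(D.cat (c + 1)).comp.flip (D.vert h c r i x) ∘ₗ cmptLin x, fun y => ?_⟩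
    rw [vert_succ _ _ h1, upd_same, vert_congr (h' := h) h1 (fun j _ hj => upd_ne _ _ (by omega))]
    rfl
  | succ s hs ih =>
    obtain ⟨L, hL⟩ := ih (by omega)
    refine ⟨(D.cat (c + 1)).comp (cmpt (h c s) x) ∘ₗ L, fun y => ?_⟩
    rw [vert_succ _ _ (by omega), upd_ne _ _ (by omega), hL]
    rfl

theorem hor_upd_linear {a l : ℕ} {q q' : ℕ → ℕ} (hq : PathLE a l q q') {c i : ℕ} (hc1 : a ≤ c)
    (hc2 : c < a + l) (h1 : q c ≤ i) (h2 : i < q' c) (x : (D.cat a).Obj) :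
    ∃ L : ShomAmb 0 (D.F c i) (D.F c (i + 1)) →ₗ[k]
        (D.cat (a + l)).Hom ((D.path q a l).obj x) ((D.path q' a l).obj x),
      ∀ y, D.hor (upd h c i y) a q q' l x = L y := by
  induction l with
  | zero => omega
  | succ l ih =>
    by_cases hc : c = a + l
    · subst hc
      obtain ⟨L, hL⟩ := vert_upd_linear (h := h) h1 h2 ((D.path q' a l).obj x)
      refine ⟨(D.cat (a + l + 1)).comp.flip ((D.F (a + l) (q (a + l))).map (D.hor h a q q' l x))
        ∘ₗ L, fun y => ?_⟩
      simp only [hor]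
      rw [hL, hor_congr (h' := h) hq.init (fun c j _ hc _ _ => upd_ne _ _ (by omega))]
      rfl
    · obtain ⟨L, hL⟩ := ih hq.init (by omega)
      refine ⟨(D.cat (a + l + 1)).comp (D.vert h (a + l) (q (a + l)) (q' (a + l))
        ((D.path q' a l).obj x)) ∘ₗ (D.F (a + l) (q (a + l))).map ∘ₗ L, fun y => ?_⟩
      simp only [hor]
      rw [hL, vert_congr (h' := h) hq.top (fun j _ _ => upd_ne _ _ (by omega))]
      rfl

variable (D p h)

/-- The family `h` with the differential applied to the member at the cell `(c, i)`. -/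
noncomputable def dInput (c i : ℕ) : ∀ c r, ShomAmb 0 (D.F c r) (D.F c (r + 1)) :=
  upd h c i (shomD 0 (D.F c i) (D.F c (i + 1)) (p c i) (h c i))

variable {D p h}

/-- In the vertical composite the higher cells stand to the left, so the differential passes the
cells `j > i` before it reaches the cell `i`. -/
theorem vert_d {c r s : ℕ} (hrs : r ≤ s)
    (hn : ∀ i, r ≤ i → i < s → h c i ∈ naive (D.F c i) (D.F c (i + 1)) (p c i))
    (x : (D.cat c).Obj) :
    (D.cat (c + 1)).d _ _ (D.vert h c r s x) = ∑ i ∈ Finset.Ico r s,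
      Int.negOnePow (∑ j ∈ Finset.Ico r s, if i < j then p c j else 0) •
        D.vert (D.dInput p h c i) c r s x := by
  induction s, hrs using Nat.le_induction with
  | base => rw [vert_self, DGCat.d_one]; simp
  | succ s hs ih =>
    have ih := ih (fun i h1 h2 => hn i h1 (by omega))
    rw [vert_succ _ _ hs, DGCat.leibniz _ _ ((mem_naive.1 (hn s hs (by omega))).1 x), ih,
      Finset.sum_Ico_succ_top hs, map_sum, Finset.smul_sum]
    refine (add_comm _ _).trans (congrArg₂ (· + ·) ?_ ?_)
    · refine Finset.sum_congr rfl fun i hi => ?_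
      rw [Finset.mem_Ico] at hi
      rw [DGCat.comp_smul', smul_smul, ← Int.negOnePow_add, Finset.sum_Ico_succ_top hs,
        if_pos hi.2, add_comm (p c s), vert_succ _ _ hs, dInput, upd_ne _ _ (by omega)]
    · have e : (∑ j ∈ Finset.Ico r (s + 1), if s < j then p c j else 0) = 0 := by
        refine Finset.sum_eq_zero fun j hj => ?_
        rw [Finset.mem_Ico] at hj
        exact if_neg (by omega)
      rw [e, Int.negOnePow_zero, one_smul, vert_succ _ _ hs, dInput, upd_same, cmpt_shomD,
        vert_congr (h' := h) hs (fun j _ hj => upd_ne _ _ (by omega))]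

/-- Read from left to right, the pasting composite contains the cells in decreasing lexicographic
order, so the differential passes precisely the lexicographically larger cells. -/
theorem hor_d {a l : ℕ} {q q' : ℕ → ℕ} (hq : PathLE a l q q') (hn : D.NaiveOn p h a l q q')
    (x : (D.cat a).Obj) :
    (D.cat (a + l)).d _ _ (D.hor h a q q' l x) = cellSum a q q' l fun c i =>
      Int.negOnePow (cellSum a q q' l fun c' j => open Classical in
        if CellLT (c, i) (c', j) then p c' j else 0) • D.hor (D.dInput p h c i) a q q' l x := by
  induction l with
  | zero => rw [cellSum_zero]; exact (D.cat a).d_one x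
  | succ l ih =>
    have ih := ih hq.init hn.init
    refine ((D.F (a + l) (q (a + l))).d_comp_map ((vert_naive hq.top hn.top).1 _)
      (vert_d hq.top hn.top _) ih).trans ?_
    rw [cellSum_succ]
    refine congrArg₂ (· + ·) ?_ ?_
    · refine Finset.sum_congr rfl fun c hc => Finset.sum_congr rfl fun i hi => ?_
      rw [Finset.mem_range] at hc
      refine congrArg₂ (fun (e : ℤ) m => Int.negOnePow e • m) ?_ ?_
      · rw [cellSum_succ]
        congr 1
        refine Finset.sum_congr rfl fun j _ => ?_
        rw [if_pos (show CellLT _ _ from .inl (by dsimp only; omega))]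
      · exact congrArg (fun v => (D.cat (a + l + 1)).comp v ((D.F (a + l) (q (a + l))).map
          (D.hor (D.dInput p h (a + c) i) a q q' l x)))
          (congrFun (vert_congr hq.top (fun j _ _ => (upd_ne _ _ (by omega)).symm)) _)
    · refine Finset.sum_congr rfl fun i hi => ?_
      refine congrArg₂ (fun (e : ℤ) m => Int.negOnePow e • m) ?_ ?_
      · rw [cellSum_succ]
        have e0 : (cellSum a q q' l fun c' j => open Classical in
            if CellLT (a + l, i) (c', j) then p c' j else 0) = 0 := by
          refine Finset.sum_eq_zero fun c hc => Finset.sum_eq_zero fun j _ => ?_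
          rw [Finset.mem_range] at hc
          exact if_neg (by simp only [CellLT]; omega)
        rw [e0, zero_add]
        refine Finset.sum_congr rfl fun j _ => ?_
        simp only [CellLT, lt_irrefl, false_or, true_and]
      · exact congrArg (fun v => (D.cat (a + l + 1)).comp
          (D.vert (D.dInput p h (a + l) i) (a + l) (q (a + l)) (q' (a + l)) _)
            ((D.F (a + l) (q (a + l))).map v))
          (congrFun (hor_congr hq.init (fun c j _ hc _ _ => (upd_ne _ _ (by omega)).symm)) _)

theorem vert_comp {c r r' s : ℕ} (h1 : r ≤ r') (h2 : r' ≤ s) (x : (D.cat c).Obj) :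
    (D.cat (c + 1)).comp (D.vert h c r' s x) (D.vert h c r r' x) = D.vert h c r s x := by
  induction s, h2 using Nat.le_induction with
  | base => rw [vert_self, DGCat.one_comp]
  | succ s hs ih => rw [vert_succ _ _ hs, DGCat.assoc, ih, vert_succ _ _ (h1.trans hs)]

/-- The exponent of the sign in the vertical composition of horizontal composites. -/
def interchange (p : ℕ → ℕ → ℤ) (a : ℕ) (q q' q'' : ℕ → ℕ) (l : ℕ) : ℤ :=
  ∑ c ∈ Finset.range l, (∑ i ∈ Finset.Ico (q (a + c)) (q' (a + c)), p (a + c) i) *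
    cellSum a q' q'' c p

/-- Interchange law. In the last column the earlier columns of the upper composite have to cross the
lower vertical composite, by naturality of the latter; the product of the two degrees is the summand
of `interchange` at this column. -/
theorem hor_comp {a l : ℕ} {q q' q'' : ℕ → ℕ} (hq : PathLE a l q q') (hq' : PathLE a l q' q'')
    (hn : D.NaiveOn p h a l q q'') (x : (D.cat a).Obj) :
    (D.cat (a + l)).comp (D.hor h a q' q'' l x) (D.hor h a q q' l x) =
      Int.negOnePow (interchange p a q q' q'' l) • D.hor h a q q'' l x := by
  induction l with
  | zero =>
    simp only [interchange, Finset.range_zero, Finset.sum_empty, Int.negOnePow_zero, one_smul]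
    exact (D.cat a).one_comp _
  | succ l ih =>
    have ih := ih hq.init hq'.init hn.init
    have hn1 : D.NaiveOn p h a (l + 1) q q' := hn.mono (fun _ _ _ => le_rfl) hq'
    have hn2 : D.NaiveOn p h a (l + 1) q' q'' := hn.mono hq (fun _ _ _ => le_rfl)
    have nat := (vert_naive hq.top hn1.top).2 _ _ (D.hor h a q' q'' l x)
    -- A sign is its own inverse, so the naturality equation can be solved for the other side.
    rw [DGCat.kos_of_mem _ _ ((hor_naive hq'.init hn2.init).1 x), DGCat.map_units_smul,
      DGCat.comp_units_smul, ← inv_smul_eq_iff, Int.units_inv_eq_self] at nat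
    have e := DGCat.comp_comp_map (D.F (a + l) (q (a + l))) (D.F (a + l) (q' (a + l)))
      (v := D.vert h (a + l) (q (a + l)) (q' (a + l))) nat.symm ih
      (vert_comp (h := h) hq.top hq'.top _)
    rw [← Int.negOnePow_add] at e
    rw [interchange, Finset.sum_range_succ, add_comm (∑ c ∈ _, _)]
    exact e

end Diagram

end

/-! ### Cuts of the set of marks -/

section

variable {k : Type u} [CommRing k]

/-- A downward closed subset of an interval is an initial segment, hence determined by its
cardinality. This makes the counting definition of `passed` usable. -/
theorem Nat.lt_add_card_filter_iff {a b : ℕ} (P : ℕ → Prop) [DecidablePred P]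
    (hP : ∀ r s, a ≤ r → r ≤ s → s < b → P s → P r) {r : ℕ} (h1 : a ≤ r) (h2 : r < b) :
    r < a + ((Finset.Ico a b).filter P).card ↔ P r := by
  have key : ∃ m, a ≤ m ∧ m ≤ b ∧ ∀ r, a ≤ r → r < b → (r < m ↔ P r) := by
    have hab : a ≤ b := by omega
    clear h1 h2
    induction b, hab using Nat.le_induction with
    | base => exact ⟨a, le_rfl, le_rfl, fun r h1 h2 => by omega⟩
    | succ b hb ih =>
      obtain ⟨m, m1, m2, m3⟩ := ih (fun r s h1 h2 h3 => hP r s h1 h2 (by omega))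
      by_cases hPb : P b
      · exact ⟨b + 1, by omega, le_rfl, fun r h1 h2 =>
          ⟨fun _ => hP r b h1 (by omega) (by omega) hPb, fun _ => h2⟩⟩
      · refine ⟨m, m1, by omega, fun r h1 h2 => ?_⟩
        rcases Nat.lt_succ_iff_lt_or_eq.1 h2 with h | rfl
        · exact m3 r h1 h
        · exact ⟨fun h => by omega, fun h => absurd h hPb⟩
  obtain ⟨m, m1, m2, m3⟩ := key
  have e : (Finset.Ico a b).filter P = Finset.Ico a m := by
    ext i
    simp only [Finset.mem_filter, Finset.mem_Ico]
    constructor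
    · rintro ⟨⟨i1, i2⟩, i3⟩
      exact ⟨i1, (m3 i i1 i2).2 i3⟩
    · rintro ⟨i1, i2⟩
      exact ⟨⟨i1, by omega⟩, (m3 i i1 (by omega)).1 i2⟩
  rw [e, Nat.card_Ico, Nat.add_sub_of_le m1, m3 r h1 h2]

namespace SeqOp

variable {U : TwoOrd} {I : ℕ → ℕ → ℕ} {J : ℕ} (e : SeqOp U I J)

/-- The position `t` cuts the set of marks into the lower set `S` and its complement, without
separating the marks of a 2-cell in the first `l` columns. -/
structure Cut (l : ℕ) (S : Mark U I → Prop) (t : (ℕ → ℕ) × Fin (J + 1)) : Prop where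
  lower : ∀ x y, e.le x y → S y → S x
  bound : ∀ c, U.a ≤ c → c < U.a + l → U.lo c ≤ t.1 c ∧ t.1 c ≤ U.hi c
  iff : ∀ y : Mark U I, y.c < U.a + l → (S y ↔ y.r < t.1 y.c)
  W_le : ∀ y, S y → e.W y ≤ t.2
  le_W : ∀ y, ¬ S y → t.2 ≤ e.W y

/-- The marks before `x`. -/
def Before (x y : Mark U I) : Prop := e.le y x ∧ y ≠ x

variable {e}

theorem Cut.init {l : ℕ} {S : Mark U I → Prop} {t : (ℕ → ℕ) × Fin (J + 1)}
    (h : e.Cut (l + 1) S t) : e.Cut l S t where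
  lower := h.lower
  bound c h1 h2 := h.bound c h1 (by omega)
  iff y hy := h.iff y (by omega)
  W_le := h.W_le
  le_W := h.le_W

theorem cut_src {l : ℕ} (hl : l ≤ U.n) : e.Cut l (fun _ => False) (U.lo, 0) where
  lower _ _ _ h := h
  bound c h1 h2 := ⟨le_rfl, U.lo_le_hi c h1 (by omega)⟩
  iff y _ := ⟨fun h => h.elim, fun h => absurd h (not_lt.2 y.cell.2.2.1)⟩
  W_le _ h := h.elim
  le_W _ _ := Fin.zero_le _

theorem cut_tgt {l : ℕ} (hl : l ≤ U.n) : e.Cut l (fun _ => True) (U.hi, Fin.last J) where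
  lower _ _ _ h := h
  bound c h1 h2 := ⟨U.lo_le_hi c h1 (by omega), le_rfl⟩
  iff y _ := ⟨fun _ => y.cell.2.2.2, fun _ => trivial⟩
  W_le _ _ := Fin.le_last _
  le_W _ h := absurd trivial h

/-- By axiom (2) a mark of a later column cannot lie between two marks of a cell of an earlier
column: if one mark of the cell precedes `x`, all do. By axiom (3) the cells of a column that
precede `x` are downward closed, so counting them is enough. -/
theorem before_iff_lt_passed (x y : Mark U I) (hc : y.c < x.c) :
    e.Before x y ↔ y.r < e.passed x y.c := by
  classical
  rw [passed, Nat.lt_add_card_filter_iff _ _ y.cell.2.2.1 y.cell.2.2.2]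
  · refine ⟨fun h z z1 z2 => ?_, fun h => h y rfl rfl⟩
    have hz : z ≠ x := fun q => by subst q; omega
    refine ⟨(e.total z x).resolve_right fun q => ?_, hz⟩
    have := e.nested y z x z1.symm z2.symm (fun q => by omega) h.1 q
    omega
  · intro r s h1 h2 h3 hs z z1 z2
    have hz : z ≠ x := fun q => by subst q; omega
    rcases h2.eq_or_lt with rfl | hlt
    · exact hs z z1 z2
    · have hcell : U.Cell y.c s := ⟨y.cell.1, y.cell.2.1, by omega, h3⟩
      -- The ordinals are non-empty, so the cell `s` has a mark `0`, which separates `z` from `x`.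
      have := hs ⟨y.c, s, 0, hcell, Nat.zero_le _⟩ rfl rfl
      exact ⟨e.trans _ _ _ (e.le_of_lt z ⟨y.c, s, 0, hcell, Nat.zero_le _⟩ z1 (by
        rw [z2]; exact hlt)) this.1, hz⟩

theorem passed_bound (x : Mark U I) (c : ℕ) (h : U.lo c ≤ U.hi c) :
    U.lo c ≤ e.passed x c ∧ e.passed x c ≤ U.hi c := by
  classical
  refine ⟨Nat.le_add_right _ _, ?_⟩
  have := Finset.card_filter_le (Finset.Ico (U.lo c) (U.hi c))
    (fun r => ∀ y : Mark U I, y.c = c → y.r = r → e.le y x ∧ y ≠ x)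
  rw [Nat.card_Ico] at this
  rw [passed]
  have h2 : ∀ m, m ≤ U.hi c - U.lo c → U.lo c + m ≤ U.hi c := fun m hm => by omega
  refine h2 _ (le_trans (le_of_eq ?_) this)
  congr

/-- Only the columns before that of `x` are claimed to be cut cleanly: a cell in the column of `x`
or in a later one may have marks on both sides of `x`. -/
theorem cut_mark (x : Mark U I) {l : ℕ} (hl : U.a + l ≤ x.c) :
    e.Cut l (e.Before x) (e.pos x) where
  lower y z h hz := by
    refine ⟨e.trans _ _ _ h hz.1, fun q => hz.2 (e.antisymm _ _ hz.1 (q ▸ h))⟩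
  bound c h1 h2 := passed_bound x c (U.lo_le_hi c h1 (by have := x.cell.2.1; omega))
  iff y hy := before_iff_lt_passed x y (by omega)
  W_le y h := e.mono _ _ h.1
  le_W y h := by
    rcases e.total y x with q | q
    · have : y = x := by_contra fun h' => h ⟨q, h'⟩
      exact le_of_eq (this ▸ rfl)
    · exact e.mono _ _ q

/-- If the paths were in the wrong order at some column, the mark `0` of the cell just above the
second path would lie in `S` but not in `S'`. -/
theorem Cut.mono {l : ℕ} {S S' : Mark U I → Prop} {t t' : (ℕ → ℕ) × Fin (J + 1)}
    (h : e.Cut l S t) (h' : e.Cut l S' t') (hl : l ≤ U.n) (hS : ∀ y, S y → S' y) :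
    Diagram.PathLE U.a l t.1 t'.1 := by
  intro c c1 c2
  by_contra hlt
  have b := h.bound c c1 c2
  have b' := h'.bound c c1 c2
  have hcell : U.Cell c (t'.1 c) := ⟨c1, by omega, b'.1, by omega⟩
  have q := (h.iff ⟨c, t'.1 c, 0, hcell, Nat.zero_le _⟩ c2).2 (not_le.1 hlt)
  exact lt_irrefl _ ((h'.iff _ c2).1 (hS _ q))

/-- The 2-cells `(c, r), …, (c, s - 1)` lie between the sets of marks `S` and `S'`. -/
def Between (U : TwoOrd) (I : ℕ → ℕ → ℕ) (S S' : Mark U I → Prop) (c r s : ℕ) : Prop :=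
  ∀ i, r ≤ i → i < s → U.Cell c i ∧ ∀ y : Mark U I, y.c = c → y.r = i → ¬ S y ∧ S' y

/-- Supplies, for the next column, the data needed to evaluate it: the cells met on the way from `t`
to `t'` have all their marks between the two cuts. -/
theorem Cut.between {l : ℕ} {S S' : Mark U I → Prop} {t t' : (ℕ → ℕ) × Fin (J + 1)}
    (h : e.Cut (l + 1) S t) (h' : e.Cut (l + 1) S' t') (hl : l < U.n) :
    Between U I S S' (U.a + l) (t.1 (U.a + l)) (t'.1 (U.a + l)) := by
  intro i h1 h2
  have b := h.bound (U.a + l) (by omega) (by omega)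
  have b' := h'.bound (U.a + l) (by omega) (by omega)
  refine ⟨⟨by omega, by omega, by omega, by omega⟩, fun y y1 y2 => ?_⟩
  have e1 := h.iff y (by omega)
  have e2 := h'.iff y (by omega)
  rw [y1, y2] at e1 e2
  rw [e1, e2]
  omega

theorem Between.init {S S' : Mark U I → Prop} {c r s : ℕ} (h : Between U I S S' c r (s + 1)) :
    Between U I S S' c r s := fun i h1 h2 => h i h1 (by omega)

/-- Cutting at a mark of the last 2-cell. -/
theorem Between.before {S S' : Mark U I → Prop} {c r s : ℕ}
    (h : Between U I S S' c r (s + 1)) (x : Mark U I) (hc : x.c = c)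
    (hr : x.r = s) : Between U I S (e.Before x) c r s := fun i h1 h2 =>
  ⟨(h i h1 (by omega)).1, fun y y1 y2 => ⟨((h i h1 (by omega)).2 y y1 y2).1,
    e.le_of_lt y x (by omega) (by omega), fun q => by subst q; omega⟩⟩

/-! ### Multiplicativity of the evaluation, and its values on naive transformations -/

section Eval

variable {D : Diagram.{u, v, w} k} {l : ℕ}
  {X : Fin (J + 1) → (D.cat U.a).Obj}

/-- Comparison of positions together with the sets of marks that they cut off. -/
def PosLE (S S' : Mark U I → Prop) (t t' : (ℕ → ℕ) × Fin (J + 1)) : Prop :=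
  (∀ y, S y → S' y) ∧ t.2 ≤ t'.2

theorem PosLE.trans {S S' S'' : Mark U I → Prop} {t t' t'' : (ℕ → ℕ) × Fin (J + 1)}
    (h : PosLE S S' t t') (h' : PosLE S' S'' t' t'') : PosLE S S'' t t'' :=
  ⟨fun y hy => h'.1 y (h.1 y hy), h.2.trans h'.2⟩

theorem Cut.posLE_mark {S : Mark U I → Prop} {t : (ℕ → ℕ) × Fin (J + 1)} (h : e.Cut l S t)
    {x : Mark U I} (hx : ¬ S x) : PosLE S (e.Before x) t (e.pos x) :=
  ⟨fun y hy => ⟨(e.total y x).resolve_right fun q => hx (h.lower _ _ q hy),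
    fun q => hx (q ▸ hy)⟩, h.le_W x hx⟩

theorem Cut.mark_posLE {S : Mark U I → Prop} {t : (ℕ → ℕ) × Fin (J + 1)} (h : e.Cut l S t)
    {x : Mark U I} (hx : S x) : PosLE (e.Before x) S (e.pos x) t :=
  ⟨fun _ hy => h.lower _ _ hy.1 hx, h.W_le x hx⟩

theorem posLE_mark_mark {x y : Mark U I} (h : e.le x y) :
    PosLE (e.Before x) (e.Before y) (e.pos x) (e.pos y) :=
  ⟨fun _ hz => ⟨e.trans _ _ _ hz.1 h, fun q => hz.2 (e.antisymm _ _ hz.1 (q ▸ h))⟩, e.mono _ _ h⟩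

variable (e) in
/-- The morphisms `prev` between positions are compatible with composition at cuts. -/
structure Mult (prev : ∀ t t', (D.cat (U.a + l)).Hom (ob U D X l t) (ob U D X l t')) : Prop where
  self : ∀ t, prev t t = (D.cat (U.a + l)).one _
  comp : ∀ {S S' S'' t t' t''}, e.Cut l S t → e.Cut l S' t' → e.Cut l S'' t'' →
    PosLE S S' t t' → PosLE S' S'' t' t'' →
    (D.cat (U.a + l)).comp (prev t' t'') (prev t t') = prev t t''

variable (h : ∀ c r, ShomAmb (I c r) (D.F c r) (D.F c (r + 1)))
  {prev : ∀ t t', (D.cat (U.a + l)).Hom (ob U D X l t) (ob U D X l t')}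

theorem evalStep_self (r : ℕ) (t t' : (ℕ → ℕ) × Fin (J + 1)) :
    evalStep e D h X l prev r t r t' = (D.F (U.a + l) r).map (prev t t') := by
  cases r <;> simp only [evalStep, dite_true] <;> exact DGCat.one_comp _ _

theorem evalStep_succ {r s : ℕ} (hrs : r ≤ s) (hc : U.Cell (U.a + l) s)
    (t t' : (ℕ → ℕ) × Fin (J + 1)) :
    evalStep e D h X l prev r t (s + 1) t' =
      (D.cat (U.a + l + 1)).comp
        ((D.F (U.a + l) (s + 1)).map (prev (e.pos (mark I hc (Fin.last _))) t'))
        ((D.cat (U.a + l + 1)).comp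
          (h (U.a + l) s (fun i => ob U D X l (e.pos (mark I hc i)))
            (fun i => prev (e.pos (mark I hc i.castSucc)) (e.pos (mark I hc i.succ))))
          (evalStep e D h X l prev r t s (e.pos (mark I hc 0)))) := by
  have : r ≠ s + 1 := by omega
  simp only [evalStep, this, hc, dite_true, dite_false]

/-- After the last cell passed, the evaluation only applies a functor to the rest of the chain;
prolonging the chain therefore composes inside this functor. -/
theorem Mult.map_comp_evalStep (hm : e.Mult prev) {S S' S'' : Mark U I → Prop}
    {t t' t'' : (ℕ → ℕ) × Fin (J + 1)} (ht : e.Cut l S t) (ht' : e.Cut l S' t')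
    (ht'' : e.Cut l S'' t'') (h1 : PosLE S S' t t') (h2 : PosLE S' S'' t' t'')
    {r s : ℕ} (hrs : r ≤ s) (hb : Between U I S S' (U.a + l) r s) :
    (D.cat (U.a + l + 1)).comp ((D.F (U.a + l) s).map (prev t' t''))
      (evalStep e D h X l prev r t s t') = evalStep e D h X l prev r t s t'' := by
  rcases hrs.eq_or_lt with rfl | hlt
  · rw [evalStep_self, evalStep_self, ← DGFunctor.map_comp, hm.comp ht ht' ht'' h1 h2]
  · obtain ⟨s, rfl⟩ : ∃ s', s = s' + 1 := ⟨s - 1, by omega⟩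
    obtain ⟨hc, hS⟩ := hb s (by omega) (by omega)
    rw [evalStep_succ h (by omega) hc, evalStep_succ h (by omega) hc, ← DGCat.assoc,
      ← DGFunctor.map_comp, hm.comp (cut_mark _ le_rfl) ht' ht''
        (ht'.mark_posLE (hS (mark I hc (Fin.last _)) rfl rfl).2) h2]

/-- The cells of the left factor are peeled off from the top; when none is left, only the
prolongation of `Mult.map_comp_evalStep` remains. -/
theorem Mult.evalStep_comp (hm : e.Mult prev) {S S' S'' : Mark U I → Prop}
    {t t' t'' : (ℕ → ℕ) × Fin (J + 1)} (ht : e.Cut l S t) (ht' : e.Cut l S' t')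
    (ht'' : e.Cut l S'' t'') (h1 : PosLE S S' t t') (h2 : PosLE S' S'' t' t'')
    {r r' s : ℕ} (hr : r ≤ r') (hs : r' ≤ s) (hb : Between U I S S' (U.a + l) r r')
    (hb' : Between U I S' S'' (U.a + l) r' s) :
    (D.cat (U.a + l + 1)).comp (evalStep e D h X l prev r' t' s t'')
      (evalStep e D h X l prev r t r' t') = evalStep e D h X l prev r t s t'' := by
  induction s, hs using Nat.le_induction generalizing S'' t'' with
  | base =>
    rw [evalStep_self]
    exact hm.map_comp_evalStep h ht ht' ht'' h1 h2 hr hb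
  | succ s hs ih =>
    obtain ⟨hc, hS⟩ := hb' s (by omega) (by omega)
    rw [evalStep_succ h hs hc, evalStep_succ h (hr.trans hs) hc, DGCat.assoc, DGCat.assoc,
      ih (cut_mark _ le_rfl) (ht'.posLE_mark (hS _ rfl rfl).1) (hb'.before (mark I hc 0) rfl rfl)]

/-- Induction on the columns, starting from associativity of composition in a chain. The
transformations are arbitrary here: a clean cut never falls inside the interval occupied by a cell
of the columns evaluated so far. -/
theorem eval_mult (hl : l ≤ U.n) (u : ∀ i : Fin J, (D.cat U.a).Hom (X i.castSucc) (X i.succ)) :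
    e.Mult (eval e D h X u l) := by
  induction l with
  | zero => exact ⟨fun t => (D.cat U.a).chainComp_self X u _, fun _ _ _ h1 h2 =>
      (D.cat U.a).chainComp_comp X u h1.2 h2.2⟩
  | succ l ih =>
    have hm := ih (by omega)
    refine ⟨fun t => ?_, fun {S S' S'' t t' t''} ht ht' ht'' h1 h2 => ?_⟩
    · exact (evalStep_self h _ t t).trans ((congrArg _ (hm.self t)).trans (DGFunctor.map_one _ _))
    · exact hm.evalStep_comp h ht.init ht'.init ht''.init h1 h2
        (ht.mono ht' hl h1.1).top (ht'.mono ht'' hl h2.1).top (ht.between ht' hl)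
        (ht'.between ht'' hl)

variable (e) in
open Classical in
/-- The position of the last mark of a 2-cell. -/
noncomputable def lastPos (c r : ℕ) : (ℕ → ℕ) × Fin (J + 1) :=
  if hc : U.Cell c r then e.pos (mark I hc (Fin.last _)) else (U.lo, 0)

theorem lastPos_of_cell {c r : ℕ} (hc : U.Cell c r) :
    e.lastPos c r = e.pos (mark I hc (Fin.last _)) := by
  simp [lastPos, hc]

/-- All dependence on the marks goes into the sign: each component is slid from the first mark of
its cell to the last one, and then past the rest of the chain to the end point `t'`. The first move
only undoes the sign operator in `naiveIncl`; the second costs the degree of the component times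
that of the rest of the chain. -/
theorem Mult.evalStep_naive (hm : e.Mult prev) {p : ℕ → ℕ → ℤ}
    {h : ∀ c r, ShomAmb 0 (D.F c r) (D.F c (r + 1))} (hn : NaiveInput U D p h)
    {φ : (ℕ → ℕ) × Fin (J + 1) → ℤ}
    (hp : ∀ t t', prev t t' ∈ (D.cat (U.a + l)).deg _ _ (φ t' - φ t)) {S S' : Mark U I → Prop}
    {t t' : (ℕ → ℕ) × Fin (J + 1)} (ht : e.Cut l S t) (ht' : e.Cut l S' t')
    (h1 : PosLE S S' t t') {r s : ℕ} (hrs : r ≤ s) (hb : Between U I S S' (U.a + l) r s) :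
    evalStep e D (fun c r => naiveIncl (I c r) (D.F c r) (D.F c (r + 1)) (p c r) (h c r)) X l
      prev r t s t' =
      Int.negOnePow (∑ i ∈ Finset.Ico r s, p (U.a + l) i * (φ t' - φ (e.lastPos (U.a + l) i))) •
        (D.cat (U.a + l + 1)).comp (D.vert h (U.a + l) r s (ob U D X l t'))
          ((D.F (U.a + l) r).map (prev t t')) := by
  induction s, hrs using Nat.le_induction generalizing S' t' with
  | base =>
    rw [evalStep_self, Diagram.vert_self, DGCat.one_comp]; simp
  | succ s hs ih =>
    obtain ⟨hc, hS⟩ := hb s (by omega) (by omega)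
    obtain ⟨n1, n2⟩ := mem_naive.1 (hn _ _ hc)
    have z0 := ht.posLE_mark (hS (mark I hc 0) rfl rfl).1
    have zl := ht'.mark_posLE (hS (mark I hc (Fin.last _)) rfl rfl).2
    have z0l : PosLE _ _ (e.pos (mark I hc 0)) (e.pos (mark I hc (Fin.last _))) :=
      posLE_mark_mark (e.le_of_le _ _ rfl rfl (Nat.zero_le _))
    -- By multiplicativity the morphisms between consecutive marks compose to the single morphism
    -- from the first mark to the last.
    have ce := (D.cat (U.a + l)).chainComp_eq (fun i => ob U D X l (e.pos (mark I hc i)))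
      (fun i j => prev (e.pos (mark I hc i)) (e.pos (mark I hc j))) (fun i => hm.self _)
      (fun i j m hij hjm => hm.comp (cut_mark _ le_rfl) (cut_mark _ le_rfl) (cut_mark _ le_rfl)
        (posLE_mark_mark (e.le_of_le _ _ rfl rfl hij))
        (posLE_mark_mark (e.le_of_le _ _ rfl rfl hjm))) (Fin.zero_le (Fin.last (I (U.a + l) s)))
    have nat := n2 _ _ (prev (e.pos (mark I hc (Fin.last _))) t')
    rw [DGCat.kos_of_mem _ _ (hp _ _), DGCat.map_units_smul, DGCat.comp_units_smul,
      ← inv_smul_eq_iff, Int.units_inv_eq_self] at nat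
    have m1 := hm.map_comp_evalStep
      (fun c r => naiveIncl (I c r) (D.F c r) (D.F c (r + 1)) (p c r) (h c r)) ht
      (cut_mark (mark I hc 0) le_rfl) (cut_mark (mark I hc (Fin.last _)) le_rfl) z0 z0l hs
      (hb.before _ rfl rfl)
    have m2 := hm.map_comp_evalStep
      (fun c r => naiveIncl (I c r) (D.F c r) (D.F c (r + 1)) (p c r) (h c r)) ht
      (cut_mark (mark I hc (Fin.last _)) le_rfl) ht' (z0.trans z0l) zl hs
      (hb.before _ rfl rfl)
    -- `← n2` moves the component to the last mark and `m1` absorbs the interval of the cell; `←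
    -- nat` moves it to `t'` and `m2` absorbs the rest of the chain.
    rw [evalStep_succ _ hs hc, naiveIncl_apply, ce, ← n2, DGCat.assoc, m1, ← DGCat.assoc, ← nat,
      DGCat.comp_units_smul, DGCat.assoc, m2, ih ht' h1 hb.init, DGCat.comp_smul', smul_smul,
      ← Int.negOnePow_add, ← DGCat.assoc, Diagram.vert_succ _ _ hs, Finset.sum_Ico_succ_top hs,
      add_comm (∑ i ∈ _, _), lastPos_of_cell hc]

/-- The degree of a position in the `l`-th column, when the vertices of the initial chain have
the degrees `ψ`. -/
def posDeg (U : TwoOrd) (p : ℕ → ℕ → ℤ) (ψ : Fin (J + 1) → ℤ) (l : ℕ)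
    (t : (ℕ → ℕ) × Fin (J + 1)) : ℤ :=
  ψ t.2 + ∑ c ∈ Finset.range l, ∑ i ∈ Finset.range (t.1 (U.a + c)), p (U.a + c) i

variable (e) in
/-- The exponent of the sign that compares the evaluation with the horizontal composite. -/
noncomputable def evalExp (p : ℕ → ℕ → ℤ) (ψ : Fin (J + 1) → ℤ) (l : ℕ)
    (t t' : (ℕ → ℕ) × Fin (J + 1)) : ℤ :=
  ∑ c ∈ Finset.range l, ∑ i ∈ Finset.Ico (t.1 (U.a + c)) (t'.1 (U.a + c)),
    p (U.a + c) i * (posDeg U p ψ c t' - posDeg U p ψ c (e.lastPos (U.a + c) i))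

/-- In each column the earlier pasting composite sits inside the first functor, next to the new
vertical composite; together they form the next `hor`. The functors applied to the chain combine to
the source path. -/
theorem eval_naive {p : ℕ → ℕ → ℤ}
    {h : ∀ c r, ShomAmb 0 (D.F c r) (D.F c (r + 1))} (hn : NaiveInput U D p h)
    (u : ∀ i : Fin J, (D.cat U.a).Hom (X i.castSucc) (X i.succ)) (ψ : Fin (J + 1) → ℤ)
    (hu : ∀ i, u i ∈ (D.cat U.a).deg (X i.castSucc) (X i.succ) (ψ i.succ - ψ i.castSucc))
    (hl : l ≤ U.n) {S S' : Mark U I → Prop}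
    {t t' : (ℕ → ℕ) × Fin (J + 1)} (ht : e.Cut l S t) (ht' : e.Cut l S' t')
    (h1 : PosLE S S' t t') :
    eval e D (fun c r => naiveIncl (I c r) (D.F c r) (D.F c (r + 1)) (p c r) (h c r)) X u l t t' =
      Int.negOnePow (e.evalExp p ψ l t t') •
        (D.cat (U.a + l)).comp (D.hor h U.a t.1 t'.1 l (X t'.2))
          ((D.path t.1 U.a l).map ((D.cat U.a).chainComp X u t.2 t'.2)) := by
  induction l with
  | zero =>
    simp only [evalExp, Finset.range_zero, Finset.sum_empty, Int.negOnePow_zero, one_smul]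
    exact ((D.cat U.a).one_comp _).symm
  | succ l ih =>
    have ih := ih (by omega) ht.init ht'.init
    have hm := eval_mult (e := e) (X := X)
      (fun c r => naiveIncl (I c r) (D.F c r) (D.F c (r + 1)) (p c r) (h c r))
      (show l ≤ U.n by omega) u
    have hp := eval_mem e D
      (fun c r => naiveIncl (I c r) (D.F c r) (D.F c (r + 1)) (p c r) (h c r)) X p
      (fun c r hc => naiveIncl_mem _ (hn c r hc)) u ψ hu l
    have hs := hm.evalStep_naive hn (φ := posDeg U p ψ l) hp ht.init ht'.init h1
      (ht.mono ht' hl h1.1).top (ht.between ht' hl)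
    have hE : e.evalExp p ψ (l + 1) t t' = (∑ i ∈ Finset.Ico (t.1 (U.a + l)) (t'.1 (U.a + l)),
        p (U.a + l) i * (posDeg U p ψ l t' - posDeg U p ψ l (e.lastPos (U.a + l) i))) +
        e.evalExp p ψ l t t' := (Finset.sum_range_succ _ _).trans (add_comm _ _)
    rw [ih, DGCat.map_units_smul, DGCat.comp_smul', smul_smul, ← Int.negOnePow_add,
      DGFunctor.map_comp, ← DGCat.assoc, ← hE] at hs
    exact hs

end Eval

end SeqOp

end

/-! ### The composite `naiveOp`, and independence of the sign from the order of the marks -/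

section

variable {k : Type u} [CommRing k]

open Diagram

open Classical in
/-- The exponent of the Koszul sign that reverses the lexicographic order of the 2-cells. -/
noncomputable def TwoOrd.pairExp (U : TwoOrd) (p : ℕ → ℕ → ℤ) : ℤ :=
  ∑ f ∈ U.cells, ∑ g ∈ U.cells, if CellLT f g then p f.1 f.2 * p g.1 g.2 else 0

theorem TwoOrd.pathLE (U : TwoOrd) : PathLE U.a U.n U.lo U.hi := U.lo_le_hi

theorem NaiveInput.naiveOn {U : TwoOrd} {D : Diagram.{u, v, w} k} {p : ℕ → ℕ → ℤ}
    {h : ∀ c r, ShomAmb 0 (D.F c r) (D.F c (r + 1))} (hn : NaiveInput U D p h) :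
    D.NaiveOn p h U.a U.n U.lo U.hi := fun c r h1 h2 h3 h4 => hn c r ⟨h1, h2, h3, h4⟩

theorem TwoOrd.total_eq (U : TwoOrd) (p : ℕ → ℕ → ℤ) :
    U.total p = cellSum U.a U.lo U.hi U.n p := sum_cells U _

/-- The composite of naive natural transformations over a 2-ordinal. -/
noncomputable def naiveOp (U : TwoOrd) (D : Diagram.{u, v, w} k) (p : ℕ → ℕ → ℤ)
    (h : ∀ c r, ShomAmb 0 (D.F c r) (D.F c (r + 1))) : ShomAmb 0 (D.src U) (D.tgt U) :=
  Int.negOnePow (U.pairExp p) • ofCmpt (D.hor h U.a U.lo U.hi U.n)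

theorem cmpt_naiveOp (U : TwoOrd) (D : Diagram.{u, v, w} k) (p : ℕ → ℕ → ℤ)
    (h : ∀ c r, ShomAmb 0 (D.F c r) (D.F c (r + 1))) (x : (D.cat U.a).Obj) :
    cmpt (naiveOp U D p h) x = Int.negOnePow (U.pairExp p) • D.hor h U.a U.lo U.hi U.n x :=
  DGCat.map_units_smul (cmptLin x) _ _

theorem naiveOp_mem {U : TwoOrd} {D : Diagram.{u, v, w} k} {p : ℕ → ℕ → ℤ}
    {h : ∀ c r, ShomAmb 0 (D.F c r) (D.F c (r + 1))} (hn : NaiveInput U D p h) :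
    naiveOp U D p h ∈ naive (D.src U) (D.tgt U) (U.total p) := by
  rw [naiveOp, Units.smul_def]
  refine zsmul_mem (mem_naive.2 ?_) _
  rw [U.total_eq]
  exact hor_naive U.pathLE hn.naiveOn

theorem DGCat.chainComp_smul (A : DGCat.{u, v, w} k) {n : ℕ} (X : Fin (n + 1) → A.Obj)
    (u : ∀ i : Fin n, A.Hom (X i.castSucc) (X i.succ)) (s : Fin n → ℤ) (b : Fin (n + 1)) :
    A.chainComp X (fun i => Int.negOnePow (s i) • u i) 0 b =
      Int.negOnePow (partialSum s b) • A.chainComp X u 0 b := by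
  induction b using Fin.induction with
  | zero => rw [chainComp_self, chainComp_self, partialSum_zero]; simp
  | succ i ih =>
    rw [A.chainComp_succ _ _ (Fin.zero_le _), A.chainComp_succ _ _ (Fin.zero_le _), ih,
      A.comp_units_smul, A.comp_smul', smul_smul, ← Int.negOnePow_add, ← partialSum_succ s i,
      sub_add_cancel]

theorem partialSum_last_sub {n : ℕ} (e : Fin n → ℤ) (j : Fin (n + 1)) :
    partialSum e (Fin.last n) - partialSum e j = ∑ i : Fin n, if j ≤ i.castSucc then e i else 0 := by
  simp only [partialSum, ← Finset.sum_sub_distrib]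
  refine Finset.sum_congr rfl fun i _ => ?_
  by_cases h : j ≤ i.castSucc
  · simp [h, not_lt.2 h, Fin.castSucc_lt_last]
  · simp [h, not_le.1 h, Fin.castSucc_lt_last]

namespace SeqOp

variable {U : TwoOrd} {I : ℕ → ℕ → ℕ} {J : ℕ} (e : SeqOp U I J)

/-- All marks of the 2-cell `f` precede the last mark of the 2-cell `g`. -/
def Precedes (f g : ℕ × ℕ) (hg : U.Cell g.1 g.2) : Prop :=
  ∀ x : Mark U I, x.c = f.1 → x.r = f.2 → e.le x (mark I hg (Fin.last _))

theorem le_last {c r : ℕ} (hc : U.Cell c r) (y : Mark U I) (h1 : y.c = c) (h2 : y.r = r) :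
    e.le y (mark I hc (Fin.last _)) := by
  subst h1 h2
  exact e.le_of_le _ _ rfl rfl y.le

/-- Among the marks of `g`, the last one is the best witness. -/
theorem exists_iff_precedes (f g : ℕ × ℕ) (hg : U.Cell g.1 g.2) :
    (∃ y : Mark U I, (y.c = g.1 ∧ y.r = g.2) ∧
        ∀ x : Mark U I, x.c = f.1 → x.r = f.2 → e.le x y) ↔ e.Precedes f g hg :=
  ⟨fun ⟨y, hy, h⟩ x h1 h2 => e.trans _ _ _ (h x h1 h2) (e.le_last hg y hy.1 hy.2),
    fun h => ⟨mark I hg (Fin.last _), ⟨rfl, rfl⟩, h⟩⟩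

theorem forall_W_le_iff {f : ℕ × ℕ} (hf : U.Cell f.1 f.2) (j : Fin J) :
    (∀ y : Mark U I, y.c = f.1 → y.r = f.2 → e.W y ≤ j.castSucc) ↔
      (e.lastPos f.1 f.2).2 ≤ j.castSucc := by
  rw [lastPos_of_cell hf]
  exact ⟨fun h => h _ rfl rfl, fun h y h1 h2 => (e.mono _ _ (e.le_last hf y h1 h2)).trans h⟩

-- Identifies the degree that the component at `(c, i)` crosses besides the initial chain: its last
-- mark and the end of the chain differ, in the earlier columns, by the cells not yet passed at that
-- mark.
open Classical in
theorem sum_marks_after (p : ℕ → ℕ → ℤ) {c i : ℕ} (hc : c < U.n) (hg : U.Cell (U.a + c) i) :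
    (∑ c' ∈ Finset.range c, ∑ j ∈ Finset.range (U.hi (U.a + c')), p (U.a + c') j) -
      ∑ c' ∈ Finset.range c,
        ∑ j ∈ Finset.range ((e.lastPos (U.a + c) i).1 (U.a + c')), p (U.a + c') j =
    ∑ f ∈ U.cells, if CellLT f (U.a + c, i) ∧ ¬ e.Precedes f (U.a + c, i) hg then p f.1 f.2
      else 0 := by
  rw [sum_cells, cellSum, ← Finset.sum_sub_distrib]
  have hsub : Finset.range c ⊆ Finset.range U.n := Finset.range_subset_range.2 hc.le
  rw [← Finset.sum_subset hsub]
  · refine Finset.sum_congr rfl fun c' hc' => ?_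
    rw [Finset.mem_range] at hc'
    have cut := cut_mark (e := e) (mark I hg (Fin.last _)) (l := c) le_rfl
    obtain ⟨b1, b2⟩ := cut.bound (U.a + c') (by omega) (by omega)
    rw [lastPos_of_cell hg, ← Finset.sum_Ico_eq_sub _ b2, ← Finset.sum_filter]
    refine Finset.sum_congr ?_ fun _ _ => rfl
    ext j
    rw [Finset.mem_Ico, Finset.mem_filter, Finset.mem_Ico]
    have key : ∀ h1 : U.Cell (U.a + c') j, e.Precedes (U.a + c', j) (U.a + c, i) hg ↔
        j < (e.pos (mark I hg (Fin.last _))).1 (U.a + c') := by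
      intro h1
      refine ⟨fun h => (before_iff_lt_passed (mark I hg (Fin.last _)) (mark I h1 0)
        (by simp only [mark]; omega)).1 ⟨h _ rfl rfl, fun q => ?_⟩, fun h x h2 h3 => ?_⟩
      · have := congrArg Mark.c q
        simp only [mark] at this
        omega
      · dsimp only at h2 h3
        refine ((before_iff_lt_passed (mark I hg (Fin.last _)) x
          (by simp only [mark]; omega)).2 ?_).1
        rw [h2, h3]
        exact h
    constructor
    · rintro ⟨h1, h2⟩
      refine ⟨⟨b1.trans h1, h2⟩, .inl (by dsimp only; omega), ?_⟩
      rw [key ⟨by omega, by omega, b1.trans h1, h2⟩]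
      omega
    · rintro ⟨⟨h1, h2⟩, -, h4⟩
      rw [key ⟨by omega, by omega, h1, h2⟩] at h4
      omega
  -- The remaining columns contribute nothing: in the column `c` itself smaller cells precede by
  -- axiom (3), and the cells of later columns are not smaller.
  · intro c' _ hc'
    rw [Finset.mem_range, not_lt] at hc'
    refine Finset.sum_eq_zero fun j hj => if_neg ?_
    rintro ⟨h1 | ⟨h1, h2⟩, h3⟩
    · dsimp only at h1; omega
    · dsimp only at h1 h2
      refine h3 fun x x1 x2 => e.le_of_lt _ _ ?_ ?_
      · dsimp only at x1; simp only [mark]; omega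
      · dsimp only at x2; simp only [mark]; omega

/-- For `f < g`, the product of the degrees occurs in `signExp` if `f` precedes the last mark of
`g`, and in `evalExp` otherwise, hence exactly once. The products with degrees of the chain occur
once in `evalExp` and once through `cross`, so they disappear modulo `2`. -/
theorem evalExp_eq (p : ℕ → ℕ → ℤ) (n : Fin J → ℤ) :
    e.evalExp p (partialSum n) U.n (U.lo, 0) (U.hi, Fin.last J) + e.signExp p +
      ∑ i, e.cross p i * n i = U.pairExp p + 2 * ∑ i, e.cross p i * n i := by
  classical
  have h1 : ∑ i, e.cross p i * n i = ∑ g ∈ U.cells, p g.1 g.2 *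
      ∑ i : Fin J, if (e.lastPos g.1 g.2).2 ≤ i.castSucc then n i else 0 := by
    simp only [cross, Finset.sum_mul, Finset.mul_sum]
    rw [Finset.sum_comm]
    refine Finset.sum_congr rfl fun g hg => Finset.sum_congr rfl fun i _ => ?_
    rw [U.mem_cells] at hg
    by_cases q : (e.lastPos g.1 g.2).2 ≤ i.castSucc
    · rw [if_pos q, if_pos ((e.forall_W_le_iff hg i).2 q)]
    · rw [if_neg q, if_neg (fun q' => q ((e.forall_W_le_iff hg i).1 q'))]
      simp
  have h2 : e.evalExp p (partialSum n) U.n (U.lo, 0) (U.hi, Fin.last J) =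
      ∑ i, e.cross p i * n i + ∑ g ∈ U.cells, ∑ f ∈ U.cells,
        if CellLT f g ∧ ¬ ∃ y : Mark U I, (y.c = g.1 ∧ y.r = g.2) ∧
          ∀ x : Mark U I, x.c = f.1 → x.r = f.2 → e.le x y then p f.1 f.2 * p g.1 g.2 else 0 := by
    rw [h1, ← Finset.sum_add_distrib, sum_cells, cellSum, evalExp]
    refine Finset.sum_congr rfl fun c hc => Finset.sum_congr rfl fun i hi => ?_
    rw [Finset.mem_range] at hc
    rw [Finset.mem_Ico] at hi
    have hg : U.Cell (U.a + c) i := ⟨by omega, by omega, hi.1, hi.2⟩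
    have e1 := e.sum_marks_after p hc hg
    have e2 := partialSum_last_sub n (e.lastPos (U.a + c) i).2
    simp only [posDeg]
    rw [add_sub_add_comm, e1, e2, mul_add, Finset.mul_sum _ _ (p (U.a + c) i)]
    congr 1
    rw [Finset.mul_sum]
    refine Finset.sum_congr rfl fun f _ => ?_
    rw [e.exists_iff_precedes f (U.a + c, i) hg]
    split_ifs
    · ring
    · ring
  have h3 : U.pairExp p = (∑ g ∈ U.cells, ∑ f ∈ U.cells,
        if CellLT f g ∧ ¬ ∃ y : Mark U I, (y.c = g.1 ∧ y.r = g.2) ∧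
          ∀ x : Mark U I, x.c = f.1 → x.r = f.2 → e.le x y then p f.1 f.2 * p g.1 g.2 else 0) +
      e.signExp p := by
    rw [Finset.sum_comm, TwoOrd.pairExp, signExp, ← Finset.sum_add_distrib]
    refine Finset.sum_congr rfl fun f _ => ?_
    rw [← Finset.sum_add_distrib]
    refine Finset.sum_congr rfl fun g _ => ?_
    by_cases q : CellLT f g <;>
    by_cases q' : ∃ y : Mark U I, (y.c = g.1 ∧ y.r = g.2) ∧
          ∀ x : Mark U I, x.c = f.1 → x.r = f.2 → e.le x y <;>
    simp only [q, q', and_true, and_false, not_true_eq_false, not_false_eq_true, if_true,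
      if_false, add_zero, zero_add]
  rw [h2, h3]
  ring

/-- On naive natural transformations the action is given by their composites. -/
theorem act_naiveIncl (D : Diagram.{u, v, w} k) (p : ℕ → ℕ → ℤ)
    (h : ∀ c r, ShomAmb 0 (D.F c r) (D.F c (r + 1))) (hn : NaiveInput U D p h) :
    e.act D p (fun c r => naiveIncl (I c r) (D.F c r) (D.F c (r + 1)) (p c r) (h c r)) =
      naiveIncl J (D.src U) (D.tgt U) (U.total p) (naiveOp U D p h) := by
  funext X
  refine MultilinearMap.ext_homogeneous (D.cat U.a)
    fun u n hu => ?_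
  have hk : (fun j => (D.cat U.a).kos (e.cross p j) (u j)) =
      fun j => Int.negOnePow (e.cross p j * n j) • u j :=
    funext fun j => (D.cat U.a).kos_of_mem _ (hu j)
  have hE := eval_naive (e := e) hn (fun j => (D.cat U.a).kos (e.cross p j) (u j)) (partialSum n)
    (fun i => by rw [partialSum_succ]; exact (D.cat U.a).kos_mem _ (hu i)) le_rfl
    (cut_src le_rfl) (cut_tgt le_rfl) ⟨fun _ q => q.elim, Fin.zero_le _⟩
  have hA : e.act D p (fun c r => naiveIncl (I c r) (D.F c r) (D.F c (r + 1)) (p c r) (h c r)) X u =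
      Int.negOnePow (e.signExp p) • eval e D
        (fun c r => naiveIncl (I c r) (D.F c r) (D.F c (r + 1)) (p c r) (h c r)) X
        (fun j => (D.cat U.a).kos (e.cross p j) (u j)) U.n (U.lo, 0) (U.hi, Fin.last J) := by
    rw [Units.smul_def]; rfl
  -- Naturality of the composite moves its component on the right-hand side to the last vertex of
  -- the chain, where the evaluation has put it.
  rw [hA, hE, naiveIncl_apply, ← (mem_naive.1 (naiveOp_mem hn)).2, cmpt_naiveOp,
    DGCat.comp_units_smul, hk]
  have hc := (D.cat U.a).chainComp_smul X u (fun j => e.cross p j * n j) (Fin.last J)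
  rw [partialSum_last] at hc
  rw [hc, DGCat.map_units_smul, DGCat.comp_smul', smul_smul, smul_smul, ← Int.negOnePow_add,
    ← Int.negOnePow_add]
  refine congrArg (fun s : ℤˣ => s • _) ?_
  rw [Int.negOnePow_eq_iff]
  have := e.evalExp_eq p n
  exact ⟨∑ i, e.cross p i * n i, by linarith⟩

theorem evalStep_congr {D : Diagram.{u, v, w} k} {X : Fin (J + 1) → (D.cat U.a).Obj}
    {h h' : ∀ c r, ShomAmb (I c r) (D.F c r) (D.F c (r + 1))}
    (hh : ∀ c r, U.Cell c r → h c r = h' c r) (l : ℕ)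
    (prev : ∀ t t', (D.cat (U.a + l)).Hom (ob U D X l t) (ob U D X l t')) (r : ℕ)
    (t : (ℕ → ℕ) × Fin (J + 1)) (s : ℕ) (t' : (ℕ → ℕ) × Fin (J + 1)) :
    evalStep e D h X l prev r t s t' = evalStep e D h' X l prev r t s t' := by
  induction s generalizing t' with
  | zero => rfl
  | succ s ih =>
    by_cases hc : U.Cell (U.a + l) s
    · simp only [evalStep, hc, dite_true, hh _ _ hc, ih]
    · simp only [evalStep, hc, dite_false]

theorem act_congr (D : Diagram.{u, v, w} k) (p : ℕ → ℕ → ℤ)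
    {h h' : ∀ c r, ShomAmb (I c r) (D.F c r) (D.F c (r + 1))}
    (hh : ∀ c r, U.Cell c r → h c r = h' c r) : e.act D p h = e.act D p h' := by
  have key : ∀ (X : Fin (J + 1) → (D.cat U.a).Obj) u l, eval e D h X u l = eval e D h' X u l := by
    intro X u l
    induction l with
    | zero => rfl
    | succ l ih =>
      funext t t'
      simp only [eval, ih]
      exact evalStep_congr e hh l _ _ _ _ _
  funext X
  refine MultilinearMap.ext fun u => ?_
  exact congrArg (fun m => ((Int.negOnePow (e.signExp p) : ℤˣ) : ℤ) • m)
    (congrFun (congrFun (key X _ U.n) _) _)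

/-- `hom^•` is closed under the action of `seq`. -/
theorem act_mem_constNaive (D : Diagram.{u, v, w} k) (p : ℕ → ℕ → ℤ)
    (h : ∀ c r, ShomAmb (I c r) (D.F c r) (D.F c (r + 1)))
    (hh : ∀ c r, U.Cell c r → h c r ∈ constNaive (I c r) (D.F c r) (D.F c (r + 1)) (p c r)) :
    e.act D p h ∈ constNaive J (D.src U) (D.tgt U) (U.total p) := by
  classical
  have : ∀ c r, ∃ g : ShomAmb 0 (D.F c r) (D.F c (r + 1)), U.Cell c r →
      g ∈ naive (D.F c r) (D.F c (r + 1)) (p c r) ∧ naiveIncl (I c r) _ _ (p c r) g = h c r := by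
    intro c r
    by_cases hc : U.Cell c r
    · obtain ⟨g, hg⟩ := Submodule.mem_map.1 (hh c r hc)
      exact ⟨g, fun _ => hg⟩
    · exact ⟨0, fun q => absurd q hc⟩
  choose g hg using this
  have hn : NaiveInput U D p g := fun c r hc => (hg c r hc).1
  rw [e.act_congr D p (fun c r hc => (hg c r hc).2.symm), e.act_naiveIncl D p g hn]
  exact Submodule.mem_map_of_mem (naiveOp_mem hn)

end SeqOp

end

/-! ### Cells and Koszul exponents under a map of 2-ordinals -/

section

open Diagram

namespace TwoOrdMap

variable {U V : TwoOrd} (P : TwoOrdMap U V)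

open Classical in
/-- The 2-cell of `V` whose inverse image contains a given 2-cell of `U`. -/
noncomputable def cellMap (f : ℕ × ℕ) : ℕ × ℕ :=
  if h : U.Cell f.1 f.2 then (P.exists_pre h).choose else 0

theorem cellMap_cell {f : ℕ × ℕ} (h : U.Cell f.1 f.2) : V.Cell (P.cellMap f).1 (P.cellMap f).2 := by
  simp only [cellMap, h, dite_true]
  exact (P.exists_pre h).choose_spec.choose

theorem pre_cellMap {f : ℕ × ℕ} (h : U.Cell f.1 f.2) :
    (P.pre _ _ (P.cellMap_cell h)).Cell f.1 f.2 := by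
  have := (P.exists_pre h).choose_spec.choose_spec
  exact P.pre_congr (by simp only [cellMap, h, dite_true]) (P.cellMap_cell h) this

theorem cellMap_eq {f f' : ℕ × ℕ} (hf : V.Cell f'.1 f'.2)
    (hc : (P.pre f'.1 f'.2 hf).Cell f.1 f.2) : P.cellMap f = f' := by
  obtain ⟨h1, h2⟩ := P.pre_unique (P.pre_cellMap (P.cell_of_pre hf hc)) hc
  exact Prod.ext h1 h2

theorem cells_pre {f' : ℕ × ℕ} (hf : V.Cell f'.1 f'.2) :
    (P.pre f'.1 f'.2 hf).cells = U.cells.filter (fun f => P.cellMap f = f') := by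
  ext f
  rw [Finset.mem_filter, TwoOrd.mem_cells, TwoOrd.mem_cells]
  refine ⟨fun h => ⟨P.cell_of_pre hf h, P.cellMap_eq hf h⟩, ?_⟩
  rintro ⟨h1, rfl⟩
  exact P.pre_cellMap h1

/-- The cells between the least arrow and the arrow `s` of a column of `V`. -/
def below (d s : ℕ) (h : V.Cell d s) : TwoOrd where
  a := P.obj d
  n := P.len d
  lo := P.arr d (V.lo d)
  hi := P.arr d s
  lo_le_hi := P.arr_mono d h.1 h.2.1 (V.lo d) s le_rfl h.2.2.1 h.2.2.2.le

/-- The strip of `U` over a column of `V` is sliced by the monotone family of paths `arr d`, so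
lying under the path of `s` is the same as lying in a slice below `s`. -/
theorem cells_below {d s : ℕ} (h : V.Cell d s) : (P.below d s h).cells =
    U.cells.filter (fun f => (P.cellMap f).1 = d ∧ (P.cellMap f).2 < s) := by
  ext f
  rw [Finset.mem_filter, TwoOrd.mem_cells, TwoOrd.mem_cells]
  obtain ⟨h1, h2, h3, h4⟩ := h
  constructor
  · rintro ⟨c1, c2, c3, c4⟩
    have c1 : P.obj d ≤ f.1 := c1
    have c2 : f.1 < P.obj (d + 1) := c2
    have c3 : P.arr d (V.lo d) f.1 ≤ f.2 := c3
    have c4 : f.2 < P.arr d s f.1 := c4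
    have m1 : P.obj V.a ≤ P.obj d := P.obj_mono h1
    have m2 : P.obj (d + 1) ≤ P.obj (V.a + V.n) := P.obj_mono h2
    have e1 : P.obj V.a = U.a := P.first
    have e2 : P.obj (V.a + V.n) = U.a + U.n := P.last
    have l1 := P.arr_lo d h1 h2 f.1 c1 c2
    have l2 := P.arr_hi d h1 h2 f.1 c1 c2
    have l3 := P.arr_mono d h1 h2 s (V.hi d) h3 h4.le le_rfl f.1 c1 c2
    have hf : U.Cell f.1 f.2 := ⟨by omega, by omega, by omega, by omega⟩
    refine ⟨hf, ?_⟩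
    obtain ⟨q1, q2, q3, q4⟩ := P.pre_cellMap hf
    have q1 : P.obj (P.cellMap f).1 ≤ f.1 := q1
    have q2 : f.1 < P.obj ((P.cellMap f).1 + 1) := q2
    have q3 : P.arr (P.cellMap f).1 (P.cellMap f).2 f.1 ≤ f.2 := q3
    have hd : (P.cellMap f).1 = d := by
      rcases lt_trichotomy (P.cellMap f).1 d with hl | hl | hl
      · have := P.obj_mono (show (P.cellMap f).1 + 1 ≤ d from hl); omega
      · exact hl
      · have := P.obj_mono (show d + 1 ≤ (P.cellMap f).1 from hl); omega
    refine ⟨hd, ?_⟩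
    by_contra hs
    have b := (P.cellMap_cell hf).2.2.2
    rw [hd] at q3 b
    have := P.arr_mono d h1 h2 s (P.cellMap f).2 h3 (not_lt.1 hs) b.le f.1 c1 c2
    omega
  · rintro ⟨hf, hd, hs⟩
    obtain ⟨q1, q2, q3, q4⟩ := P.pre_cellMap hf
    have q1 : P.obj (P.cellMap f).1 ≤ f.1 := q1
    have q2 : f.1 < P.obj ((P.cellMap f).1 + 1) := q2
    have q4 : f.2 < P.arr (P.cellMap f).1 ((P.cellMap f).2 + 1) f.1 := q4
    have b := (P.cellMap_cell hf).2.2.1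
    rw [hd] at q1 q2 q4 b
    have l3 := P.arr_mono d h1 h2 ((P.cellMap f).2 + 1) s (by omega) hs h4.le f.1 q1 q2
    refine ⟨q1, q2, ?_, q4.trans_le l3⟩
    change P.arr d (V.lo d) f.1 ≤ f.2
    rw [P.arr_lo d h1 h2 f.1 q1 q2]
    exact hf.2.2.1

theorem sum_cellMap {M : Type*} [AddCommMonoid M] (φ : ℕ × ℕ → M) :
    ∑ f ∈ U.cells, φ f = ∑ f' ∈ V.cells, ∑ f ∈ U.cells with P.cellMap f = f', φ f := by
  refine (Finset.sum_fiberwise_of_maps_to (fun f hf => ?_) φ).symm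
  rw [TwoOrd.mem_cells] at hf ⊢
  exact P.cellMap_cell hf

theorem pushDeg_eq (p : ℕ → ℕ → ℤ) {f' : ℕ × ℕ} (hf : V.Cell f'.1 f'.2) :
    P.pushDeg p f'.1 f'.2 = ∑ f ∈ U.cells with P.cellMap f = f', p f.1 f.2 := by
  rw [pushDeg, dif_pos hf, TwoOrd.total, cells_pre]

/-- The cells above a given cell of the same column do not lie over a smaller cell. -/
theorem lt_of_cellLT {f g : ℕ × ℕ} (hf : U.Cell f.1 f.2) (hg : U.Cell g.1 g.2) (h : CellLT f g)
    (h' : CellLT (P.cellMap g) (P.cellMap f)) :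
    f.1 < g.1 ∧ (P.cellMap g).1 = (P.cellMap f).1 ∧ (P.cellMap g).2 < (P.cellMap f).2 := by
  obtain ⟨f1, f2, f3, f4⟩ := P.pre_cellMap hf
  obtain ⟨g1, g2, g3, g4⟩ := P.pre_cellMap hg
  have f1 : P.obj (P.cellMap f).1 ≤ f.1 := f1
  have g2 : g.1 < P.obj ((P.cellMap g).1 + 1) := g2
  have f3 : P.arr (P.cellMap f).1 (P.cellMap f).2 f.1 ≤ f.2 := f3
  have g4 : g.2 < P.arr (P.cellMap g).1 ((P.cellMap g).2 + 1) g.1 := g4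
  have hle : f.1 ≤ g.1 := by rcases h with h | h <;> omega
  rcases h' with h' | ⟨h1, h2⟩
  · have := P.obj_mono (show (P.cellMap g).1 + 1 ≤ (P.cellMap f).1 from h'); omega
  · refine ⟨?_, h1, h2⟩
    rcases h with h | ⟨h3, h4⟩
    · exact h
    · rw [h1] at g2 g4
      obtain ⟨b1, b2, b3, b4⟩ := P.cellMap_cell hf
      obtain ⟨_, _, c3, c4⟩ := P.cellMap_cell hg
      rw [h1] at c3 c4
      have := P.arr_mono _ b1 b2 ((P.cellMap g).2 + 1) (P.cellMap f).2 (by omega) h2 (by omega)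
        g.1 (h3 ▸ f1) g2
      rw [h3] at f3
      omega

end TwoOrdMap

theorem CellLT.trichotomy (f g : ℕ × ℕ) : CellLT f g ∨ f = g ∨ CellLT g f := by
  simp only [CellLT, Prod.ext_iff]; omega

theorem CellLT.asymm {f g : ℕ × ℕ} (h : CellLT f g) : ¬ CellLT g f := by
  simp only [CellLT] at *; omega

theorem CellLT.irrefl (f : ℕ × ℕ) : ¬ CellLT f f := by simp [CellLT]

namespace Diagram

/-- As a sum over pairs of cells the exponent becomes comparable with `pairExp` and `shuffleExp`: a
pair counts when the upper cell lies in an earlier column than the lower one. -/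
theorem interchange_eq (p : ℕ → ℕ → ℤ) (a : ℕ) (q q' q'' : ℕ → ℕ) (l : ℕ) :
    interchange p a q q' q'' l = cellSum a q q' l fun c i => cellSum a q' q'' l fun c' j =>
      if c' < c then p c' j * p c i else 0 := by
  rw [interchange, cellSum]
  refine Finset.sum_congr rfl fun c hc => ?_
  rw [Finset.sum_mul]
  refine Finset.sum_congr rfl fun i _ => ?_
  rw [Finset.mem_range] at hc
  rw [cellSum, cellSum, ← Finset.sum_subset (Finset.range_subset_range.2 hc.le), Finset.mul_sum]
  · refine Finset.sum_congr rfl fun c' hc' => ?_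
    rw [Finset.mem_range] at hc'
    rw [Finset.mul_sum]
    refine Finset.sum_congr rfl fun j _ => ?_
    rw [if_pos (by omega), mul_comm]
  · intro c' _ hc'
    rw [Finset.mem_range] at hc'
    exact Finset.sum_eq_zero fun j _ => if_neg (by omega)

end Diagram

namespace TwoOrdMap

variable {U V : TwoOrd} (P : TwoOrdMap U V)

open Classical in
/-- The Koszul signs of composites over a map of 2-ordinals. -/
theorem pairExp_push (p : ℕ → ℕ → ℤ) :
    V.pairExp (P.pushDeg p) + ∑ f ∈ V.cells, ((if hf : V.Cell f.1 f.2 then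
      (P.pre f.1 f.2 hf).pairExp p else 0) + interchange p (P.obj f.1) (P.arr f.1 (V.lo f.1))
        (P.arr f.1 f.2) (P.arr f.1 (f.2 + 1)) (P.len f.1)) = U.pairExp p + P.shuffleExp p := by
  have h1 : V.pairExp (P.pushDeg p) = ∑ f ∈ U.cells, ∑ g ∈ U.cells,
      if CellLT (P.cellMap f) (P.cellMap g) then p f.1 f.2 * p g.1 g.2 else 0 := by
    rw [P.sum_cellMap, TwoOrd.pairExp]
    refine Finset.sum_congr rfl fun f' hf => ?_
    rw [TwoOrd.mem_cells] at hf
    rw [Finset.sum_congr rfl fun f _ => P.sum_cellMap _, Finset.sum_comm]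
    refine Finset.sum_congr rfl fun g' hg => ?_
    rw [TwoOrd.mem_cells] at hg
    rw [P.pushDeg_eq p hf, P.pushDeg_eq p hg, Finset.sum_mul_sum]
    by_cases q : CellLT f' g'
    · rw [if_pos q]
      refine Finset.sum_congr rfl fun f hf' => Finset.sum_congr rfl fun g hg' => ?_
      rw [(Finset.mem_filter.1 hf').2, (Finset.mem_filter.1 hg').2, if_pos q]
    · rw [if_neg q]
      refine (Finset.sum_eq_zero fun f hf' => Finset.sum_eq_zero fun g hg' => ?_).symm
      rw [(Finset.mem_filter.1 hf').2, (Finset.mem_filter.1 hg').2, if_neg q]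
  have h2 : (∑ f ∈ V.cells, if hf : V.Cell f.1 f.2 then (P.pre f.1 f.2 hf).pairExp p else 0) =
      ∑ f ∈ U.cells, ∑ g ∈ U.cells, if P.cellMap f = P.cellMap g ∧ CellLT f g then
        p f.1 f.2 * p g.1 g.2 else 0 := by
    rw [P.sum_cellMap]
    refine Finset.sum_congr rfl fun f' hf => ?_
    rw [TwoOrd.mem_cells] at hf
    rw [dif_pos hf, TwoOrd.pairExp, P.cells_pre]
    refine Finset.sum_congr rfl fun f hf' => ?_
    rw [Finset.sum_filter]
    refine Finset.sum_congr rfl fun g _ => ?_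
    rw [(Finset.mem_filter.1 hf').2, ite_and]
    simp only [eq_comm]
  have h3 : P.shuffleExp p = ∑ f ∈ U.cells, ∑ g ∈ U.cells,
      if CellLT f g ∧ CellLT (P.cellMap g) (P.cellMap f) then p f.1 f.2 * p g.1 g.2 else 0 := by
    refine Finset.sum_congr rfl fun f hf => Finset.sum_congr rfl fun g hg => ?_
    rw [TwoOrd.mem_cells] at hf hg
    refine if_congr (and_congr_right fun _ => ⟨?_, fun h => ?_⟩) rfl rfl
    · rintro ⟨f', g', hf', hg', a1, a2, a3⟩
      rwa [P.cellMap_eq hf' a1, P.cellMap_eq hg' a2]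
    · exact ⟨_, _, P.cellMap_cell hf, P.cellMap_cell hg, P.pre_cellMap hf, P.pre_cellMap hg, h⟩
  -- By `lt_of_cellLT`, two cells whose order is reversed by `P` lie over the same column of `V`,
  -- the smaller one in the higher slice and in an earlier column of `U`: these are the pairs
  -- counted by the interchange signs.
  have h4 : (∑ f ∈ V.cells, interchange p (P.obj f.1) (P.arr f.1 (V.lo f.1))
        (P.arr f.1 f.2) (P.arr f.1 (f.2 + 1)) (P.len f.1)) = P.shuffleExp p := by
    rw [h3, P.sum_cellMap]
    refine Finset.sum_congr rfl fun f' hf => ?_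
    rw [TwoOrd.mem_cells] at hf
    have e1 : interchange p (P.obj f'.1) (P.arr f'.1 (V.lo f'.1)) (P.arr f'.1 f'.2)
        (P.arr f'.1 (f'.2 + 1)) (P.len f'.1) = ∑ g ∈ (P.below f'.1 f'.2 hf).cells,
          ∑ f ∈ (P.pre f'.1 f'.2 hf).cells, if f.1 < g.1 then p f.1 f.2 * p g.1 g.2 else 0 := by
      rw [interchange_eq, sum_cells]
      refine cellSum_congr fun c i _ _ _ _ => ?_
      rw [sum_cells]
      rfl
    rw [e1, P.cells_pre, P.cells_below, Finset.sum_comm]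
    refine Finset.sum_congr rfl fun f hf' => ?_
    rw [Finset.sum_filter]
    obtain ⟨u1, u2⟩ := Finset.mem_filter.1 hf'
    rw [TwoOrd.mem_cells] at u1
    refine Finset.sum_congr rfl fun g hg => ?_
    rw [TwoOrd.mem_cells] at hg
    rw [← ite_and]
    refine if_congr ⟨?_, fun h => ?_⟩ rfl rfl
    · rintro ⟨⟨a1, a2⟩, a3⟩
      rw [← u2] at a1 a2
      exact ⟨.inl a3, .inr ⟨a1, a2⟩⟩
    · have := P.lt_of_cellLT u1 hg h.1 h.2
      rw [u2] at this
      exact ⟨this.2, this.1⟩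
  rw [Finset.sum_add_distrib, h4, h2, h1, ← add_assoc, add_left_inj]
  -- Pairs whose images are in increasing order while they themselves are not become, after
  -- swapping, the reversed pairs. These are thus counted here and in `h4`: once to complete
  -- `U.pairExp`, once to give `P.shuffleExp`.
  have h5 : (∑ f ∈ U.cells, ∑ g ∈ U.cells,
      if CellLT (P.cellMap f) (P.cellMap g) ∧ CellLT g f then p f.1 f.2 * p g.1 g.2 else 0) =
      ∑ f ∈ U.cells, ∑ g ∈ U.cells,
      if CellLT f g ∧ CellLT (P.cellMap g) (P.cellMap f) then p f.1 f.2 * p g.1 g.2 else 0 := by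
    rw [Finset.sum_comm]
    refine Finset.sum_congr rfl fun f _ => Finset.sum_congr rfl fun g _ => ?_
    exact if_congr and_comm (mul_comm _ _) rfl
  have h6 : (∑ f ∈ U.cells, ∑ g ∈ U.cells,
      if CellLT (P.cellMap f) (P.cellMap g) then p f.1 f.2 * p g.1 g.2 else 0) =
      (∑ f ∈ U.cells, ∑ g ∈ U.cells, if CellLT (P.cellMap f) (P.cellMap g) ∧ CellLT f g then
        p f.1 f.2 * p g.1 g.2 else 0) + ∑ f ∈ U.cells, ∑ g ∈ U.cells,
        if CellLT (P.cellMap f) (P.cellMap g) ∧ CellLT g f then p f.1 f.2 * p g.1 g.2 else 0 := by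
    simp only [← Finset.sum_add_distrib]
    refine Finset.sum_congr rfl fun f _ => Finset.sum_congr rfl fun g _ => ?_
    rcases CellLT.trichotomy f g with q | rfl | q
    · simp [q, q.asymm]
    · simp [CellLT.irrefl]
    · simp [q, q.asymm]
  rw [h6, h5, TwoOrd.pairExp]
  simp only [← Finset.sum_add_distrib]
  refine Finset.sum_congr rfl fun f _ => Finset.sum_congr rfl fun g _ => ?_
  rcases CellLT.trichotomy (P.cellMap f) (P.cellMap g) with q | q | q
  · have : P.cellMap f ≠ P.cellMap g := fun e => CellLT.irrefl _ (e ▸ q)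
    simp [q, q.asymm, this]
  · simp [q, CellLT.irrefl]
  · have : P.cellMap f ≠ P.cellMap g := fun e => CellLT.irrefl _ (e ▸ q)
    simp [q, q.asymm, this]

end TwoOrdMap

end

/-! ### Transformations bundled with their functors -/

section

variable {k : Type u} [CommRing k]

open Diagram

namespace Diagram

/-- A transformation between two dg functors from `D.cat a` to a member of the diagram `D`. -/
structure Transf (D : Diagram.{u, v, w} k) (a : ℕ) where
  b : ℕ
  F : DGFunctor (D.cat a) (D.cat b)
  G : DGFunctor (D.cat a) (D.cat b)
  app : ∀ x, (D.cat b).Hom (F.obj x) (G.obj x)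

namespace Transf

variable {D : Diagram.{u, v, w} k} {a : ℕ}

/-- The horizontal composite. -/
def hcomp (S : D.Transf a) (R : D.Transf S.b) : D.Transf a where
  b := R.b
  F := S.F.comp R.F
  G := S.G.comp R.G
  app x := (D.cat R.b).comp (R.app (S.G.obj x)) (R.F.map (S.app x))

/-- The multiple by a sign. -/
def sign (s : ℤˣ) (S : D.Transf a) : D.Transf a where
  b := S.b
  F := S.F
  G := S.G
  app x := s • S.app x

theorem hcomp_sign_left (s : ℤˣ) (S : D.Transf a) (R : D.Transf S.b) :
    (S.sign s).hcomp R = (S.hcomp R).sign s := by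
  refine congrArg (Transf.mk R.b (S.F.comp R.F) (S.G.comp R.G)) (funext fun x => ?_)
  exact (congrArg _ (DGCat.map_units_smul R.F.map s (S.app x))).trans
    ((D.cat R.b).comp_smul' _ _ _)

theorem hcomp_sign_right (s : ℤˣ) (S : D.Transf a) (R : D.Transf S.b) :
    S.hcomp (R.sign s) = (S.hcomp R).sign s := by
  refine congrArg (Transf.mk R.b (S.F.comp R.F) (S.G.comp R.G)) (funext fun x => ?_)
  exact (D.cat R.b).comp_units_smul _ _ _

theorem sign_sign (s t : ℤˣ) (S : D.Transf a) : (S.sign t).sign s = S.sign (s * t) :=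
  congrArg (Transf.mk S.b S.F S.G) (funext fun _ => smul_smul _ _ _)

/-- Composition of dg functors is associative by definition, so only the components have to be
compared. -/
theorem hcomp_assoc (S : D.Transf a) (R : D.Transf S.b) (T : D.Transf R.b) :
    (S.hcomp R).hcomp T = S.hcomp (R.hcomp T) := by
  refine congrArg (Transf.mk T.b (S.F.comp (R.F.comp T.F)) (S.G.comp (R.G.comp T.G)))
    (funext fun x => ?_)
  exact (congrArg _ (T.F.map_comp _ _)).trans (DGCat.assoc _ _ _ _).symm

/-- Turns an equality of bundled transformations into the heterogeneous equality demanded by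
`HomAlgebra.op_comp`. -/
theorem heq_ofCmpt {S S' : D.Transf a} (h : S = S') :
    HEq (ofCmpt (F := S.F) (G := S.G) S.app) (ofCmpt (F := S'.F) (G := S'.G) S'.app) := by
  subst h; rfl

end Transf

variable (D : Diagram.{u, v, w} k) (h : ∀ c r, ShomAmb 0 (D.F c r) (D.F c (r + 1)))

/-- The vertical composite of a column. -/
def vertTransf (c r s : ℕ) : D.Transf c := ⟨c + 1, D.F c r, D.F c s, D.vert h c r s⟩

/-- The horizontal composite of several columns. -/
def horTransf (q q' : ℕ → ℕ) (a l : ℕ) : D.Transf a :=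
  ⟨a + l, D.path q a l, D.path q' a l, D.hor h a q q' l⟩

theorem hcomp_horTransf_zero (q q' : ℕ → ℕ) {a : ℕ} (S : D.Transf a) :
    S.hcomp (D.horTransf h q q' S.b 0) = S :=
  congrArg (Transf.mk S.b S.F S.G) (funext fun x => (D.cat S.b).one_comp (S.app x))

/-- The targets `a + (l + l')` and `a + l + l'` are absorbed by the bundling: each further column is
attached at the object `S.b`, whichever form it has. -/
theorem horTransf_add (q q' : ℕ → ℕ) (a l l' : ℕ) : D.horTransf h q q' a (l + l') =
    (D.horTransf h q q' a l).hcomp (D.horTransf h q q' (a + l) l') := by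
  induction l' with
  | zero => exact (D.hcomp_horTransf_zero h q q' (D.horTransf h q q' a l)).symm
  | succ l' ih =>
    exact (congrArg (fun S : D.Transf a => S.hcomp (D.vertTransf h S.b (q S.b) (q' S.b))) ih).trans
      (Transf.hcomp_assoc (D.horTransf h q q' a l) (D.horTransf h q q' (a + l) l')
        (D.vertTransf h (a + l + l') (q (a + l + l')) (q' (a + l + l'))))

theorem horTransf_congr {q q' r r' : ℕ → ℕ} {a l : ℕ} (hq : ∀ c, a ≤ c → c < a + l → q c = r c)
    (hq' : ∀ c, a ≤ c → c < a + l → q' c = r' c) :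
    D.horTransf h q q' a l = D.horTransf h r r' a l := by
  induction l with
  | zero => rfl
  | succ l ih =>
    have e := ih (fun c h1 h2 => hq c h1 (by omega)) (fun c h1 h2 => hq' c h1 (by omega))
    have e2 : D.vertTransf h (a + l) (q (a + l)) (q' (a + l)) =
        D.vertTransf h (a + l) (r (a + l)) (r' (a + l)) := by
      rw [hq (a + l) (by omega) (by omega), hq' (a + l) (by omega) (by omega)]
    exact (congrArg (fun S : D.Transf a => S.hcomp (D.vertTransf h S.b (q S.b) (q' S.b))) e).trans
      (congrArg (fun R => (D.horTransf h r r' a l).hcomp R) e2)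

end Diagram

/-! ### Compatibility of `naiveOp` with maps of 2-ordinals -/

section Push

variable {U V : TwoOrd} (P : TwoOrdMap U V) {D : Diagram.{u, v, w} k} {p : ℕ → ℕ → ℤ}
  {h : ∀ c r, ShomAmb 0 (D.F c r) (D.F c (r + 1))}

theorem NaiveInput.pre (hn : NaiveInput U D p h) {d s : ℕ} (hc : V.Cell d s) :
    NaiveInput (P.pre d s hc) D p h := fun c r hcr => hn c r (P.cell_of_pre hc hcr)

open Classical in
/-- The exponent of the sign in the vertical composite of the composites over the inverse images
of the 2-cells of a column. -/
noncomputable def TwoOrdMap.colExp (p : ℕ → ℕ → ℤ) (d s : ℕ) : ℤ :=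
  ∑ i ∈ Finset.Ico (V.lo d) s, ((if hf : V.Cell d i then (P.pre d i hf).pairExp p else 0) +
    interchange p (P.obj d) (P.arr d (V.lo d)) (P.arr d i) (P.arr d (i + 1)) (P.len d))

variable (D p h) in
open Classical in
/-- The composites over the inverse images of the 2-cells. -/
noncomputable def pushInput :
    ∀ d s, ShomAmb 0 ((D.push P).F d s) ((D.push P).F d (s + 1)) := fun d s =>
  if hc : V.Cell d s then naiveOp (P.pre d s hc) D p h else 0

theorem naiveOn_column (hn : NaiveInput U D p h) {d : ℕ} (h1 : V.a ≤ d) (h2 : d < V.a + V.n) :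
    D.NaiveOn p h (P.obj d) (P.len d) (P.arr d (V.lo d)) (P.arr d (V.hi d)) := by
  intro c r c1 c2 c3 c4
  have m1 : P.obj V.a ≤ P.obj d := P.obj_mono h1
  have m2 : P.obj (d + 1) ≤ P.obj (V.a + V.n) := P.obj_mono h2
  have e1 : P.obj V.a = U.a := P.first
  have e2 : P.obj (V.a + V.n) = U.a + U.n := P.last
  have c2' : c < P.obj (d + 1) := c2
  rw [P.arr_lo d h1 h2 c c1 c2] at c3
  rw [P.arr_hi d h1 h2 c c1 c2] at c4
  exact hn c r ⟨by omega, by omega, c3, c4⟩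

/-- Each cell of `V` stacks one more slice on top of the previous ones. The interchange law merges
it, with the sign `interchange`; the sign `pairExp` comes from `naiveOp` on the slice. -/
theorem vert_pushInput (hn : NaiveInput U D p h) {d s : ℕ} (h1 : V.a ≤ d) (h2 : d < V.a + V.n)
    (hs : V.lo d ≤ s) (hs' : s ≤ V.hi d) (y : (D.cat (P.obj d)).Obj) :
    (D.push P).vert (pushInput P D p h) d (V.lo d) s y = Int.negOnePow (P.colExp p d s) •
      D.hor h (P.obj d) (P.arr d (V.lo d)) (P.arr d s) (P.len d) y := by
  classical
  induction s, hs using Nat.le_induction with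
  | base =>
    refine ((D.push P).vert_self _ d (V.lo d) y).trans ?_
    -- Between equal paths there are no cells, and the pasting composite is an identity.
    have e : ∀ l, D.hor h (P.obj d) (P.arr d (V.lo d)) (P.arr d (V.lo d)) l y =
        (D.cat (P.obj d + l)).one _ := by
      intro l
      induction l with
      | zero => rfl
      | succ l ih =>
        refine (congrArg₂ (fun a b => (D.cat (P.obj d + l + 1)).comp a ((D.F _ _).map b))
          (D.vert_self h _ _ _) ih).trans ?_
        exact ((D.cat (P.obj d + l + 1)).one_comp _).trans (DGFunctor.map_one _ _)
    rw [TwoOrdMap.colExp, Finset.Ico_self, Finset.sum_empty, Int.negOnePow_zero, one_smul]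
    exact (e _).symm
  | succ s hs ih =>
    have hc : V.Cell d s := ⟨h1, h2, hs, hs'⟩
    have e1 : cmpt (pushInput P D p h d s) y = Int.negOnePow ((P.pre d s hc).pairExp p) •
        D.hor h (P.obj d) (P.arr d s) (P.arr d (s + 1)) (P.len d) y :=
      (congrArg (fun Φ => cmpt Φ y) (show pushInput P D p h d s = naiveOp (P.pre d s hc) D p h from
        dif_pos hc)).trans (cmpt_naiveOp (P.pre d s hc) D p h y)
    refine ((D.push P).vert_succ _ hs y).trans ?_
    rw [ih (by omega), e1]
    have e2 := hor_comp (D := D) (p := p) (h := h) (a := P.obj d) (l := P.len d)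
      (q := P.arr d (V.lo d)) (q' := P.arr d s) (q'' := P.arr d (s + 1))
      (P.arr_mono d h1 h2 _ _ le_rfl hs (by omega))
      (P.arr_mono d h1 h2 _ _ hs (Nat.le_succ s) hs')
      ((naiveOn_column P hn h1 h2).mono (fun _ _ _ => le_rfl)
        (P.arr_mono d h1 h2 _ _ (by omega) hs' le_rfl)) y
    have e3 : ∀ (σ τ : ℤˣ), (D.cat (P.obj d + P.len d)).comp
        (σ • D.hor h (P.obj d) (P.arr d s) (P.arr d (s + 1)) (P.len d) y)
        (τ • D.hor h (P.obj d) (P.arr d (V.lo d)) (P.arr d s) (P.len d) y) =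
        (σ * τ * Int.negOnePow (interchange p (P.obj d) (P.arr d (V.lo d)) (P.arr d s)
          (P.arr d (s + 1)) (P.len d))) •
          D.hor h (P.obj d) (P.arr d (V.lo d)) (P.arr d (s + 1)) (P.len d) y := by
      intro σ τ
      rw [DGCat.comp_units_smul, DGCat.comp_smul', e2, smul_smul, smul_smul, mul_assoc]
    refine (e3 _ _).trans ?_
    rw [← Int.negOnePow_add, ← Int.negOnePow_add, TwoOrdMap.colExp, TwoOrdMap.colExp,
      Finset.sum_Ico_succ_top hs, dif_pos hc]
    congr 2
    ring

/-- The horizontal composite of the first columns of `V`. -/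
noncomputable def pushTransf (D : Diagram.{u, v, w} k) (p : ℕ → ℕ → ℤ)
    (h : ∀ c r, ShomAmb 0 (D.F c r) (D.F c (r + 1))) (m : ℕ) : D.Transf (P.obj V.a) :=
  ⟨P.obj (V.a + m), (D.push P).path V.lo V.a m, (D.push P).path V.hi V.a m,
    (D.push P).hor (pushInput P D p h) V.a V.lo V.hi m⟩

/-- Joining the strips over consecutive columns of `V` end to end produces no sign of its own; those
of the columns accumulate. -/
theorem pushTransf_eq (hn : NaiveInput U D p h) {m : ℕ} (hm : m ≤ V.n) :
    pushTransf P D p h m = (D.horTransf h U.lo U.hi (P.obj V.a)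
      (∑ d ∈ Finset.range m, P.len (V.a + d))).sign
        (Int.negOnePow (∑ d ∈ Finset.range m, P.colExp p (V.a + d) (V.hi (V.a + d)))) := by
  induction m with
  | zero =>
    refine congrArg (Transf.mk (P.obj V.a) (DGFunctor.id _) (DGFunctor.id _))
      (funext fun x : (D.cat (P.obj V.a)).Obj => ?_)
    simp only [Finset.range_zero, Finset.sum_empty, Int.negOnePow_zero]
    exact (one_smul ℤˣ ((D.cat (P.obj V.a)).one x)).symm
  | succ m ih =>
    have ih := ih (by omega)
    have h1 : V.a ≤ V.a + m := by omega
    have h2 : V.a + m < V.a + V.n := by omega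
    have e1 : (⟨P.obj (V.a + m + 1), (D.push P).F (V.a + m) (V.lo (V.a + m)),
        (D.push P).F (V.a + m) (V.hi (V.a + m)), (D.push P).vert (pushInput P D p h) (V.a + m)
          (V.lo (V.a + m)) (V.hi (V.a + m))⟩ : D.Transf (P.obj (V.a + m))) =
        (D.horTransf h (P.arr (V.a + m) (V.lo (V.a + m))) (P.arr (V.a + m) (V.hi (V.a + m)))
          (P.obj (V.a + m)) (P.len (V.a + m))).sign
          (Int.negOnePow (P.colExp p (V.a + m) (V.hi (V.a + m)))) :=
      congrArg (Transf.mk _ _ _) (funext fun y =>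
        vert_pushInput P hn h1 h2 (V.lo_le_hi _ h1 h2) le_rfl y)
    -- The least and greatest arrows of a column go to the least and greatest paths, so the whole
    -- strip is bounded by `U.lo` and `U.hi`.
    have e0 := D.horTransf_congr h (a := P.obj (V.a + m)) (l := P.len (V.a + m))
      (P.arr_lo _ h1 h2) (P.arr_hi _ h1 h2)
    have e2 : pushTransf P D p h (m + 1) =
        ((pushTransf P D p h m).hcomp (D.horTransf h U.lo U.hi (pushTransf P D p h m).b
          (P.len (V.a + m)))).sign (Int.negOnePow (P.colExp p (V.a + m) (V.hi (V.a + m)))) :=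
      (congrArg (fun R => (pushTransf P D p h m).hcomp R)
        (e1.trans (congrArg (Transf.sign _) e0))).trans
        (Transf.hcomp_sign_right _ (pushTransf P D p h m) _)
    rw [e2, ih]
    refine (congrArg (Transf.sign _) (Transf.hcomp_sign_left _ (D.horTransf h U.lo U.hi (P.obj V.a)
      (∑ d ∈ Finset.range m, P.len (V.a + d))) _)).trans ?_
    rw [Transf.sign_sign, Finset.sum_range_succ,
      Finset.sum_range_succ, horTransf_add, ← Int.negOnePow_add, add_comm (P.colExp _ _ _)]
    rfl

theorem TwoOrdMap.obj_add (m : ℕ) :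
    P.obj (V.a + m) = P.obj V.a + ∑ d ∈ Finset.range m, P.len (V.a + d) := by
  induction m with
  | zero => rfl
  | succ m ih =>
    have : P.obj (V.a + (m + 1)) = P.obj (V.a + m) + P.len (V.a + m) := rfl
    rw [Finset.sum_range_succ]
    omega

/-- Composites of naive natural transformations are compatible with maps of 2-ordinals. -/
theorem naiveOp_comp (hn : NaiveInput U D p h) :
    HEq (naiveOp V (D.push P) (P.pushDeg p) (pushInput P D p h))
      (Int.negOnePow (P.shuffleExp p) • naiveOp U D p h) := by
  classical
  set s := Int.negOnePow (V.pairExp (P.pushDeg p)) with hs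
  set t := Int.negOnePow (∑ d ∈ Finset.range V.n, P.colExp p (V.a + d) (V.hi (V.a + d))) with ht
  have e1 : naiveOp V (D.push P) (P.pushDeg p) (pushInput P D p h) =
      ofCmpt (F := (pushTransf P D p h V.n).F) (G := (pushTransf P D p h V.n).G)
        ((pushTransf P D p h V.n).sign s).app :=
    shom_zero_ext fun x => cmpt_naiveOp V (D.push P) (P.pushDeg p) (pushInput P D p h) x
  -- The first object and the number of columns are made variables, so that their equalities with
  -- `U.a` and `U.n` can be eliminated by substitution.
  have key : ∀ a n, P.obj V.a = a → ∑ d ∈ Finset.range V.n, P.len (V.a + d) = n →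
      HEq (ofCmpt (F := (pushTransf P D p h V.n).F) (G := (pushTransf P D p h V.n).G)
        ((pushTransf P D p h V.n).sign s).app)
        (ofCmpt (F := (D.horTransf h U.lo U.hi a n).F) (G := (D.horTransf h U.lo U.hi a n).G)
          ((D.horTransf h U.lo U.hi a n).sign (s * t)).app) := by
    rintro _ _ rfl rfl
    refine Transf.heq_ofCmpt ?_
    rw [pushTransf_eq P hn le_rfl, Transf.sign_sign]
  have o1 : P.obj V.a = U.a := P.first
  have o2 : P.obj (V.a + V.n) = U.a + U.n := P.last
  have o3 := P.obj_add V.n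
  have hk := key U.a U.n o1 (by omega)
  have hsign : s * t = Int.negOnePow (P.shuffleExp p) * Int.negOnePow (U.pairExp p) := by
    rw [hs, ht, ← Int.negOnePow_add, ← Int.negOnePow_add, add_comm (P.shuffleExp p),
      ← P.pairExp_push p, sum_cells V]
    rfl
  rw [e1]
  refine hk.trans (heq_of_eq ?_)
  rw [hsign]
  refine shom_zero_ext fun x => ?_
  refine (smul_smul _ _ _).symm.trans ?_
  exact (congrArg _ (cmpt_naiveOp U D p h x).symm).trans
    (DGCat.map_units_smul (cmptLin x) (Int.negOnePow (P.shuffleExp p)) (naiveOp U D p h)).symm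

end Push

/-! ### Multilinearity, the differential, and the algebra over the trivial operad -/

section Algebra

variable {U : TwoOrd} {D : Diagram.{u, v, w} k} {p : ℕ → ℕ → ℤ}
  {h : ∀ c r, ShomAmb 0 (D.F c r) (D.F c (r + 1))}

theorem naiveOp_congr {p' : ℕ → ℕ → ℤ} {h' : ∀ c r, ShomAmb 0 (D.F c r) (D.F c (r + 1))}
    (hh : ∀ c r, U.Cell c r → p c r = p' c r ∧ h c r = h' c r) :
    naiveOp U D p h = naiveOp U D p' h' := by
  classical
  have e : U.pairExp p = U.pairExp p' := by
    refine Finset.sum_congr rfl fun f hf => Finset.sum_congr rfl fun g hg => ?_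
    rw [TwoOrd.mem_cells] at hf hg
    rw [(hh _ _ hf).1, (hh _ _ hg).1]
  rw [naiveOp, naiveOp, e, hor_congr U.pathLE
    fun c i h1 h2 h3 h4 => (hh c i ⟨h1, h2, h3, h4⟩).2]

theorem naiveOp_upd_linear {c r : ℕ} (hc : U.Cell c r) :
    ∃ L : ShomAmb 0 (D.F c r) (D.F c (r + 1)) →ₗ[k] ShomAmb 0 (D.src U) (D.tgt U),
      ∀ x, naiveOp U D p (upd h c r x) = L x := by
  choose L hL using fun x => hor_upd_linear (h := h) U.pathLE hc.1 hc.2.1 hc.2.2.1 hc.2.2.2 x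
  have hc : ∀ y x, cmpt (naiveOp U D p (upd h c r y)) x =
      ((Int.negOnePow (U.pairExp p) : ℤˣ) : ℤ) • L x y := by
    intro y x
    rw [cmpt_naiveOp, Units.smul_def, hL]
  refine ⟨⟨⟨fun y => naiveOp U D p (upd h c r y), fun y z => ?_⟩, fun a y => ?_⟩, fun x => rfl⟩
  · refine shom_zero_ext fun x => ?_
    refine (hc _ _).trans ?_
    rw [map_add, smul_add, ← hc, ← hc]
    rfl
  · refine shom_zero_ext fun x => ?_
    refine (hc _ _).trans ?_
    rw [map_smul, smul_comm, ← hc]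
    rfl

-- Raising the degree of `f` by one adds, for every pair containing `f`, the degree of the other
-- cell: the smaller cells form `leftDeg`, the larger ones the last sum.
open Classical in
theorem pairExp_upd {f : ℕ × ℕ} (hf : f ∈ U.cells) :
    U.pairExp (upd p f.1 f.2 (p f.1 f.2 + 1)) = U.pairExp p + U.leftDeg p f +
      ∑ g ∈ U.cells, if CellLT f g then p g.1 g.2 else 0 := by
  have e : ∀ g : ℕ × ℕ, upd p f.1 f.2 (p f.1 f.2 + 1) g.1 g.2 = p g.1 g.2 + if g = f then 1 else 0 := by
    intro g
    by_cases q : g = f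
    · subst q; simp [upd_same]
    · rw [upd_ne _ _ (fun q' => q (Prod.ext q'.1 q'.2)), if_neg q, add_zero]
  have e2 : ∀ x y : ℕ × ℕ, (if CellLT x y then
      (p x.1 x.2 + if x = f then 1 else 0) * (p y.1 y.2 + if y = f then 1 else 0) else 0) =
      (if CellLT x y then p x.1 x.2 * p y.1 y.2 else 0) +
      (if y = f then (if CellLT x f then p x.1 x.2 else 0) else 0) +
      (if x = f then (if CellLT f y then p y.1 y.2 else 0) else 0) := by
    intro x y
    by_cases q1 : x = f <;> by_cases q2 : y = f
    · subst q1 q2; simp [CellLT.irrefl]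
    · subst q1; simp only [q2, if_true, if_false]; split_ifs <;> ring
    · subst q2; simp only [q1, if_true, if_false]; split_ifs <;> ring
    · simp [q1, q2]
  simp only [TwoOrd.pairExp, e, e2, Finset.sum_add_distrib, TwoOrd.leftDeg]
  congr 1
  · congr 1
    refine Finset.sum_congr rfl fun x _ => ?_
    rw [Finset.sum_ite_eq' U.cells f, if_pos hf]
  · rw [Finset.sum_comm]
    refine Finset.sum_congr rfl fun y _ => ?_
    rw [Finset.sum_ite_eq' U.cells f, if_pos hf]

/-- In the composite the differential passes the cells larger than `f`, whereas in the tensor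
product it passes the smaller ones. The change of `pairExp` when the degree of `f` is raised
accounts for both, up to twice `leftDeg`. -/
theorem shomD_naiveOp (hn : NaiveInput U D p h) :
    shomD 0 (D.src U) (D.tgt U) (U.total p) (naiveOp U D p h) =
      ∑ f ∈ U.cells, Int.negOnePow (U.leftDeg p f) •
        naiveOp U D (upd p f.1 f.2 (p f.1 f.2 + 1))
          (upd h f.1 f.2 (shomD 0 (D.F f.1 f.2) (D.F f.1 (f.2 + 1)) (p f.1 f.2) (h f.1 f.2))) := by
  classical
  refine shom_zero_ext fun x => ?_
  have e1 := map_sum (cmptLin (F := D.src U) (G := D.tgt U) x) (fun f : ℕ × ℕ =>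
    Int.negOnePow (U.leftDeg p f) • naiveOp U D (upd p f.1 f.2 (p f.1 f.2 + 1))
      (upd h f.1 f.2 (shomD 0 (D.F f.1 f.2) (D.F f.1 (f.2 + 1)) (p f.1 f.2) (h f.1 f.2)))) U.cells
  refine Eq.trans ?_ e1.symm
  rw [cmpt_shomD, cmpt_naiveOp, DGCat.map_units_smul, hor_d U.pathLE hn.naiveOn,
    ← sum_cells U (fun f => Int.negOnePow (cellSum U.a U.lo U.hi U.n fun c' j =>
        if CellLT f (c', j) then p c' j else 0) •
          D.hor (D.dInput p h f.1 f.2) U.a U.lo U.hi U.n x), Finset.smul_sum]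
  refine Finset.sum_congr rfl fun f hf => ?_
  rw [DGCat.map_units_smul]
  refine Eq.trans ?_ (congrArg _ (cmpt_naiveOp U D _ _ x).symm)
  rw [smul_smul, smul_smul, ← Int.negOnePow_add, ← Int.negOnePow_add, pairExp_upd hf,
    sum_cells U (fun g => if CellLT f g then p g.1 g.2 else 0)]
  refine congrArg₂ (fun (σ : ℤˣ) m => σ • m) ?_ rfl
  rw [Int.negOnePow_eq_iff]
  exact ⟨-U.leftDeg p f, by ring⟩

end Algebra

/-- The algebra structure over the trivial operad on the naive natural transformations. -/
noncomputable def naiveAlgebra (k : Type u) [CommRing k] : HomAlgebra.{u, v, w} k trivOperad where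
  op {U _ _} _ D p h := naiveOp U D p h
  op_congr _ _ _ _ _ _ hh := naiveOp_congr hh
  op_mem _ _ _ _ hn := naiveOp_mem hn
  op_add _ D p h _ c r hc x _ y _ := by
    obtain ⟨L, hL⟩ := naiveOp_upd_linear (D := D) (p := p) (h := h) hc
    rw [hL, hL, hL, map_add]
  op_smul _ D p h _ c r hc a x _ := by
    obtain ⟨L, hL⟩ := naiveOp_upd_linear (D := D) (p := p) (h := h) hc
    rw [hL, hL, map_smul]
  op_d _ _ _ _ hn := shomD_naiveOp hn
  op_comp P _ _ _ _ _ _ _ _ hn := naiveOp_comp P hn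

end

theorem mainTheorem5 (k : Type u) [CommRing k] :
    -- `hom^•` is a constant cosimplicial subcomplex of `shom^•`
    (∀ (A B : DGCat.{u, v, w} k) (F G : DGFunctor A B) (p : ℤ), ∀ Φ ∈ naive F G p,
      shomD 0 F G p Φ ∈ naive F G (p + 1) ∧
      (∀ n : ℕ, naiveIncl n F G p Φ ∈ shomDeg n F G p ∧
        shomD n F G p (naiveIncl n F G p Φ) = naiveIncl n F G (p + 1) (shomD 0 F G p Φ) ∧
        (∀ Ψ ∈ naive F G p, naiveIncl n F G p Φ = naiveIncl n F G p Ψ → Φ = Ψ)) ∧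
      (∀ (m n : ℕ) (σ : Fin (m + 1) →o Fin (n + 1)),
        cosimp F G p σ (naiveIncl m F G p Φ) = naiveIncl n F G p Φ)) ∧
    -- `hom^•` is closed under the action of `seq` on `shom^•`
    (∀ {U : TwoOrd} {I : ℕ → ℕ → ℕ} {J : ℕ} (e : seqOperad.obj U I J) (D : Diagram.{u, v, w} k)
      (p : ℕ → ℕ → ℤ) (h : ∀ c r, ShomAmb (I c r) (D.F c r) (D.F c (r + 1))),
      (∀ c r, U.Cell c r → h c r ∈ constNaive (I c r) (D.F c r) (D.F c (r + 1)) (p c r)) →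
      SeqOp.act e D p h ∈ constNaive J (D.src U) (D.tgt U) (U.total p)) ∧
    -- the restricted action is an algebra structure, pulled back from the trivial operad
    (∃ τ : HomAlgebra.{u, v, w} k trivOperad,
      ∀ {U : TwoOrd} {I : ℕ → ℕ → ℕ} {J : ℕ} (e : seqOperad.obj U I J) (D : Diagram.{u, v, w} k)
        (p : ℕ → ℕ → ℤ) (h : ∀ c r, ShomAmb 0 (D.F c r) (D.F c (r + 1))), NaiveInput U D p h →
        SeqOp.act e D p (fun c r => naiveIncl (I c r) (D.F c r) (D.F c (r + 1)) (p c r) (h c r)) =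
          naiveIncl J (D.src U) (D.tgt U) (U.total p) ((τ.pullback seqProj).op e D p h)) := by
  refine ⟨fun A B F G p Φ hΦ => ⟨shomD_naive hΦ, fun n => ⟨naiveIncl_mem n hΦ,
    shomD_naiveIncl n p Φ, fun Ψ _ h => naiveIncl_injective n p h⟩,
    fun m n σ => cosimp_naiveIncl σ hΦ⟩,
    fun e D p h hh => SeqOp.act_mem_constNaive e D p h hh,
    naiveAlgebra k, fun e D p h hn => SeqOp.act_naiveIncl e D p h hn⟩
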